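/- **Proposition 3.7.** Let $\mathcal N\ge 1$ be square-free, $k\ge 4$ an integer and $\chi$ a Dirichlet character modulo $\mathcal N$. For $d\mid\mathcal N$ let $\chi_d$ be the component of $\chi$ modulo $d$ (so $\chi=\chi_d\chi_{\mathcal N/d}$ with $\chi_d$ a character modulo $d$ and $\chi_{\mathcal N/d}$ a character modulo $\mathcal N/d$). Let $\Gamma_0(\mathcal N)=\{\begin{pmatrix}A&B\\C&D\end{pmatrix}\in Sp_2(\mathbb Z): C\equiv 0\ (\mathcal N)\}$ (here $Sp_2(\mathbb Z)$ is the group of $4\times4$ integral symplectic matrices), and let $\Gamma_\infty^+$ be the group of all $\begin{pmatrix}*&*\\0&D\end{pmatrix}\in Sp_2(\mathbb Z)$ with $\det D=1$. For $\tau=X+iY$ in the degree 2 Siegel upper half space ($X,Y$ real symmetric $2\times 2$ matrices, $Y>0$), a function $f$ on it, and a real matrix $g=\begin{pmatrix}A&B\\C&D\end{pmatrix}$ with $\det g>0$ that acts on it, put $$(f|g)(\tau)=(\det g)^{k/2}\det(C\tau+D)^{-k}f\big((A\tau+B)(C\tau+D)^{-1}\big).$$ For a factorization $\rho=(\mathcal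 N_0,\mathcal N_1,\mathcal N_2)$, $\mathcal N_0\mathcal N_1\mathcal N_2=\mathcal N$, put $\gamma_\rho=\begin{pmatrix}I&0\\M_\rho&I\end{pmatrix}$, where $M_\rho$ is an integral diagonal matrix congruent, modulo each prime $p\mid\mathcal N$, to $0$, $\begin{pmatrix}1&\\&0\end{pmatrix}$ or $I$ according as $p\mid\mathcal N_0$, $p\mid\mathcal N_1$ or $p\mid\mathcal N_2$. If $\chi_{\mathcal N_1}^2=1$, the Eisenstein series of weight $k$, level $\mathcal N$ and character $\chi$ at the cusp $\rho$ is $$\mathbb E_\rho(\tau)=\tfrac12\sum_{\gamma}\overline\chi(\det D_\gamma)\,(1|\gamma_\rho\gamma)(\tau),$$ where $\gamma=\begin{pmatrix}*&*\\ *&D_\gamma\end{pmatrix}\in\Gamma_0(\mathcal N)$ varies so that $\Gamma_\infty^+\gamma_\rho\gamma$ runs once over the $\Gamma_0(\mathcal N)$-orbit of $\Gamma_\infty^+\gamma_\rho$. For a prime $p$ let $$f|T(p)=p^{k-3}\sum_\gamma\overline\chi(\det D_\gamma)\,f|\delta^{-1}\gamma,\qquad \delta=\begin{pmatrix}pI_2&\\&I_2\end{pmatrix},$$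 where $\gamma$ varies over representatives of $(\delta\Gamma_0(\mathcal N)\delta^{-1}\cap\Gamma_0(\mathcal N))\backslash\Gamma_0(\mathcal N)$. Fix $\rho=(\mathcal N_0,\mathcal N_1,\mathcal N_2)$ with $\mathcal N_0\mathcal N_1\mathcal N_2=\mathcal N$ and $\chi_{\mathcal N_1}^2=1$, let $q$ be a prime dividing $\mathcal N_0$, and set $\rho'=(\mathcal N_0/q,\,q\mathcal N_1,\,\mathcal N_2)$, $\rho''=(\mathcal N_0/q,\,\mathcal N_1,\,q\mathcal N_2)$. Then $$\mathbb E_\rho|T(q)=\begin{cases}\chi_{\mathcal N_1}(q)\chi_{\mathcal N_2}(q^2)\big(\mathbb E_\rho+q^{-1}(q-1)\mathbb E_{\rho'}+q^{-1}(q-1)\mathbb E_{\rho''}\big)&\text{if }\chi_q=1,\\[2pt] \chi_{\mathcal N_1}(q)\chi_{\mathcal N_2}(q^2)\big(\mathbb E_\rho+\left(\tfrac{-1}{q}\right)q^{-2}(q-1)\mathbb E_{\rho''}\big)&\text{if }\chi_q^2=1,\ \chi_q\ne1,\\[2pt] \chi_{\mathcal N_1}(q)\chi_{\mathcal N_2}(q^2)\,\mathbb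 E_\rho&\text{if }\chi_q^2\ne1,\end{cases}$$ where $\left(\frac{-1}{q}\right)$ is the Legendre symbol (in the second case $q$ is odd, since the only character modulo $2$ is trivial). -/

import Mathlib

noncomputable section

namespace SiegelTwo

open Matrix

/-- `Sp₂(ℤ)`: the group of `4 × 4` integral symplectic matrices. An element is written in `2 × 2`
blocks `(A B; C D)`. -/
abbrev Sp : Type := Matrix.symplecticGroup (Fin 2) ℤ

/-- The block `C` of `γ = (A B; C D)`. -/
def blockC (γ : Sp) : Matrix (Fin 2) (Fin 2) ℤ := (γ : Matrix (Fin 2 ⊕ Fin 2) (Fin 2 ⊕ Fin 2) ℤ).toBlocks₂₁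

/-- The block `D` of `γ = (A B; C D)`. -/
def blockD (γ : Sp) : Matrix (Fin 2) (Fin 2) ℤ := (γ : Matrix (Fin 2 ⊕ Fin 2) (Fin 2 ⊕ Fin 2) ℤ).toBlocks₂₂

/-- The block `A` of `γ = (A B; C D)`. -/
def blockA (γ : Sp) : Matrix (Fin 2) (Fin 2) ℤ := (γ : Matrix (Fin 2 ⊕ Fin 2) (Fin 2 ⊕ Fin 2) ℤ).toBlocks₁₁

theorem blockC_one : blockC 1 = 0 := by
  ext i j; simp [blockC, toBlocks₂₁]

theorem blockD_one : blockD 1 = 1 := by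
  ext i j; simp [blockD, toBlocks₂₂, Matrix.one_apply]

theorem blockC_mul (γ η : Sp) :
    blockC (γ * η) = blockC γ * blockA η + blockD γ * blockC η := by
  ext i j
  simp [blockC, blockA, blockD, toBlocks₂₁, toBlocks₁₁, toBlocks₂₂, Matrix.mul_apply]

theorem blockD_mul (γ η : Sp) :
    ∃ B : Matrix (Fin 2) (Fin 2) ℤ, blockD (γ * η) = blockC γ * B + blockD γ * blockD η := by
  refine ⟨(η : Matrix (Fin 2 ⊕ Fin 2) (Fin 2 ⊕ Fin 2) ℤ).toBlocks₁₂, ?_⟩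
  ext i j
  simp [blockC, blockD, toBlocks₂₁, toBlocks₁₂, toBlocks₂₂, Matrix.mul_apply]

theorem blockC_inv (γ : Sp) : blockC γ⁻¹ = -(blockC γ)ᵀ := by
  obtain ⟨M, hM⟩ := γ
  ext i j
  simp [blockC, SymplecticGroup.coe_inv, Matrix.J, toBlocks₂₁, Matrix.mul_apply,
    Matrix.fromBlocks, Matrix.one_apply]

/-- `Γ∞⁺`: the matrices `(* *; 0 D)` in `Sp₂(ℤ)` with `det D = 1`. It has index two in the group
`Γ∞` of all `(* *; 0 D)` in `Sp₂(ℤ)` (where `det D = ±1`). -/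
def GammaInfPlus : Subgroup Sp where
  carrier := {γ | blockC γ = 0 ∧ (blockD γ).det = 1}
  one_mem' := ⟨blockC_one, by rw [blockD_one, det_one]⟩
  mul_mem' := by
    rintro γ η ⟨h1, h2⟩ ⟨h3, h4⟩
    obtain ⟨B, hB⟩ := blockD_mul γ η
    refine ⟨by rw [blockC_mul, h1, h3]; simp, ?_⟩
    rw [hB, h1, Matrix.zero_mul, zero_add, det_mul, h2, h4, mul_one]
  inv_mem' := by
    rintro γ ⟨h1, h2⟩
    refine ⟨by rw [blockC_inv, h1]; simp, ?_⟩
    obtain ⟨B, hB⟩ := blockD_mul γ γ⁻¹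
    rw [mul_inv_cancel, blockD_one, h1, Matrix.zero_mul, zero_add] at hB
    have := congrArg Matrix.det hB
    rw [det_mul, h2, one_mul, det_one] at this
    exact this.symm

/-- `Γ₀(N)`: the matrices `(A B; C D)` in `Sp₂(ℤ)` with `C ≡ 0 (mod N)`. -/
def Gamma0 (N : ℕ) : Subgroup Sp where
  carrier := {γ | ∀ i j, (N : ℤ) ∣ blockC γ i j}
  one_mem' := by intro i j; rw [blockC_one]; simp
  mul_mem' := by
    intro γ η h1 h2 i j
    rw [blockC_mul, Matrix.add_apply, Matrix.mul_apply, Matrix.mul_apply]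
    exact dvd_add (Finset.dvd_sum fun x _ => (h1 i x).mul_right _)
      (Finset.dvd_sum fun x _ => (h2 x j).mul_left _)
  inv_mem' := by
    intro γ h i j
    rw [blockC_inv, Matrix.neg_apply, Matrix.transpose_apply]
    exact (h j i).neg_right

/-- The degree 2 Siegel upper half space: `τ = X + iY` with `X, Y` real symmetric, `Y > 0`. -/
def upperHalf : Set (Matrix (Fin 2) (Fin 2) ℂ) :=
  {τ | τ.IsSymm ∧ (τ.map Complex.im).PosDef}

/-- `C τ + D` for a real `4 × 4` matrix `g = (A B; C D)`. -/
def denom (g : Matrix (Fin 2 ⊕ Fin 2) (Fin 2 ⊕ Fin 2) ℝ) (τ : Matrix (Fin 2) (Fin 2) ℂ) :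
    Matrix (Fin 2) (Fin 2) ℂ :=
  g.toBlocks₂₁.map Complex.ofReal * τ + g.toBlocks₂₂.map Complex.ofReal

/-- `g ∘ τ = (A τ + B)(C τ + D)⁻¹` for a real `4 × 4` matrix `g = (A B; C D)`. -/
def act (g : Matrix (Fin 2 ⊕ Fin 2) (Fin 2 ⊕ Fin 2) ℝ) (τ : Matrix (Fin 2) (Fin 2) ℂ) :
    Matrix (Fin 2) (Fin 2) ℂ :=
  (g.toBlocks₁₁.map Complex.ofReal * τ + g.toBlocks₁₂.map Complex.ofReal) * (denom g τ)⁻¹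

/-- The weight `k` action
`(f | g)(τ) = (det g)^{k/2} det(C τ + D)^{-k} f(g ∘ τ)`, for real `g = (A B; C D)`, `det g > 0`. -/
def slash (k : ℕ) (f : Matrix (Fin 2) (Fin 2) ℂ → ℂ)
    (g : Matrix (Fin 2 ⊕ Fin 2) (Fin 2 ⊕ Fin 2) ℝ) (τ : Matrix (Fin 2) (Fin 2) ℂ) : ℂ :=
  ((g.det ^ ((k : ℝ) / 2) : ℝ) : ℂ) * (denom g τ).det ^ (-(k : ℤ)) * f (act g τ)

/-- An integral symplectic matrix, viewed as a real matrix. -/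
def toReal (γ : Sp) : Matrix (Fin 2 ⊕ Fin 2) (Fin 2 ⊕ Fin 2) ℝ :=
  (γ : Matrix (Fin 2 ⊕ Fin 2) (Fin 2 ⊕ Fin 2) ℤ).map (Int.cast : ℤ → ℝ)

/-- The subgroup `γ₀⁻¹ Γ∞⁺ γ₀ ∩ Γ₀(N)` of `Γ₀(N)`. Its right cosets (the classes `H γ`)
correspond bijectively, through `γ ↦ Γ∞⁺ γ₀ γ`, to the classes `Γ∞⁺ γ₀ γ` in the
`Γ₀(N)`-orbit of `Γ∞⁺ γ₀`. -/
def cuspStabilizer (N : ℕ) (γ₀ : Sp) : Subgroup (Gamma0 N) :=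
  (GammaInfPlus.comap (MulAut.conj γ₀).toMonoidHom).subgroupOf (Gamma0 N)

/-- The Eisenstein series attached to `γ₀`:
`𝔼_{γ₀}(τ) = ½ ∑ conj χ(det D_γ) · (1 | γ₀ γ)(τ)`, where `γ ∈ Γ₀(N)` and the classes `Γ∞⁺ γ₀ γ`
run once through the `Γ₀(N)`-orbit of `Γ∞⁺ γ₀`. When `χ(-1) = (-1)^k` the summand depends only on
`Γ∞ γ₀ γ`, each such class splits into two classes modulo `Γ∞⁺`, and this is the sum over the orbit
of `Γ∞ γ₀`; when `χ(-1) ≠ (-1)^k` the two classes cancel. -/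
def eisenstein (N : ℕ) (χ : DirichletCharacter ℂ N) (k : ℕ) (γ₀ : Sp)
    (τ : Matrix (Fin 2) (Fin 2) ℂ) : ℂ :=
  (1 / 2) * ∑' c : Quotient (QuotientGroup.rightRel (cuspStabilizer N γ₀)),
    (starRingEnd ℂ) (χ ((blockD (c.out : Gamma0 N)).det : ZMod N)) *
      slash k (fun _ => 1) (toReal (γ₀ * (c.out : Gamma0 N))) τ

/-- The diagonal matrix `M_ρ` for `ρ = (N₀, N₁, N₂)`. If `N₀ N₁ N₂` is square-free, the upper left
entry is `0` mod `N₀` and `1` mod `N₁ N₂`, and the lower right entry is `0` mod `N₀ N₁` and `1`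
mod `N₂`; that is, modulo a prime `q`, `M_ρ` is `0`, `diag(1, 0)`, `I` according as `q ∣ N₀`,
`q ∣ N₁`, `q ∣ N₂`. -/
def cuspMatrix (N₀ N₁ N₂ : ℕ) : Matrix (Fin 2) (Fin 2) ℤ :=
  Matrix.diagonal ![(N₀ : ℤ) ^ (N₁ * N₂).totient, ((N₀ * N₁ : ℕ) : ℤ) ^ N₂.totient]

/-- `γ_ρ = (I 0; M_ρ I)`. -/
def cusp (N₀ N₁ N₂ : ℕ) : Sp :=
  ⟨Matrix.fromBlocks 1 0 (cuspMatrix N₀ N₁ N₂) 1, by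
    rw [SymplecticGroup.fromBlocks_mem_iff]
    simp [cuspMatrix, Matrix.diagonal_transpose]⟩

/-- `𝔼_ρ = 𝔼_{γ_ρ}` of level `N`, character `χ` and weight `k`, for `ρ = (N₀, N₁, N₂)`. -/
def eisensteinCusp (N : ℕ) (χ : DirichletCharacter ℂ N) (k : ℕ) (N₀ N₁ N₂ : ℕ) :
    Matrix (Fin 2) (Fin 2) ℂ → ℂ :=
  eisenstein N χ k (cusp N₀ N₁ N₂)

/-- The integral matrix `δ = diag(p I, I)`. -/
def heckeDelta (p : ℕ) : Matrix (Fin 2 ⊕ Fin 2) (Fin 2 ⊕ Fin 2) ℤ :=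
  Matrix.fromBlocks ((p : ℤ) • 1) 0 0 1

/-- The subgroup `δ Γ₀(N) δ⁻¹ ∩ Γ₀(N)` of `Γ₀(N)`: those `γ` with `γ = δ g δ⁻¹` (that is,
`γ δ = δ g`) for some `g ∈ Γ₀(N)`. -/
def heckeSubgroup (N p : ℕ) : Subgroup (Gamma0 N) where
  carrier := {γ | ∃ g : Gamma0 N,
    ((γ : Sp) : Matrix (Fin 2 ⊕ Fin 2) (Fin 2 ⊕ Fin 2) ℤ) * heckeDelta p =
      heckeDelta p * ((g : Sp) : Matrix (Fin 2 ⊕ Fin 2) (Fin 2 ⊕ Fin 2) ℤ)}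
  one_mem' := ⟨1, by simp⟩
  mul_mem' := by
    rintro γ η ⟨g, hg⟩ ⟨h, hh⟩
    refine ⟨g * h, ?_⟩
    push_cast
    rw [Matrix.mul_assoc, hh, ← Matrix.mul_assoc, hg, Matrix.mul_assoc]
  inv_mem' := by
    rintro γ ⟨g, hg⟩
    refine ⟨g⁻¹, ?_⟩
    have h1 : (((γ⁻¹ : Gamma0 N) : Sp) : Matrix (Fin 2 ⊕ Fin 2) (Fin 2 ⊕ Fin 2) ℤ) *
        ((γ : Sp) : Matrix (Fin 2 ⊕ Fin 2) (Fin 2 ⊕ Fin 2) ℤ) = 1 := by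
      have : (γ⁻¹ : Gamma0 N) * γ = 1 := inv_mul_cancel γ
      simpa only [Subgroup.coe_mul, Submonoid.coe_mul, Subgroup.coe_one, Submonoid.coe_one] using
        congrArg (fun x : Gamma0 N => ((x : Sp) : Matrix (Fin 2 ⊕ Fin 2) (Fin 2 ⊕ Fin 2) ℤ)) this
    have h2 : ((g : Sp) : Matrix (Fin 2 ⊕ Fin 2) (Fin 2 ⊕ Fin 2) ℤ) *
        (((g⁻¹ : Gamma0 N) : Sp) : Matrix (Fin 2 ⊕ Fin 2) (Fin 2 ⊕ Fin 2) ℤ) = 1 := by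
      have : g * (g⁻¹ : Gamma0 N) = 1 := mul_inv_cancel g
      simpa only [Subgroup.coe_mul, Submonoid.coe_mul, Subgroup.coe_one, Submonoid.coe_one] using
        congrArg (fun x : Gamma0 N => ((x : Sp) : Matrix (Fin 2 ⊕ Fin 2) (Fin 2 ⊕ Fin 2) ℤ)) this
    calc _ = (((γ⁻¹ : Gamma0 N) : Sp) : Matrix (Fin 2 ⊕ Fin 2) (Fin 2 ⊕ Fin 2) ℤ) *
          ((heckeDelta p * ((g : Sp) : Matrix (Fin 2 ⊕ Fin 2) (Fin 2 ⊕ Fin 2) ℤ)) *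
          (((g⁻¹ : Gamma0 N) : Sp) : Matrix (Fin 2 ⊕ Fin 2) (Fin 2 ⊕ Fin 2) ℤ)) := by
          rw [Matrix.mul_assoc (heckeDelta p), h2, Matrix.mul_one]
      _ = _ := by
          rw [← hg, ← Matrix.mul_assoc, ← Matrix.mul_assoc, h1, Matrix.one_mul]

/-- The Hecke operator `T(p)` on forms of weight `k`, level `N`, character `χ`:
`f | T(p) = p^{k-3} ∑_γ conj χ(det D_γ) f | δ⁻¹ γ`, with `γ` running over representatives of
`(δ Γ₀(N) δ⁻¹ ∩ Γ₀(N)) \ Γ₀(N)`, a finite set. -/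
def heckeT (N : ℕ) (χ : DirichletCharacter ℂ N) (k p : ℕ) (f : Matrix (Fin 2) (Fin 2) ℂ → ℂ)
    (τ : Matrix (Fin 2) (Fin 2) ℂ) : ℂ :=
  (p : ℂ) ^ ((k : ℤ) - 3) *
    ∑ᶠ c : Quotient (QuotientGroup.rightRel (heckeSubgroup N p)),
      (starRingEnd ℂ) (χ ((blockD (c.out : Gamma0 N)).det : ZMod N)) *
        slash k f (((heckeDelta p).map (Int.cast : ℤ → ℝ))⁻¹ * toReal (c.out : Gamma0 N)) τ

/-- The component `χ_d` modulo `d` of a Dirichlet character `χ` modulo `N`, for `d ∣ N` with `d` and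
`N / d` coprime: `χ_d(a) = χ(b)` where `b ≡ a (mod d)` and `b ≡ 1 (mod N / d)`. Thus
`χ = χ_d χ_{N/d}`. (For all other `d` the value is the trivial character.) -/
def charPart {N : ℕ} (χ : DirichletCharacter ℂ N) (d : ℕ) : DirichletCharacter ℂ d :=
  if h : d.Coprime (N / d) ∧ d * (N / d) = N then
    { toFun := fun a => χ (ZMod.ringEquivCongr h.2 ((ZMod.chineseRemainder h.1).symm (a, 1)))
      map_one' := by
        rw [show ((1 : ZMod d), (1 : ZMod (N / d))) = 1 from rfl]
        simp
      map_mul' := fun a b => by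
        rw [← map_mul, ← map_mul, ← map_mul, Prod.mk_mul_mk, mul_one]
      map_nonunit' := fun a ha => by
        apply MulChar.map_nonunit
        intro hu
        have h1 := (MulEquiv.isUnit_map (ZMod.ringEquivCongr h.2)).1 hu
        have h2 := (MulEquiv.isUnit_map (ZMod.chineseRemainder h.1).symm).1 h1
        exact ha (Prod.isUnit_iff.1 h2).1 }
  else 1

end SiegelTwo

end

noncomputable section

namespace SiegelTwo

open Matrix

/-! A class `Γ∞⁺ γ` is determined by the `2 × 2` minors of the lower half `(C D)`
(`pluecker_eq_iff`). Because `C Dᵀ` is symmetric there are five independent ones: `b = det C`, `e =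
det D` and the entries `x, y, z` of the symmetric matrix `adj(D) C`. They satisfy `b e = x z - y²`,
and `det(Cτ + D) = b det τ + x τ₀₀ + 2 y τ₀₁ + z τ₁₁ + e` is linear in them.

In these coordinates `𝔼_ρ` becomes `½ ∑ w_ρ(u) det(Cτ + D)^{-k}` over all matrices of minors `u`
(`eisensteinCusp_eq_tsum`), where `w_ρ` is a product of local weights over the primes `r ∣ N`. For
`r ∣ N₀` the weight is `conj χ_r(e)`, supported on `b = x = y = z = 0` modulo `r`. For `r ∣ N₁` it
is `conj χ_r` of a nonzero diagonal entry of `adj(D) C`, supported on `b = 0` and `(x, z) ≠ 0`; the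
choice of entry does not matter since `χ_r² = 1`. For `r ∣ N₂` it is `χ_r(b)`. That these local
shapes cut out exactly the orbit of the cusp is `exists_gamma0_of_hasCuspType`, together with
`localWeight_pluecker`.

As `q ∣ N`, the operator `T(q)` is a sum over `(1 S; 0 1)` with `S` symmetric modulo `q`
(`bijective_heckeRep`). The matrix `δ` scales `(b, x, y, z, e)` to `(q²b, qx, qy, qz, e)`. At primes
other than `q` this only produces a constant, in total `χ_{N₁}(q) χ_{N₂}(q²)` (`prod_deltaFactor`).
At `q` the support condition becomes automatic, and the sum over `S` leaves the character sum `∑_S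
conj χ_q(b det S - x s₁ - 2 y s₂ - z s₃ + e)`.

The value of this sum depends on the type of `u` modulo `q`, and the three types are the supports of
the local weights of `ρ`, `ρ'`, `ρ''`. If `b = x = y = z = 0` the sum is `q³ conj χ_q(e)`. If `b =
0` and `(x, z) ≠ 0` it is `q² ∑ conj χ_q`. If `b ≠ 0`, completing the square reduces it to `∑_S conj
χ_q(det S)`. The cases of the theorem are read off in `sum_star_charPart`. Combining the series
needs absolute convergence, which follows from `|det(Cτ + D)| ≥ c · size u` and a divisor bound for
the number of `b` dividing `x z - y²`. -/

/-- Integral `4 × 4` matrices in `2 × 2` blocks. -/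
abbrev Mat4 : Type := Matrix (Fin 2 ⊕ Fin 2) (Fin 2 ⊕ Fin 2) ℤ

/-! ### Minors of the lower half of a symplectic matrix. -/

section Symplectic

/-- The alternating form whose value on two vectors is the minor of their last two coordinates. -/
def volForm : Mat4 := fromBlocks 0 0 0 !![0, 1; -1, 0]

/-- The skew matrix of `2 × 2` minors of the lower half `(C D)` of `γ`: a complete invariant of the
class `Γ∞⁺ γ`. -/
def pluecker (γ : Sp) : Mat4 := (γ : Mat4)ᵀ * volForm * (γ : Mat4)

theorem pluecker_mul (γ η : Sp) :
    pluecker (γ * η) = (η : Mat4)ᵀ * pluecker γ * (η : Mat4) := by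
  simp only [pluecker, Submonoid.coe_mul, transpose_mul, Matrix.mul_assoc]

theorem pluecker_apply (γ : Sp) (x y : Fin 2 ⊕ Fin 2) :
    pluecker γ x y = (γ : Mat4) (.inr 0) x * (γ : Mat4) (.inr 1) y
      - (γ : Mat4) (.inr 1) x * (γ : Mat4) (.inr 0) y := by
  simp [pluecker, volForm, Matrix.mul_apply, Fin.sum_univ_two]
  ring

theorem pluecker_skew (γ : Sp) (x y : Fin 2 ⊕ Fin 2) : pluecker γ x y = -pluecker γ y x := by
  rw [pluecker_apply, pluecker_apply]; ring

theorem blockC_apply (γ : Sp) (i j : Fin 2) : blockC γ i j = (γ : Mat4) (.inr i) (.inl j) := rfl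
theorem blockD_apply (γ : Sp) (i j : Fin 2) : blockD γ i j = (γ : Mat4) (.inr i) (.inr j) := rfl

theorem coe_mul_coe_inv (γ : Sp) : (γ : Mat4) * ((γ⁻¹ : Sp) : Mat4) = 1 := by
  rw [← Submonoid.coe_mul, mul_inv_cancel, Submonoid.coe_one]

theorem coe_inv_mul_coe (γ : Sp) : ((γ⁻¹ : Sp) : Mat4) * (γ : Mat4) = 1 := by
  rw [← Submonoid.coe_mul, inv_mul_cancel, Submonoid.coe_one]

/-- For the converse: every column of `C` has vanishing minor with both columns of `D`, and `det D =
1`, so Cramer's rule gives `C = 0`. -/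
theorem mem_gammaInfPlus_iff (γ : Sp) : γ ∈ GammaInfPlus ↔ pluecker γ = volForm := by
  constructor
  · rintro ⟨hC, hD⟩
    have hc : ∀ i j, (γ : Mat4) (.inr i) (.inl j) = 0 := fun i j => by
      rw [← blockC_apply, hC]; rfl
    rw [det_fin_two] at hD
    simp only [blockD_apply] at hD
    ext x y
    rw [pluecker_apply]
    rcases x with x | x <;> rcases y with y | y <;> fin_cases x <;> fin_cases y <;>
      simp [hc, volForm] <;> linarith
  · intro h
    have key : ∀ x y, (γ : Mat4) (.inr 0) x * (γ : Mat4) (.inr 1) y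
      - (γ : Mat4) (.inr 1) x * (γ : Mat4) (.inr 0) y = volForm x y := fun x y => by
      rw [← pluecker_apply, h]
    have hD := key (.inr 0) (.inr 1)
    simp [volForm] at hD
    have hX : ∀ i j, (γ : Mat4) (.inr 0) (.inl i) * (γ : Mat4) (.inr 1) (.inr j)
      - (γ : Mat4) (.inr 1) (.inl i) * (γ : Mat4) (.inr 0) (.inr j) = 0 := fun i j => by
      rw [key]; simp [volForm]
    refine ⟨?_, ?_⟩
    · ext i j
      rw [blockC_apply]
      have h0 := hX j 0
      have h1 := hX j 1
      fin_cases i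
      · simp only [Fin.zero_eta, Matrix.zero_apply]
        linear_combination (-(γ : Mat4) (.inr 0) (.inl j)) * hD
          + (γ : Mat4) (.inr 0) (.inr 0) * h1 - (γ : Mat4) (.inr 0) (.inr 1) * h0
      · simp only [Fin.mk_one, Matrix.zero_apply]
        linear_combination (-(γ : Mat4) (.inr 1) (.inl j)) * hD
          + (γ : Mat4) (.inr 1) (.inr 0) * h1 - (γ : Mat4) (.inr 1) (.inr 1) * h0
    · rw [det_fin_two]
      simp only [blockD_apply]
      linarith

theorem pluecker_eq_iff (γ η : Sp) : pluecker γ = pluecker η ↔ γ * η⁻¹ ∈ GammaInfPlus := by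
  rw [mem_gammaInfPlus_iff, pluecker_mul]
  constructor
  · intro h
    rw [h, pluecker]
    calc _ = ((η : Mat4) * ((η⁻¹ : Sp) : Mat4))ᵀ * volForm * ((η : Mat4) * ((η⁻¹ : Sp) : Mat4)) := by
          simp only [transpose_mul, Matrix.mul_assoc]
      _ = _ := by rw [coe_mul_coe_inv]; simp
  · intro h
    rw [pluecker.eq_def η, ← h]
    symm
    calc _ = (((η⁻¹ : Sp) : Mat4) * (η : Mat4))ᵀ * pluecker γ * (((η⁻¹ : Sp) : Mat4) * (η : Mat4)) := by
          simp only [transpose_mul, Matrix.mul_assoc]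
      _ = _ := by rw [coe_inv_mul_coe]; simp

theorem pluecker_mul_left {u : Sp} (hu : u ∈ GammaInfPlus) (γ : Sp) :
    pluecker (u * γ) = pluecker γ := by
  rw [pluecker_eq_iff]; simpa using hu

/-- The relations `CᵀA = AᵀC`, `BᵀD = DᵀB`, `AᵀD - CᵀB = 1` in coordinates. -/
theorem symplectic_relations (γ : Sp) :
    ((γ : Mat4) (.inl 0) (.inl 0) * (γ : Mat4) (.inr 0) (.inl 1)
      + (γ : Mat4) (.inl 1) (.inl 0) * (γ : Mat4) (.inr 1) (.inl 1)
      = (γ : Mat4) (.inr 0) (.inl 0) * (γ : Mat4) (.inl 0) (.inl 1)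
      + (γ : Mat4) (.inr 1) (.inl 0) * (γ : Mat4) (.inl 1) (.inl 1)) ∧
    ((γ : Mat4) (.inl 0) (.inr 0) * (γ : Mat4) (.inr 0) (.inr 1)
      + (γ : Mat4) (.inl 1) (.inr 0) * (γ : Mat4) (.inr 1) (.inr 1)
      = (γ : Mat4) (.inr 0) (.inr 0) * (γ : Mat4) (.inl 0) (.inr 1)
      + (γ : Mat4) (.inr 1) (.inr 0) * (γ : Mat4) (.inl 1) (.inr 1)) ∧
    ∀ i j, (γ : Mat4) (.inl 0) (.inl i) * (γ : Mat4) (.inr 0) (.inr j)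
      + (γ : Mat4) (.inl 1) (.inl i) * (γ : Mat4) (.inr 1) (.inr j)
      - (γ : Mat4) (.inr 0) (.inl i) * (γ : Mat4) (.inl 0) (.inr j)
      - (γ : Mat4) (.inr 1) (.inl i) * (γ : Mat4) (.inl 1) (.inr j) = if i = j then 1 else 0 := by
  have h := SymplecticGroup.mem_iff'.1 γ.2
  have key := fun x y => congrFun (congrFun h x) y
  refine ⟨?_, ?_, ?_⟩
  · have := key (.inl 0) (.inl 1)
    simp [Matrix.mul_apply, Matrix.J, Fin.sum_univ_two, Matrix.one_apply] at this
    linarith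
  · have := key (.inr 0) (.inr 1)
    simp [Matrix.mul_apply, Matrix.J, Fin.sum_univ_two, Matrix.one_apply] at this
    linarith
  · intro i j
    have := key (.inl i) (.inr j)
    simp [Matrix.mul_apply, Matrix.J, Fin.sum_univ_two, Matrix.one_apply] at this
    split_ifs at this ⊢ <;> linarith

/-- The relations `CDᵀ = DCᵀ`, `ADᵀ - BCᵀ = 1` in coordinates. -/
theorem symplectic_relations_transpose (γ : Sp) :
    ((γ : Mat4) (.inr 0) (.inl 0) * (γ : Mat4) (.inr 1) (.inr 0)
      + (γ : Mat4) (.inr 0) (.inl 1) * (γ : Mat4) (.inr 1) (.inr 1)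
      = (γ : Mat4) (.inr 0) (.inr 0) * (γ : Mat4) (.inr 1) (.inl 0)
      + (γ : Mat4) (.inr 0) (.inr 1) * (γ : Mat4) (.inr 1) (.inl 1)) ∧
    ∀ i j, (γ : Mat4) (.inl i) (.inl 0) * (γ : Mat4) (.inr j) (.inr 0)
      + (γ : Mat4) (.inl i) (.inl 1) * (γ : Mat4) (.inr j) (.inr 1)
      - (γ : Mat4) (.inl i) (.inr 0) * (γ : Mat4) (.inr j) (.inl 0)
      - (γ : Mat4) (.inl i) (.inr 1) * (γ : Mat4) (.inr j) (.inl 1) = if i = j then 1 else 0 := by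
  have h := SymplecticGroup.mem_iff.1 γ.2
  have key := fun x y => congrFun (congrFun h x) y
  refine ⟨?_, ?_⟩
  · have := key (.inr 0) (.inr 1)
    simp [Matrix.mul_apply, Matrix.J, Fin.sum_univ_two, Matrix.one_apply] at this
    linarith
  · intro i j
    have := key (.inl i) (.inr j)
    simp [Matrix.mul_apply, Matrix.J, Fin.sum_univ_two, Matrix.one_apply] at this
    split_ifs at this ⊢ <;> linarith

/-- `(1 S; 0 1)` for `S = (s₁ s₂; s₂ s₃)`. -/
def upperUnip (s₁ s₂ s₃ : ℤ) : Sp :=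
  ⟨fromBlocks 1 !![s₁, s₂; s₂, s₃] 0 1, by
    rw [SymplecticGroup.fromBlocks_mem_iff]
    refine ⟨by simp, ?_, by simp⟩
    ext i j
    fin_cases i <;> fin_cases j <;> simp⟩

/-- `(U⁻ᵀ 0; 0 U)` for `U ∈ SL₂(ℤ)`. -/
def levi (U : SpecialLinearGroup (Fin 2) ℤ) : Sp :=
  ⟨fromBlocks ((U⁻¹ : SpecialLinearGroup (Fin 2) ℤ) : Matrix (Fin 2) (Fin 2) ℤ)ᵀ 0 0
    (U : Matrix (Fin 2) (Fin 2) ℤ), by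
    rw [SymplecticGroup.fromBlocks_mem_iff]
    refine ⟨by simp, by simp, ?_⟩
    simp [adjugate_mul]⟩

theorem blockC_upperUnip (s₁ s₂ s₃ : ℤ) : blockC (upperUnip s₁ s₂ s₃) = 0 := by
  ext i j; simp [blockC, upperUnip]

theorem blockD_upperUnip (s₁ s₂ s₃ : ℤ) : blockD (upperUnip s₁ s₂ s₃) = 1 := by
  ext i j; simp [blockD, upperUnip]

theorem upperUnip_mem_gammaInfPlus (s₁ s₂ s₃ : ℤ) : upperUnip s₁ s₂ s₃ ∈ GammaInfPlus :=
  ⟨blockC_upperUnip _ _ _, by rw [blockD_upperUnip, det_one]⟩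

theorem upperUnip_mem_gamma0 (N : ℕ) (s₁ s₂ s₃ : ℤ) : upperUnip s₁ s₂ s₃ ∈ Gamma0 N := by
  intro i j
  rw [blockC_upperUnip]; simp

theorem levi_mem_gammaInfPlus (U : SpecialLinearGroup (Fin 2) ℤ) : levi U ∈ GammaInfPlus :=
  ⟨by ext i j; simp [blockC, levi], by
    rw [show blockD (levi U) = (U : Matrix (Fin 2) (Fin 2) ℤ) by ext i j; simp [blockD, levi]]
    exact U.2⟩

/-- The matrices of minors of lower halves of symplectic matrices. -/
def plueckerSet : Set Mat4 := Set.range pluecker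

theorem act_mem_plueckerSet (γ : Sp) (u : Mat4) :
    (γ : Mat4)ᵀ * u * (γ : Mat4) ∈ plueckerSet ↔ u ∈ plueckerSet := by
  constructor
  · rintro ⟨η, hη⟩
    refine ⟨η * γ⁻¹, ?_⟩
    rw [pluecker_mul, hη]
    calc _ = ((γ : Mat4) * ((γ⁻¹ : Sp) : Mat4))ᵀ * u * ((γ : Mat4) * ((γ⁻¹ : Sp) : Mat4)) := by
          simp only [transpose_mul, Matrix.mul_assoc]
      _ = _ := by rw [coe_mul_coe_inv]; simp
  · rintro ⟨η, rfl⟩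
    exact ⟨η * γ, pluecker_mul _ _⟩

/-- The minor `det C`. -/
def cB (u : Mat4) : ℤ := u (.inl 0) (.inl 1)
/-- The minor `det D`. -/
def cE (u : Mat4) : ℤ := u (.inr 0) (.inr 1)
/-- The upper left entry of `adj(D) C`. -/
def cX (u : Mat4) : ℤ := u (.inl 0) (.inr 1)
/-- The upper right entry of `adj(D) C`. -/
def cY (u : Mat4) : ℤ := u (.inl 1) (.inr 1)
/-- The lower right entry of `adj(D) C`. -/
def cZ (u : Mat4) : ℤ := -u (.inl 1) (.inr 0)

theorem skew_of_mem {u : Mat4} (hu : u ∈ plueckerSet) (x y : Fin 2 ⊕ Fin 2) : u x y = -u y x := by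
  obtain ⟨γ, rfl⟩ := hu
  exact pluecker_skew γ x y

/-- This is the symmetry of `C Dᵀ`, equivalently of `adj(D) C`; it reduces six minors to five. -/
theorem inl_zero_inr_zero_of_mem {u : Mat4} (hu : u ∈ plueckerSet) :
    u (.inl 0) (.inr 0) = -cY u := by
  obtain ⟨γ, rfl⟩ := hu
  simp only [cY, pluecker_apply]
  linear_combination (symplectic_relations_transpose γ).1

/-- Both sides are the determinant of `adj(D) C`. -/
theorem quadric_of_mem {u : Mat4} (hu : u ∈ plueckerSet) :
    cB u * cE u = cX u * cZ u - cY u ^ 2 := by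
  have h := inl_zero_inr_zero_of_mem hu
  rw [pow_two, show cX u * cZ u - cY u * cY u = cX u * cZ u + u (.inl 0) (.inr 0) * cY u by
    rw [h]; ring]
  obtain ⟨γ, rfl⟩ := hu
  simp only [cB, cE, cX, cY, cZ, pluecker_apply]
  ring

theorem eq_of_coords_of_skew {u v : Mat4} (su : ∀ x y, u x y = -u y x) (sv : ∀ x y, v x y = -v y x)
    (h1 : u (.inl 0) (.inr 0) = -cY u) (h2 : v (.inl 0) (.inr 0) = -cY v)
    (hB : cB u = cB v) (hX : cX u = cX v) (hY : cY u = cY v) (hZ : cZ u = cZ v)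
    (hE : cE u = cE v) : u = v := by
  have ku : ∀ x, u x x = 0 := fun x => by have := su x x; omega
  have kv : ∀ x, v x x = 0 := fun x => by have := sv x x; omega
  simp only [cB, cE, cX, cY, cZ] at *
  have e3 : ∀ i j, u (.inl i) (.inr j) = v (.inl i) (.inr j) := by
    intro i j
    fin_cases i <;> fin_cases j <;> simp <;> omega
  ext x y
  rcases x with x | x <;> rcases y with y | y
  · fin_cases x <;> fin_cases y <;> simp [ku, kv, hB]
    rw [su, sv, hB]
  · exact e3 x y
  · rw [su, sv, e3]
  · fin_cases x <;> fin_cases y <;> simp [ku, kv, hE]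
    rw [su, sv, hE]

theorem eq_of_coords {u v : Mat4} (hu : u ∈ plueckerSet) (hv : v ∈ plueckerSet)
    (hB : cB u = cB v) (hX : cX u = cX v) (hY : cY u = cY v) (hZ : cZ u = cZ v)
    (hE : cE u = cE v) : u = v :=
  eq_of_coords_of_skew (skew_of_mem hu) (skew_of_mem hv) (inl_zero_inr_zero_of_mem hu)
    (inl_zero_inr_zero_of_mem hv) hB hX hY hZ hE

/-- Otherwise `u = 0`, and undoing the invertible congruence by `γ` would give `volForm = 0`. -/
theorem coords_ne_zero {u : Mat4} (hu : u ∈ plueckerSet) :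
    ¬ (cB u = 0 ∧ cX u = 0 ∧ cY u = 0 ∧ cZ u = 0 ∧ cE u = 0) := by
  rintro ⟨h1, h2, h3, h4, h5⟩
  have hz : u = 0 := eq_of_coords_of_skew (skew_of_mem hu) (by simp) (inl_zero_inr_zero_of_mem hu)
    (by simp [cY]) (by rw [h1]; simp [cB]) (by rw [h2]; simp [cX]) (by rw [h3]; simp [cY]) (by rw [h4]; simp [cZ])
    (by rw [h5]; simp [cE])
  obtain ⟨γ, rfl⟩ := hu
  have : volForm = 0 := by
    have e := pluecker_mul γ γ⁻¹
    rw [hz, mul_inv_cancel] at e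
    simpa [pluecker] using e
  have := congrFun (congrFun this (.inr 0)) (.inr 1)
  simp [volForm] at this

/-- The effect of `(1 S; 0 1)` on the minors. -/
theorem coords_upperUnip {u : Mat4} (hu : u ∈ plueckerSet) (s₁ s₂ s₃ : ℤ) :
    cB ((upperUnip s₁ s₂ s₃ : Mat4)ᵀ * u * (upperUnip s₁ s₂ s₃ : Mat4)) = cB u ∧
    cX ((upperUnip s₁ s₂ s₃ : Mat4)ᵀ * u * (upperUnip s₁ s₂ s₃ : Mat4)) = cX u + cB u * s₃ ∧
    cY ((upperUnip s₁ s₂ s₃ : Mat4)ᵀ * u * (upperUnip s₁ s₂ s₃ : Mat4)) = cY u - cB u * s₂ ∧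
    cZ ((upperUnip s₁ s₂ s₃ : Mat4)ᵀ * u * (upperUnip s₁ s₂ s₃ : Mat4)) = cZ u + cB u * s₁ ∧
    cE ((upperUnip s₁ s₂ s₃ : Mat4)ᵀ * u * (upperUnip s₁ s₂ s₃ : Mat4)) =
      cB u * s₁ * s₃ - cB u * s₂ ^ 2 + cX u * s₁ + 2 * cY u * s₂ + cZ u * s₃ + cE u := by
  have h := inl_zero_inr_zero_of_mem hu
  have su := skew_of_mem hu
  have k : ∀ x, u x x = 0 := fun x => by have := su x x; omega
  have a1 := su (.inl 1) (.inl 0)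
  have a3 := fun i j => su (.inr i) (.inl j)
  refine ⟨?_, ?_, ?_, ?_, ?_⟩ <;>
  · simp only [cB, cE, cX, cY, cZ] at *
    simp [upperUnip, Matrix.mul_apply, Fin.sum_univ_two, k, a1, a3, h]
    try ring

/-- The effect of `δ = diag(p, p, 1, 1)` on the minors. -/
theorem coords_heckeDelta (p : ℕ) (u : Mat4) :
    cB ((heckeDelta p)ᵀ * u * heckeDelta p) = p ^ 2 * cB u ∧
    cX ((heckeDelta p)ᵀ * u * heckeDelta p) = p * cX u ∧
    cY ((heckeDelta p)ᵀ * u * heckeDelta p) = p * cY u ∧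
    cZ ((heckeDelta p)ᵀ * u * heckeDelta p) = p * cZ u ∧
    cE ((heckeDelta p)ᵀ * u * heckeDelta p) = cE u := by
  have hp : (p : ℤ) • (1 : Matrix (Fin 2) (Fin 2) ℤ) = !![(p : ℤ), 0; 0, (p : ℤ)] := by
    ext i j; fin_cases i <;> fin_cases j <;> simp
  refine ⟨?_, ?_, ?_, ?_, ?_⟩ <;>
  · simp [cB, cE, cX, cY, cZ, heckeDelta, hp, Matrix.mul_apply, Fin.sum_univ_two, Matrix.one_apply]
    try ring

end Symplectic

end SiegelTwo

end

noncomputable section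

namespace SiegelTwo

open Matrix

/-! ### Summability of `size⁻⁴` over the integral points of the quadric. -/

section Convergence

theorem succ_pow_three_le_eight_mul_two_pow (a : ℕ) : (a + 1) ^ 3 ≤ 8 * 2 ^ a := by
  rcases lt_or_ge a 3 with h | h
  · interval_cases a <;> norm_num
  · induction a, h using Nat.le_induction with
    | base => norm_num
    | succ n hn ih =>
      rw [pow_succ 2 n]
      nlinarith [Nat.mul_le_mul hn (Nat.mul_le_mul hn hn), Nat.mul_le_mul hn hn]

/-- A bound of the shape `d(n) = O(n^{1/3})` for the number of divisors. -/
theorem card_divisors_pow_three_le {n : ℕ} (hn : n ≠ 0) :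
    n.divisors.card ^ 3 ≤ 8 ^ 8 * n := by
  rw [Nat.card_divisors hn, ← Finset.prod_pow]
  -- For `p ≥ 8` one has `(a + 1)³ ≤ 8^a ≤ p^a` with no loss. A prime below `8` costs a factor `8`,
  -- and there are at most eight of them, whence `8^8`.
  have h1 : ∀ p ∈ n.primeFactors, (n.factorization p + 1) ^ 3 ≤
      (if p < 8 then 8 else 1) * p ^ n.factorization p := by
    intro p hp
    have h2 := (Nat.prime_of_mem_primeFactors hp).two_le
    split_ifs with h
    · exact (succ_pow_three_le_eight_mul_two_pow _).trans
        (Nat.mul_le_mul_left _ (Nat.pow_le_pow_left h2 _))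
    · rw [one_mul]
      have h3 : n.factorization p + 1 ≤ 2 ^ n.factorization p := Nat.lt_two_pow_self
      calc _ ≤ (2 ^ n.factorization p) ^ 3 := Nat.pow_le_pow_left h3 3
        _ = 8 ^ n.factorization p := by rw [← pow_mul, mul_comm, pow_mul]; norm_num
        _ ≤ _ := Nat.pow_le_pow_left (not_lt.1 h) _
  refine (Finset.prod_le_prod' h1).trans ?_
  rw [Finset.prod_mul_distrib]
  refine Nat.mul_le_mul ?_ (le_of_eq ?_)
  · rw [Finset.prod_ite, Finset.prod_const, Finset.prod_const_one, mul_one]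
    refine Nat.pow_le_pow_right (by norm_num) ?_
    calc _ ≤ (Finset.range 8).card := Finset.card_le_card fun p hp => by
          simp only [Finset.mem_filter] at hp
          exact Finset.mem_range.2 hp.2
      _ = 8 := by simp
  · exact Nat.prod_factorization_pow_eq_self hn

theorem summable_one_add_abs_rpow {s : ℝ} (hs : 1 < s) :
    Summable fun n : ℤ => (1 + |(n : ℝ)|) ^ (-s) := by
  have h1 : Summable fun n : ℤ => |(n : ℝ)| ^ (-s) + (if n = 0 then (1 : ℝ) else 0) := by
    refine (Real.summable_abs_int_rpow hs).add ?_
    exact summable_of_ne_finset_zero (s := {0}) (fun n hn => by simp at hn; simp [hn])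
  refine Summable.of_nonneg_of_le (fun n => by positivity) (fun n => ?_) h1
  split_ifs with h
  · subst h
    simp
    positivity
  · rw [add_zero]
    have : 0 < |(n : ℝ)| := by positivity
    exact Real.rpow_le_rpow_of_nonpos this (by linarith) (by linarith)

/-- The power `-s` is split into three powers `-s/3`, and each is bounded by the term of one
variable. -/
theorem summable_one_add_abs_rpow_three {s : ℝ} (hs : 3 < s) :
    Summable fun p : ℤ × ℤ × ℤ => (1 + |(p.1 : ℝ)| + |(p.2.1 : ℝ)| + |(p.2.2 : ℝ)|) ^ (-s) := by
  have h1 := summable_one_add_abs_rpow (s := s / 3) (by linarith)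
  have hnn : (0 : ℤ → ℝ) ≤ fun n : ℤ => (1 + |(n : ℝ)|) ^ (-(s / 3)) := fun n => by
    simp only [Pi.zero_apply]; positivity
  have h3 := h1.mul_of_nonneg (h1.mul_of_nonneg h1 hnn hnn) hnn (fun p => by
    simp only [Pi.zero_apply]; positivity)
  refine Summable.of_nonneg_of_le (fun n => by positivity) (fun p => ?_) h3
  obtain ⟨x, y, z⟩ := p
  simp only
  have ax := abs_nonneg (x : ℝ)
  have ay := abs_nonneg (y : ℝ)
  have az := abs_nonneg (z : ℝ)
  have hm : 0 < 1 + |(x : ℝ)| + |(y : ℝ)| + |(z : ℝ)| := by positivity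
  rw [show (-s) = -(s / 3) + (-(s / 3) + -(s / 3)) by ring, Real.rpow_add hm, Real.rpow_add hm]
  have hle : -(s / 3) ≤ 0 := by linarith
  gcongr ?_ * (?_ * ?_)
  · exact Real.rpow_le_rpow_of_nonpos (by positivity) (by linarith) hle
  · exact Real.rpow_le_rpow_of_nonpos (by positivity) (by linarith) hle
  · exact Real.rpow_le_rpow_of_nonpos (by positivity) (by linarith) hle

/-- The sum of the absolute values of the minors. -/
def size (u : Mat4) : ℝ :=
  |(cB u : ℝ)| + |(cX u : ℝ)| + |(cY u : ℝ)| + |(cZ u : ℝ)| + |(cE u : ℝ)|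

theorem one_le_size {u : Mat4} (hu : u ∈ plueckerSet) : 1 ≤ size u := by
  have h := coords_ne_zero hu
  have : (1 : ℤ) ≤ |cB u| + |cX u| + |cY u| + |cZ u| + |cE u| := by
    by_contra hc
    apply h
    have := abs_nonneg (cB u)
    have := abs_nonneg (cX u)
    have := abs_nonneg (cY u)
    have := abs_nonneg (cZ u)
    have := abs_nonneg (cE u)
    refine ⟨?_, ?_, ?_, ?_, ?_⟩ <;> rw [← abs_eq_zero] <;> omega
  unfold size
  exact_mod_cast this

theorem card_int_divisors_le (S : Finset ℤ) {n : ℤ} (hn : n ≠ 0) (hS : ∀ b ∈ S, b ∣ n) :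
    S.card ≤ 2 * n.natAbs.divisors.card := by
  classical
  have h1 : S ⊆ (n.natAbs.divisors.image fun d : ℕ => (d : ℤ)) ∪
      (n.natAbs.divisors.image fun d : ℕ => -(d : ℤ)) := by
    intro b hb
    have h2 : b.natAbs ∈ n.natAbs.divisors := by
      rw [Nat.mem_divisors]
      exact ⟨Int.natAbs_dvd_natAbs.2 (hS b hb), by simpa using hn⟩
    rw [Finset.mem_union, Finset.mem_image, Finset.mem_image]
    rcases Int.natAbs_eq b with h | h
    · exact Or.inl ⟨_, h2, h.symm⟩
    · exact Or.inr ⟨_, h2, h.symm⟩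
  calc _ ≤ _ := Finset.card_le_card h1
    _ ≤ _ := Finset.card_union_le _ _
    _ ≤ n.natAbs.divisors.card + n.natAbs.divisors.card :=
      add_le_add Finset.card_image_le Finset.card_image_le
    _ = _ := by ring

theorem card_divisors_le_rpow {x y z : ℤ} (hn : x * z - y ^ 2 ≠ 0) :
    ((x * z - y ^ 2).natAbs.divisors.card : ℝ) ≤
      (2 * 8 ^ 8) * (1 + |(x : ℝ)| + |(y : ℝ)| + |(z : ℝ)|) ^ (2 / 3 : ℝ) := by
  have h1 := card_divisors_pow_three_le (n := (x * z - y ^ 2).natAbs) (by simpa using hn)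
  set d := (x * z - y ^ 2).natAbs.divisors.card
  set m := 1 + |(x : ℝ)| + |(y : ℝ)| + |(z : ℝ)| with hm
  have ax := abs_nonneg (x : ℝ)
  have ay := abs_nonneg (y : ℝ)
  have az := abs_nonneg (z : ℝ)
  have hm0 : 0 < m := by positivity
  have h2 : ((x * z - y ^ 2).natAbs : ℝ) ≤ 2 * m ^ 2 := by
    rw [Nat.cast_natAbs]
    push_cast
    calc |(x : ℝ) * z - y ^ 2| ≤ |(x : ℝ) * z| + |(y : ℝ) ^ 2| := abs_sub _ _
      _ = |(x : ℝ)| * |(z : ℝ)| + |(y : ℝ)| ^ 2 := by rw [abs_mul, abs_pow]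
      _ ≤ m * m + m ^ 2 := by gcongr <;> linarith
      _ = _ := by ring
  have h3 : (d : ℝ) ^ 3 ≤ 8 ^ 8 * (2 * m ^ 2) := by
    calc (d : ℝ) ^ 3 ≤ 8 ^ 8 * ((x * z - y ^ 2).natAbs : ℝ) := by exact_mod_cast h1
      _ ≤ _ := by gcongr
  refine le_of_pow_le_pow_left₀ (n := 3) (by norm_num) (by positivity) (h3.trans ?_)
  rw [mul_pow, ← Real.rpow_natCast (m ^ (2 / 3 : ℝ)), ← Real.rpow_mul hm0.le]
  norm_num
  nlinarith [sq_nonneg m]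

/-- When `b ≠ 0`, `u` is determined by `(x, y, z, b)`, and `b` divides the nonzero integer `x z -
y²`. With `m = 1 + |x| + |y| + |z|` this leaves `O(m^{2/3})` values of `b`, so the sum is dominated
by that of `m^{-4 + 2/3} = m^{-10/3}` over `ℤ³`, and `10/3 > 3`. -/
theorem summable_size_of_det_ne_zero :
    Summable ({u ∈ plueckerSet | cB u * cE u ≠ 0}.indicator fun u => (size u ^ 4)⁻¹) := by
  rw [← summable_subtype_iff_indicator]
  let g : (ℤ × ℤ × ℤ) × ℤ → ℝ := fun p =>
    if p.1.1 * p.1.2.2 - p.1.2.1 ^ 2 ≠ 0 ∧ p.2 ∣ p.1.1 * p.1.2.2 - p.1.2.1 ^ 2 then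
      (1 + |(p.1.1 : ℝ)| + |(p.1.2.1 : ℝ)| + |(p.1.2.2 : ℝ)|) ^ (-4 : ℝ) else 0
  have hg0 : 0 ≤ g := fun p => by
    simp only [g, Pi.zero_apply]
    split_ifs <;> positivity
  have hfin : ∀ p : ℤ × ℤ × ℤ, p.1 * p.2.2 - p.2.1 ^ 2 ≠ 0 →
      {b : ℤ | b ∣ p.1 * p.2.2 - p.2.1 ^ 2}.Finite := fun p hp => by
    refine (Set.finite_Icc (-|p.1 * p.2.2 - p.2.1 ^ 2|) |p.1 * p.2.2 - p.2.1 ^ 2|).subset ?_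
    intro b hb
    rw [Set.mem_Icc, ← abs_le]
    exact Int.le_of_dvd (abs_pos.2 hp) ((abs_dvd_abs _ _).2 hb)
  -- The constant is that of `card_divisors_le_rpow`, doubled for the signs of the divisors.
  have hfib : ∀ p : ℤ × ℤ × ℤ, ∃ T : Finset ℤ, (∀ b, b ∉ T → g (p, b) = 0) ∧
      ∑ b ∈ T, g (p, b) ≤
        (4 * 8 ^ 8) * (1 + |(p.1 : ℝ)| + |(p.2.1 : ℝ)| + |(p.2.2 : ℝ)|) ^ (-(10 / 3) : ℝ) := by
    intro p
    by_cases hp : p.1 * p.2.2 - p.2.1 ^ 2 = 0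
    · exact ⟨∅, fun b _ => by simp [g, hp], by simp; positivity⟩
    · refine ⟨(hfin p hp).toFinset, fun b hb => ?_, ?_⟩
      · simp only [Set.Finite.mem_toFinset, Set.mem_ofPred_eq] at hb
        simp [g, hb]
      · have hm : 0 < 1 + |(p.1 : ℝ)| + |(p.2.1 : ℝ)| + |(p.2.2 : ℝ)| := by positivity
        calc _ ≤ ∑ b ∈ (hfin p hp).toFinset,
              (1 + |(p.1 : ℝ)| + |(p.2.1 : ℝ)| + |(p.2.2 : ℝ)|) ^ (-4 : ℝ) := by
              refine Finset.sum_le_sum fun b _ => ?_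
              simp only [g]
              split_ifs
              · exact le_rfl
              · positivity
          _ = ((hfin p hp).toFinset.card : ℝ) *
              (1 + |(p.1 : ℝ)| + |(p.2.1 : ℝ)| + |(p.2.2 : ℝ)|) ^ (-4 : ℝ) := by
              rw [Finset.sum_const, nsmul_eq_mul]
          _ ≤ (2 * ((2 * 8 ^ 8) *
                (1 + |(p.1 : ℝ)| + |(p.2.1 : ℝ)| + |(p.2.2 : ℝ)|) ^ (2 / 3 : ℝ))) *
              (1 + |(p.1 : ℝ)| + |(p.2.1 : ℝ)| + |(p.2.2 : ℝ)|) ^ (-4 : ℝ) := by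
              gcongr
              refine le_trans ?_ (mul_le_mul_of_nonneg_left (card_divisors_le_rpow hp) (by norm_num))
              exact_mod_cast card_int_divisors_le (hfin p hp).toFinset hp (by simp)
          _ = _ := by
              rw [show (-(10 / 3) : ℝ) = 2 / 3 + (-4) by norm_num, Real.rpow_add hm]
              ring
  have hsum : Summable g := by
    rw [summable_prod_of_nonneg hg0]
    refine ⟨fun p => ?_, ?_⟩
    · obtain ⟨T, hT, -⟩ := hfib p
      exact summable_of_ne_finset_zero (s := T) hT
    · refine Summable.of_nonneg_of_le (fun p => tsum_nonneg fun b => hg0 _) (fun p => ?_)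
        ((summable_one_add_abs_rpow_three (s := 10 / 3) (by norm_num)).mul_left (4 * 8 ^ 8))
      obtain ⟨T, hT, hle⟩ := hfib p
      rw [tsum_eq_sum hT]
      exact hle
  let φ : {u : Mat4 | u ∈ plueckerSet ∧ cB u * cE u ≠ 0} → (ℤ × ℤ × ℤ) × ℤ :=
    fun u => ((cX u.1, cY u.1, cZ u.1), cB u.1)
  have hφ : Function.Injective φ := by
    rintro ⟨u, hu, hu'⟩ ⟨v, hv, hv'⟩ h
    simp only [φ, Prod.mk.injEq] at h
    obtain ⟨⟨hx, hy, hz⟩, hb⟩ := h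
    have h1 := quadric_of_mem hu
    have h2 := quadric_of_mem hv
    rw [hx, hy, hz, hb, ← h2] at h1
    exact Subtype.ext (eq_of_coords hu hv hb hx hy hz (mul_left_cancel₀ (left_ne_zero_of_mul hv') h1))
  refine Summable.of_nonneg_of_le (fun u => ?_) (fun u => ?_) (hsum.comp_injective hφ)
  · simp only [Function.comp_apply]; positivity
  · obtain ⟨u, hu, hu'⟩ := u
    have hq := quadric_of_mem hu
    simp only [Function.comp_apply, φ, g]
    rw [if_pos ⟨by rw [← hq]; exact hu', by rw [← hq]; exact dvd_mul_right _ _⟩,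
      show (-4 : ℝ) = -((4 : ℕ) : ℝ) by norm_num, Real.rpow_neg (by positivity), Real.rpow_natCast]
    gcongr
    have : (1 : ℝ) ≤ |(cB u : ℝ)| := by
      exact_mod_cast Int.one_le_abs (left_ne_zero_of_mul hu')
    have := abs_nonneg (cE u : ℝ)
    unfold size
    linarith

/-- Used with `{s, t} = {b, e}`. If `s = 0` the quadric becomes `y² = x z`, so `y` is determined up
to sign by `x` and `z`. Three integer parameters and one sign remain, and the exponent `4` exceeds
`3`. -/
theorem summable_size_of_eq_zero (s t : Mat4 → ℤ)
    (hst : ∀ u ∈ plueckerSet, ∀ v ∈ plueckerSet, s u = s v → t u = t v → cX u = cX v →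
      cY u = cY v → cZ u = cZ v → u = v)
    (hmul : ∀ u, s u * t u = cB u * cE u) (hle : ∀ u, |(t u : ℝ)| + |(cX u : ℝ)| + |(cZ u : ℝ)| ≤ size u) :
    Summable ({u ∈ plueckerSet | s u = 0}.indicator fun u => (size u ^ 4)⁻¹) := by
  rw [← summable_subtype_iff_indicator]
  let φ : {u : Mat4 | u ∈ plueckerSet ∧ s u = 0} → (ℤ × ℤ × ℤ) × Bool :=
    fun u => ((t u.1, cX u.1, cZ u.1), decide (0 ≤ cY u.1))
  have hφ : Function.Injective φ := by
    rintro ⟨u, hu, hu'⟩ ⟨v, hv, hv'⟩ h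
    simp only [φ, Prod.mk.injEq] at h
    obtain ⟨⟨ht, hx, hz⟩, hb⟩ := h
    have h1 := quadric_of_mem hu
    have h2 := quadric_of_mem hv
    rw [← hmul, hu', zero_mul] at h1
    rw [← hmul, hv', zero_mul] at h2
    have h3 : cY u ^ 2 = cY v ^ 2 := by rw [hx, hz] at h1; linarith
    have hy : cY u = cY v := by
      have hb' := decide_eq_decide.1 hb
      rcases sq_eq_sq_iff_eq_or_eq_neg.1 h3 with h | h
      · exact h
      · omega
    exact Subtype.ext (hst u hu v hv (hu'.trans hv'.symm) ht hx hy hz)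
  -- The factor `16 = 2⁴` comes from `1 + |t| + |x| + |z| ≤ 2 · size u`, which uses `1 ≤ size u`.
  have hsum : Summable fun p : (ℤ × ℤ × ℤ) × Bool =>
      ((1 + |(p.1.1 : ℝ)| + |(p.1.2.1 : ℝ)| + |(p.1.2.2 : ℝ)|) ^ (-4 : ℝ)) * (16 : ℝ) :=
    (summable_one_add_abs_rpow_three (s := 4) (by norm_num)).mul_of_nonneg
      (g := fun _ : Bool => (16 : ℝ)) (Summable.of_finite)
      (fun p => by simp only [Pi.zero_apply]; positivity) (fun _ => by simp)
  refine Summable.of_nonneg_of_le (fun u => ?_) (fun u => ?_) (hsum.comp_injective hφ)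
  · simp only [Function.comp_apply]; positivity
  · obtain ⟨u, hu, hu'⟩ := u
    simp only [Function.comp_apply, φ]
    rw [show (-4 : ℝ) = -((4 : ℕ) : ℝ) by norm_num, Real.rpow_neg (by positivity), Real.rpow_natCast]
    have h1 := one_le_size hu
    have h2 := hle u
    have h3 : 1 + |(t u : ℝ)| + |(cX u : ℝ)| + |(cZ u : ℝ)| ≤ 2 * size u := by linarith
    calc (size u ^ 4)⁻¹ = ((2 * size u) ^ 4)⁻¹ * 16 := by
          rw [mul_pow, mul_inv]; norm_num; field_simp
      _ ≤ _ := by gcongr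

theorem summable_size :
    Summable (plueckerSet.indicator fun u => (size u ^ 4)⁻¹) := by
  have hB := summable_size_of_eq_zero cB cE
    (fun u hu v hv hb he hx hy hz => eq_of_coords hu hv hb hx hy hz he) (fun u => rfl)
    (fun u => by
      have := abs_nonneg (cB u : ℝ)
      have := abs_nonneg (cY u : ℝ)
      unfold size; linarith)
  have hE := summable_size_of_eq_zero cE cB
    (fun u hu v hv he hb hx hy hz => eq_of_coords hu hv hb hx hy hz he) (fun u => mul_comm _ _)
    (fun u => by
      have := abs_nonneg (cE u : ℝ)
      have := abs_nonneg (cY u : ℝ)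
      unfold size; linarith)
  refine Summable.of_nonneg_of_le (fun u => Set.indicator_nonneg (fun u _ => ?_) _) (fun u => ?_)
    ((summable_size_of_det_ne_zero.add hB).add hE)
  · have : 0 ≤ size u := by unfold size; positivity
    positivity
  · have h0 : 0 ≤ (size u ^ 4)⁻¹ := by
      have : 0 ≤ size u := by unfold size; positivity
      positivity
    by_cases hu : u ∈ plueckerSet
    · rw [Set.indicator_of_mem hu]
      have hind : ∀ s : Set Mat4, 0 ≤ s.indicator (fun u => (size u ^ 4)⁻¹) u := fun s =>
        Set.indicator_apply_nonneg fun _ => h0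
      have i1 := hind {u ∈ plueckerSet | cB u * cE u ≠ 0}
      have i2 := hind {u ∈ plueckerSet | cB u = 0}
      have i3 := hind {u ∈ plueckerSet | cE u = 0}
      by_cases h : cB u * cE u = 0
      · rcases mul_eq_zero.1 h with h | h
        · have : u ∈ {u ∈ plueckerSet | cB u = 0} := ⟨hu, h⟩
          rw [Set.indicator_of_mem this] at i2 ⊢
          linarith
        · have : u ∈ {u ∈ plueckerSet | cE u = 0} := ⟨hu, h⟩
          rw [Set.indicator_of_mem this] at i3 ⊢
          linarith
      · have : u ∈ {u ∈ plueckerSet | cB u * cE u ≠ 0} := ⟨hu, h⟩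
        rw [Set.indicator_of_mem this] at i1 ⊢
        linarith
    · rw [Set.indicator_of_notMem hu]
      exact add_nonneg (add_nonneg (Set.indicator_apply_nonneg fun _ => h0)
        (Set.indicator_apply_nonneg fun _ => h0)) (Set.indicator_apply_nonneg fun _ => h0)

end Convergence

end SiegelTwo

end

noncomputable section

namespace SiegelTwo

open Matrix

/-! ### Lower bound for `det(Cτ + D)` and absolute convergence. -/

section Convergence

/-- `det(Cτ + D)` in terms of the minors of `(C D)`, for real or complex values of the minors. -/
def linForm (b x y z e : ℂ) (τ : Matrix (Fin 2) (Fin 2) ℂ) : ℂ :=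
  b * τ.det + (x * τ 0 0 + 2 * y * τ 0 1 + z * τ 1 1) + e

theorem im_quadratic_pos {τ : Matrix (Fin 2) (Fin 2) ℂ} (hτ : τ ∈ upperHalf) {s t : ℝ}
    (h : s ≠ 0 ∨ t ≠ 0) :
    0 < s ^ 2 * (τ 0 0).im + 2 * (s * t) * (τ 0 1).im + t ^ 2 * (τ 1 1).im := by
  obtain ⟨hs, hp⟩ := hτ
  have h1 := hp.dotProduct_mulVec_pos (x := ![s, t]) (by
    intro hc
    have h0 := congrFun hc 0
    have h1 := congrFun hc 1
    simp at h0 h1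
    rcases h with h | h <;> contradiction)
  have h2 : τ 1 0 = τ 0 1 := hs.apply 0 1
  simp [dotProduct, mulVec, Fin.sum_univ_two, h2] at h1
  nlinarith [h1]

/-- A symmetric complex matrix with positive definite imaginary part is nonsingular. If it were
singular, then `ω = sβ` and `α = s²β`, and the imaginary form at `(1, -Re s)` would equal `Im((s -
Re s)² β) = -(Im s)² Im β ≤ 0`. -/
theorem det_ne_zero_of_im_pos {α ω β : ℂ}
    (h : ∀ s t : ℝ, s ≠ 0 ∨ t ≠ 0 → 0 < s ^ 2 * α.im + 2 * (s * t) * ω.im + t ^ 2 * β.im) :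
    α * β - ω ^ 2 ≠ 0 := by
  intro h0
  have hβ : 0 < β.im := by simpa using h 0 1 (by simp)
  have hβ0 : β ≠ 0 := fun hc => by rw [hc] at hβ; simp at hβ
  obtain ⟨s, rfl⟩ : ∃ s, ω = s * β := ⟨ω / β, by field_simp⟩
  have hα : α = s ^ 2 * β := by
    apply mul_right_cancel₀ hβ0
    linear_combination h0
  subst hα
  have h1 := h 1 (-s.re) (by simp)
  simp only [pow_two, Complex.mul_im, Complex.mul_re] at h1
  nlinarith [mul_nonneg (sq_nonneg s.im) hβ.le]

/-- Real coefficients are allowed because the compactness argument below needs them. If `b ≠ 0`,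
then `b` times the form is the determinant of `bτ + (z, -y; -y, x)`, whose imaginary part `b Im τ`
is definite. If `b = 0` and `x ≠ 0`, then `x z = y²` turns `x` times the imaginary part into the
value of `Im τ` at `(x, y)`. -/
theorem linForm_ne_zero {τ : Matrix (Fin 2) (Fin 2) ℂ} (hτ : τ ∈ upperHalf) {b x y z e : ℝ}
    (hq : b * e = x * z - y ^ 2) (h0 : ¬ (b = 0 ∧ x = 0 ∧ y = 0 ∧ z = 0 ∧ e = 0)) :
    linForm b x y z e τ ≠ 0 := by
  have h2 : τ 1 0 = τ 0 1 := hτ.1.apply 0 1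
  by_cases hb : b = 0
  · subst hb
    by_cases hxy : x = 0 ∧ y = 0
    · obtain ⟨rfl, rfl⟩ := hxy
      by_cases hz : z = 0
      · subst hz
        simp only [linForm]
        simp only [true_and] at h0
        simpa using h0
      · intro hc
        have him := congrArg Complex.im hc
        simp [linForm] at him
        have := im_quadratic_pos hτ (s := 0) (t := 1) (by simp)
        rcases him with h | h
        · exact hz h
        · rw [h] at this; simp at this
    · have hx : x ≠ 0 := by
        rintro rfl
        apply hxy
        refine ⟨rfl, ?_⟩
        have : y ^ 2 = 0 := by linarith
        exact pow_eq_zero_iff (two_ne_zero) |>.1 this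
      intro hc
      have him := congrArg Complex.im hc
      simp [linForm] at him
      have h3 := im_quadratic_pos hτ (s := x) (t := y) (Or.inl hx)
      have h4 : x * (x * (τ 0 0).im + 2 * y * (τ 0 1).im + z * (τ 1 1).im) = 0 := by
        rw [him, mul_zero]
      have h5 : x * z = y ^ 2 := by linarith
      have h6 : x * (x * (τ 0 0).im + 2 * y * (τ 0 1).im + z * (τ 1 1).im) =
        x ^ 2 * (τ 0 0).im + 2 * (x * y) * (τ 0 1).im + y ^ 2 * (τ 1 1).im := by
        rw [← h5]; ring
      linarith
  · intro hc
    have h3 : ((b : ℂ) * τ 0 0 + z) * (b * τ 1 1 + x) - (b * τ 0 1 - y) ^ 2 = 0 := by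
      have hq' : (b : ℂ) * e = x * z - y ^ 2 := by exact_mod_cast hq
      have : (b : ℂ) * linForm b x y z e τ = 0 := by rw [hc, mul_zero]
      rw [linForm, det_fin_two, h2] at this
      linear_combination this - hq'
    rcases lt_or_gt_of_ne hb with hb | hb
    · refine det_ne_zero_of_im_pos (α := -(b * τ 0 0 + z)) (β := -(b * τ 1 1 + x))
        (ω := -(b * τ 0 1 - y)) (fun s t hst => ?_) (by linear_combination h3)
      have := im_quadratic_pos hτ hst
      simp
      nlinarith
    · refine det_ne_zero_of_im_pos (fun s t hst => ?_) h3
      have := im_quadratic_pos hτ hst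
      simp
      nlinarith

/-- Both sides are homogeneous of degree one, so `c` is the minimum of the nonvanishing continuous
norm on the compact slice of the real quadric where the absolute values sum to `1`. -/
theorem exists_linForm_lower_bound {τ : Matrix (Fin 2) (Fin 2) ℂ} (hτ : τ ∈ upperHalf) :
    ∃ c : ℝ, 0 < c ∧ ∀ b x y z e : ℝ, b * e = x * z - y ^ 2 →
      c * (|b| + |x| + |y| + |z| + |e|) ≤ ‖linForm b x y z e τ‖ := by
  let K : Set (Fin 5 → ℝ) := {p | |p 0| + |p 1| + |p 2| + |p 3| + |p 4| = 1 ∧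
    p 0 * p 4 = p 1 * p 3 - p 2 ^ 2}
  let F : (Fin 5 → ℝ) → ℝ := fun p => ‖linForm (p 0) (p 1) (p 2) (p 3) (p 4) τ‖
  have hF : Continuous F := by
    unfold F linForm
    fun_prop
  have hK : IsCompact K := by
    refine Metric.isCompact_of_isClosed_isBounded ?_ ?_
    · refine IsClosed.inter (isClosed_eq ?_ ?_) (isClosed_eq ?_ ?_) <;> fun_prop
    · refine (Metric.isBounded_closedBall (x := (0 : Fin 5 → ℝ)) (r := 1)).subset fun p hp => ?_
      rw [mem_closedBall_zero_iff, pi_norm_le_iff_of_nonneg zero_le_one]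
      intro i
      have h := hp.1
      have h0 := fun i => abs_nonneg (p i)
      rw [Real.norm_eq_abs]
      fin_cases i <;> simp <;> linarith [h0 0, h0 1, h0 2, h0 3, h0 4]
  obtain ⟨p, hp, hmin⟩ := hK.exists_isMinOn ⟨![0, 0, 0, 0, 1], by simp [K]⟩ hF.continuousOn
  refine ⟨F p, ?_, fun b x y z e hq => ?_⟩
  · refine norm_pos_iff.2 (linForm_ne_zero hτ hp.2 ?_)
    rintro ⟨h0, h1, h2, h3, h4⟩
    have := hp.1
    rw [h0, h1, h2, h3, h4] at this
    simp at this
  · set m := |b| + |x| + |y| + |z| + |e| with hm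
    have hm0 : 0 ≤ m := by positivity
    rcases hm0.eq_or_lt with h | h
    · rw [← h, mul_zero]; exact norm_nonneg _
    · have hmem : ![b / m, x / m, y / m, z / m, e / m] ∈ K := by
        refine ⟨?_, ?_⟩
        · simp [abs_div, abs_of_pos h]
          rw [← add_div, ← add_div, ← add_div, ← add_div, ← hm, div_self h.ne']
        · simp
          field_simp
          linarith
      have h1 := hmin hmem
      simp only [Set.mem_ofPred_eq] at h1
      have h2 : F ![b / m, x / m, y / m, z / m, e / m] * m = ‖linForm b x y z e τ‖ := by
        have hmc : (m : ℂ) ≠ 0 := by exact_mod_cast h.ne'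
        have h3 : linForm b x y z e τ =
            linForm ((b / m : ℝ) : ℂ) ((x / m : ℝ) : ℂ) ((y / m : ℝ) : ℂ) ((z / m : ℝ) : ℂ)
              ((e / m : ℝ) : ℂ) τ * m := by
          simp only [linForm]
          push_cast
          field_simp
        rw [h3, norm_mul, Complex.norm_real, Real.norm_of_nonneg hm0]
        simp [F]
      rw [← h2]
      exact mul_le_mul_of_nonneg_right h1 hm0

/-- The `4 × 2` matrix with the blocks `τ` and `1`. -/
def stack (τ : Matrix (Fin 2) (Fin 2) ℂ) : Matrix (Fin 2 ⊕ Fin 2) (Fin 2) ℂ :=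
  fromRows τ (1 : Matrix (Fin 2) (Fin 2) ℂ)

/-- `det(Cτ + D)` as a function of the matrix of minors of `(C D)`. -/
def plForm (u : Mat4) (τ : Matrix (Fin 2) (Fin 2) ℂ) : ℂ :=
  ((stack τ)ᵀ * u.map (Int.cast : ℤ → ℂ) * stack τ) 0 1

theorem plForm_eq_linForm {u : Mat4} (hu : u ∈ plueckerSet) {τ : Matrix (Fin 2) (Fin 2) ℂ}
    (hτ : τ.IsSymm) : plForm u τ = linForm (cB u) (cX u) (cY u) (cZ u) (cE u) τ := by
  have h := inl_zero_inr_zero_of_mem hu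
  have su := skew_of_mem hu
  have k : ∀ x, u x x = 0 := fun x => by have := su x x; omega
  have a1 := su (.inl 1) (.inl 0)
  have a3 := fun i j => su (.inr i) (.inl j)
  have h2 : τ 1 0 = τ 0 1 := hτ.apply 0 1
  simp only [cB, cE, cX, cY, cZ] at *
  simp [plForm, stack, linForm, Matrix.mul_apply, Fin.sum_univ_two, k, a1, a3, h, det_fin_two, h2]
  ring

theorem plForm_ne_zero {u : Mat4} (hu : u ∈ plueckerSet) {τ : Matrix (Fin 2) (Fin 2) ℂ}
    (hτ : τ ∈ upperHalf) : plForm u τ ≠ 0 := by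
  rw [plForm_eq_linForm hu hτ.1]
  have := linForm_ne_zero hτ (b := cB u) (x := cX u) (y := cY u) (z := cZ u) (e := cE u)
    (by exact_mod_cast quadric_of_mem hu) (by exact_mod_cast coords_ne_zero hu)
  simpa using this

/-- Absolute convergence of the Eisenstein series of weight at least four. -/
theorem summable_mul_plForm {τ : Matrix (Fin 2) (Fin 2) ℂ} (hτ : τ ∈ upperHalf) {k : ℕ}
    (hk : 4 ≤ k) {w : Mat4 → ℂ} (hw : ∀ u, ‖w u‖ ≤ 1) (hw0 : ∀ u, u ∉ plueckerSet → w u = 0) :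
    Summable fun u => w u * plForm u τ ^ (-(k : ℤ)) := by
  obtain ⟨c, hc, hbound⟩ := exists_linForm_lower_bound hτ
  refine Summable.of_norm_bounded (summable_size.mul_left (c ^ k)⁻¹) fun u => ?_
  by_cases hu : u ∈ plueckerSet
  · rw [Set.indicator_of_mem hu, norm_mul, norm_zpow, _root_.zpow_neg, zpow_natCast]
    have h1 := one_le_size hu
    have h2 : c * size u ≤ ‖plForm u τ‖ := by
      rw [plForm_eq_linForm hu hτ.1]
      simpa [size] using hbound (cB u) (cX u) (cY u) (cZ u) (cE u)
        (by exact_mod_cast quadric_of_mem hu)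
    calc _ ≤ 1 * (‖plForm u τ‖ ^ k)⁻¹ := by gcongr; exact hw u
      _ ≤ ((c * size u) ^ k)⁻¹ := by
        rw [one_mul]
        gcongr
      _ = (c ^ k)⁻¹ * (size u ^ k)⁻¹ := by rw [mul_pow, mul_inv]
      _ ≤ _ := by gcongr
  · rw [Set.indicator_of_notMem hu, hw0 u hu]
    simp

end Convergence

end SiegelTwo

end

noncomputable section

namespace SiegelTwo

open Matrix

/-! ### Components of Dirichlet characters and character sums over symmetric matrices. -/

section Characters

theorem coprime_div_of_squarefree {N d : ℕ} (hN : Squarefree N) (hd : d ∣ N) :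
    d.Coprime (N / d) ∧ d * (N / d) = N := by
  have h := Nat.mul_div_cancel' hd
  refine ⟨?_, h⟩
  rw [← h] at hN
  exact Nat.coprime_of_squarefree_mul hN

theorem exists_modEq_and_modEq_one {m n : ℕ} (h : m.Coprime n) (a : ℤ) :
    ∃ b : ℤ, b ≡ a [ZMOD m] ∧ b ≡ 1 [ZMOD n] := by
  obtain ⟨u, v, huv⟩ := Nat.isCoprime_iff_coprime.2 h
  refine ⟨a * (v * n) + u * m, ?_, ?_⟩
  · rw [Int.modEq_iff_dvd]
    exact ⟨a * u - u, by linear_combination (-a) * huv⟩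
  · rw [Int.modEq_iff_dvd]
    exact ⟨v - a * v, by linear_combination (-1) * huv⟩

theorem charPart_eq {N d : ℕ} (χ : DirichletCharacter ℂ N) (hN : Squarefree N) (hd : d ∣ N)
    {a b : ℤ} (h1 : b ≡ a [ZMOD d]) (h2 : b ≡ 1 [ZMOD (N / d : ℕ)]) :
    charPart χ d (a : ZMod d) = χ (b : ZMod N) := by
  have h := coprime_div_of_squarefree hN hd
  rw [charPart, dif_pos h]
  change χ (ZMod.ringEquivCongr h.2 ((ZMod.chineseRemainder h.1).symm ((a : ZMod d), 1))) = _
  have e1 : (ZMod.chineseRemainder h.1).symm ((a : ZMod d), 1) = (b : ZMod (d * (N / d))) := by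
    rw [RingEquiv.symm_apply_eq, map_intCast]
    ext
    · simpa using ((ZMod.intCast_eq_intCast_iff _ _ _).2 h1).symm
    · simpa using ((ZMod.intCast_eq_intCast_iff _ _ _).2 h2).symm
  rw [e1, map_intCast]

theorem charPart_self {N : ℕ} (χ : DirichletCharacter ℂ N) (hN : Squarefree N) (a : ℤ) :
    charPart χ N (a : ZMod N) = χ (a : ZMod N) := by
  refine charPart_eq χ hN dvd_rfl rfl ?_
  rw [Nat.div_self (Nat.pos_of_ne_zero hN.ne_zero)]
  exact Int.modEq_one

theorem charPart_mul {N d m : ℕ} (χ : DirichletCharacter ℂ N) (hN : Squarefree N)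
    (hdm : d * m ∣ N) (a : ℤ) :
    charPart χ (d * m) (a : ZMod (d * m)) =
      charPart χ d (a : ZMod d) * charPart χ m (a : ZMod m) := by
  obtain ⟨n, rfl⟩ := hdm
  have hcop : d.Coprime m := Nat.coprime_of_squarefree_mul (hN.squarefree_of_dvd ⟨n, rfl⟩)
  have h0 := hN.ne_zero
  simp only [ne_eq, mul_eq_zero, not_or] at h0
  obtain ⟨⟨hd0, hm0⟩, hn0⟩ := h0
  have hd : d ∣ d * m * n := ⟨m * n, by ring⟩
  have hm : m ∣ d * m * n := ⟨d * n, by ring⟩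
  have e1 : d * m * n / d = m * n := by
    rw [mul_assoc, Nat.mul_div_cancel_left _ (Nat.pos_of_ne_zero hd0)]
  have e2 : d * m * n / m = d * n := by
    rw [mul_comm d m, mul_assoc, Nat.mul_div_cancel_left _ (Nat.pos_of_ne_zero hm0)]
  have e3 : d * m * n / (d * m) = n :=
    Nat.mul_div_cancel_left _ (Nat.mul_pos (Nat.pos_of_ne_zero hd0) (Nat.pos_of_ne_zero hm0))
  obtain ⟨b, hb1, hb2⟩ := exists_modEq_and_modEq_one (coprime_div_of_squarefree hN hd).1 a
  obtain ⟨c, hc1, hc2⟩ := exists_modEq_and_modEq_one (coprime_div_of_squarefree hN hm).1 a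
  rw [charPart_eq χ hN hd hb1 hb2, charPart_eq χ hN hm hc1 hc2, ← map_mul, ← Int.cast_mul]
  rw [e1] at hb2
  rw [e2] at hc2
  push_cast at hb2 hc2
  refine charPart_eq χ hN ⟨n, rfl⟩ ?_ ?_
  · push_cast
    rw [← Int.modEq_and_modEq_iff_modEq_mul (by simpa using hcop)]
    constructor
    · simpa using hb1.mul (hc2.of_mul_right n)
    · simpa using (hb2.of_mul_right n).mul hc1
  · rw [e3]
    simpa using (hb2.of_mul_left m).mul (hc2.of_mul_left d)

theorem charPart_one {N : ℕ} (χ : DirichletCharacter ℂ N) (a : ZMod 1) : charPart χ 1 a = 1 := by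
  rw [Subsingleton.elim a 1, map_one]

theorem charPart_eq_prod {N : ℕ} (χ : DirichletCharacter ℂ N) (hN : Squarefree N) (a : ℤ) (d : ℕ)
    (hd : d ∣ N) : charPart χ d (a : ZMod d) =
      ∏ r ∈ d.primeFactors, charPart χ r (a : ZMod r) := by
  induction d using induction_on_primes with
  | zero => exact absurd (zero_dvd_iff.1 hd) hN.ne_zero
  | one => simp [charPart_one]
  | prime_mul p d hp ih =>
    have hcop : p.Coprime d := Nat.coprime_of_squarefree_mul (hN.squarefree_of_dvd hd)
    rw [charPart_mul χ hN hd, ih (dvd_of_mul_left_dvd hd), hcop.primeFactors_mul,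
      Finset.prod_union hcop.disjoint_primeFactors, hp.primeFactors, Finset.prod_singleton]

/-- A lift `b` of `a` modulo `r` with `b ≡ 1` modulo `N / r` is also `1` modulo the divisor `N / M`,
so `χ_r(a) = χ(b) = χ_M(b)`. -/
theorem charPart_sq_eq_one {N M r : ℕ} (χ : DirichletCharacter ℂ N) (hN : Squarefree N)
    (hM : M ∣ N) (hr : r ∣ M) (h : charPart χ M ^ 2 = 1) : charPart χ r ^ 2 = 1 := by
  ext a
  obtain ⟨n, hn⟩ := ZMod.intCast_surjective (a : ZMod r)
  have hrN := hr.trans hM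
  obtain ⟨b, hb1, hb2⟩ := exists_modEq_and_modEq_one (coprime_div_of_squarefree hN hrN).1 n
  have e1 := charPart_eq χ hN hrN hb1 hb2
  have e2 : charPart χ M (b : ZMod M) = χ (b : ZMod N) :=
    charPart_eq χ hN hM rfl (hb2.of_dvd (by exact_mod_cast Nat.div_dvd_div_left hM hr))
  have hu : IsUnit (b : ZMod M) := by
    by_contra hc
    have h0 := a.isUnit.map (charPart χ r)
    rw [← hn, e1, ← e2, MulChar.map_nonunit _ hc] at h0
    exact not_isUnit_zero h0
  rw [MulChar.one_apply_coe, MulChar.pow_apply' _ two_ne_zero, ← hn, e1, ← e2,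
    ← MulChar.pow_apply' _ two_ne_zero, h, MulChar.one_apply hu]

theorem sum_mulChar_affine {F : Type*} [Field F] [Fintype F] (ψ : MulChar F ℂ) {x : F} (hx : x ≠ 0)
    (c : F) : ∑ s, ψ (x * s + c) = ∑ s, ψ s :=
  Fintype.sum_equiv ((Equiv.mulLeft₀ x hx).trans (Equiv.addRight c)) _ _ fun s => by simp

/-- For `s₁ ≠ 0` the argument is a bijective affine function of `s₃`. For `s₁ = 0` it does not
involve `s₃`, and `ψ(-s₂²) = ψ(-1) ψ²(s₂)`. -/
theorem sum_mulChar_det {F : Type*} [Field F] [Fintype F] (ψ : MulChar F ℂ) :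
    ∑ s₁, ∑ s₂, ∑ s₃, ψ (s₁ * s₃ - s₂ ^ 2) =
      (Fintype.card F : ℂ) * ((Fintype.card F - 1) * ∑ s, ψ s) +
        Fintype.card F * (ψ (-1) * ∑ s, (ψ ^ 2) s) := by
  classical
  have h1 : ∀ s₁ s₂, ∑ s₃, ψ (s₁ * s₃ - s₂ ^ 2) =
      (if s₁ = 0 then Fintype.card F * ψ (-s₂ ^ 2) - ∑ s, ψ s else 0) + ∑ s, ψ s := by
    intro s₁ s₂
    split_ifs with h
    · subst h
      simp
    · simp_rw [sub_eq_add_neg]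
      rw [sum_mulChar_affine ψ h, zero_add]
  simp_rw [h1]
  rw [Finset.sum_comm]
  simp_rw [Finset.sum_add_distrib, Finset.sum_ite_eq']
  simp only [Finset.mem_univ, if_true, Finset.sum_const, Finset.card_univ, nsmul_eq_mul,
    Finset.sum_sub_distrib]
  have h2 : ∀ s : F, ψ (-s ^ 2) = ψ (-1) * (ψ ^ 2) s := fun s => by
    rw [MulChar.pow_apply' ψ two_ne_zero, ← map_pow, ← map_mul, neg_one_mul]
  simp_rw [h2]
  rw [← Finset.mul_sum, ← Finset.mul_sum]
  ring

/-- Translating `(s₁, s₂, s₃)` by `(z/b, -y/b, x/b)` completes the square, and the constant term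
vanishes exactly by `b e = x z - y²`. Nothing is divided by `2`, so characteristic `2` is covered.
-/
theorem sum_mulChar_quadric {F : Type*} [Field F] [Fintype F] (ψ : MulChar F ℂ) {b x y z e : F}
    (hb : b ≠ 0) (hq : b * e = x * z - y ^ 2) :
    ∑ s₁, ∑ s₂, ∑ s₃, ψ (b * s₁ * s₃ - b * s₂ ^ 2 + x * s₁ + 2 * y * s₂ + z * s₃ + e) =
      ψ b * ∑ s₁, ∑ s₂, ∑ s₃, ψ (s₁ * s₃ - s₂ ^ 2) := by
  simp_rw [Finset.mul_sum]
  refine Fintype.sum_equiv (Equiv.addRight (z / b)) _ _ fun s₁ => ?_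
  refine Fintype.sum_equiv (Equiv.addRight (-(y / b))) _ _ fun s₂ => ?_
  refine Fintype.sum_equiv (Equiv.addRight (x / b)) _ _ fun s₃ => ?_
  rw [← map_mul]
  congr 1
  simp only [Equiv.coe_addRight]
  field_simp
  linear_combination hq

theorem sum_mulChar_linear {F : Type*} [Field F] [Fintype F] (ψ : MulChar F ℂ) {x y z e : F}
    (h : x ≠ 0 ∨ z ≠ 0) :
    ∑ s₁, ∑ s₂, ∑ s₃, ψ (x * s₁ + 2 * y * s₂ + z * s₃ + e) =
      (Fintype.card F : ℂ) ^ 2 * ∑ s, ψ s := by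
  rcases h with h | h
  · rw [Finset.sum_comm]
    simp_rw [Finset.sum_comm (s := Finset.univ (α := F)) (t := Finset.univ (α := F))
      (f := fun s₁ s₃ => ψ (x * s₁ + _ + z * s₃ + e))]
    have : ∀ s₂ s₃, ∑ s₁, ψ (x * s₁ + 2 * y * s₂ + z * s₃ + e) = ∑ s, ψ s := fun s₂ s₃ => by
      simp_rw [add_assoc]
      exact sum_mulChar_affine ψ h _
    simp_rw [this]
    simp
    ring
  · have : ∀ s₁ s₂, ∑ s₃, ψ (x * s₁ + 2 * y * s₂ + z * s₃ + e) = ∑ s, ψ s := fun s₁ s₂ => by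
      rw [← sum_mulChar_affine ψ h (x * s₁ + 2 * y * s₂ + e)]
      exact Finset.sum_congr rfl fun s _ => by congr 1; ring
    simp_rw [this]
    simp
    ring

/-- Since `ψ² = 1`, `ψ` is `1` on nonzero squares. If `-1` is not a square, every nonsquare is `-1`
times a square, so `ψ(-1) = 1` would force `ψ = 1`. -/
theorem mulChar_neg_one_eq_legendreSym {q : ℕ} [Fact q.Prime] {ψ : MulChar (ZMod q) ℂ}
    (h1 : ψ ≠ 1) (h2 : ψ ^ 2 = 1) : ψ (-1) = (legendreSym q (-1) : ℂ) := by
  have hsq : ∀ a : ZMod q, a ≠ 0 → IsSquare a → ψ a = 1 := by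
    rintro a ha ⟨b, rfl⟩
    have hb : IsUnit b := by
      rw [isUnit_iff_ne_zero]; rintro rfl; simp at ha
    rw [← pow_two, map_pow, ← MulChar.pow_apply' ψ two_ne_zero, h2, MulChar.one_apply hb]
  have hne : ((-1 : ℤ) : ZMod q) ≠ 0 := by simp
  by_cases hs : IsSquare (-1 : ZMod q)
  · rw [hsq _ (by simp) hs, (legendreSym.eq_one_iff q hne).2 (by simpa using hs)]
    simp
  · rw [(legendreSym.eq_neg_one_iff q).2 (by simpa using hs)]
    have h3 : ψ (-1) ^ 2 = 1 := by rw [← map_pow]; simp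
    rcases sq_eq_sq_iff_eq_or_eq_neg.1 (h3.trans (one_pow 2).symm) with h | h
    · exfalso
      apply h1
      ext a
      rw [MulChar.one_apply_coe]
      by_cases ha : IsSquare (a : ZMod q)
      · exact hsq _ a.ne_zero ha
      · have hm : IsSquare (-(a : ZMod q)) := by
          rw [← quadraticChar_one_iff_isSquare (neg_ne_zero.2 a.ne_zero), neg_eq_neg_one_mul, map_mul,
            quadraticChar_neg_one_iff_not_isSquare.2 hs, quadraticChar_neg_one_iff_not_isSquare.2 ha]
          norm_num
        have := hsq _ (neg_ne_zero.2 a.ne_zero) hm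
        rw [neg_eq_neg_one_mul, map_mul, h, one_mul] at this
        exact this
    · simp [h]

end Characters

end SiegelTwo

end

noncomputable section

namespace SiegelTwo

open Matrix

/-! ### Orbits of the cusps described modulo the primes dividing the level. -/

section Orbits

theorem natCast_dvd_of_primeFactors {N : ℕ} (hN : Squarefree N) {x : ℤ}
    (h : ∀ r ∈ N.primeFactors, ((x : ℤ) : ZMod r) = 0) : (N : ℤ) ∣ x := by
  rw [Int.natCast_dvd, ← Nat.prod_primeFactors_of_squarefree hN]
  refine Finset.prod_primes_dvd _ (fun r hr => (Nat.prime_of_mem_primeFactors hr).prime)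
    fun r hr => ?_
  rw [← Int.natCast_dvd, ← ZMod.intCast_zmod_eq_zero_iff_dvd]
  exact h r hr

theorem exists_int_eq_residues (N : ℕ) (f : ∀ r : ℕ, ZMod r) :
    ∃ a : ℤ, ∀ r ∈ N.primeFactors, (a : ZMod r) = f r := by
  obtain ⟨a, ha⟩ := Nat.chineseRemainderOfFinset (fun r : ℕ => (f r).val) id (t := N.primeFactors)
    (fun r hr => (Nat.prime_of_mem_primeFactors hr).ne_zero)
    (fun r hr s hs hrs => (Nat.coprime_primes (Nat.prime_of_mem_primeFactors hr)
      (Nat.prime_of_mem_primeFactors hs)).2 hrs)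
  refine ⟨a, fun r hr => ?_⟩
  have : NeZero r := ⟨(Nat.prime_of_mem_primeFactors hr).ne_zero⟩
  have h1 := (ZMod.natCast_eq_natCast_iff _ _ _).2 (ha r hr)
  simpa using h1

/-- Lifts a primitive row modulo `n` to a primitive integral row. With `w ≡ v₀` nonzero, `v₁` is a
unit modulo `gcd(w, n)` and lifts to a unit modulo `w`; adding a multiple of `w`, found from Bézout
for `(w, n)`, makes it congruent to `v₁` modulo `n` and keeps it coprime to `w`. -/
theorem exists_isCoprime_of_residues {n : ℕ} (hn : n ≠ 0) (v₀ v₁ : ℤ)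
    (h : ∀ r : ℕ, r.Prime → r ∣ n → ¬ ((r : ℤ) ∣ v₀ ∧ (r : ℤ) ∣ v₁)) :
    ∃ w₀ w₁ : ℤ, IsCoprime w₀ w₁ ∧ (n : ℤ) ∣ w₀ - v₀ ∧ (n : ℤ) ∣ w₁ - v₁ := by
  obtain ⟨w, hw, hwn⟩ : ∃ w : ℤ, w ≠ 0 ∧ (n : ℤ) ∣ w - v₀ := by
    by_cases h0 : v₀ = 0
    · exact ⟨n, by exact_mod_cast hn, by rw [h0, sub_zero]⟩
    · exact ⟨v₀, h0, by simp⟩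
  have : NeZero w.natAbs := ⟨by simpa using hw⟩
  have hg : Int.gcd w n ∣ w.natAbs := Int.natCast_dvd.1 (Int.gcd_dvd_left ..)
  have hcop : v₁.natAbs.Coprime (Int.gcd w n) := by
    refine Nat.Coprime.symm (Nat.coprime_of_dvd fun r hr hr1 hr2 => ?_)
    have hrn : r ∣ n := by
      have := Int.gcd_dvd_right (a := w) (b := (n : ℤ))
      exact hr1.trans (by exact_mod_cast this)
    refine h r hr hrn ⟨?_, Int.natCast_dvd.2 hr2⟩
    have h1 : (r : ℤ) ∣ w := (Int.natCast_dvd.2 (hr1.trans hg))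
    have h2 : (r : ℤ) ∣ w - v₀ := dvd_trans (by exact_mod_cast hrn) hwn
    exact (dvd_sub_right h1).1 h2
  have hu : IsUnit (v₁ : ZMod (Int.gcd w n)) := by
    rw [ZMod.coe_int_isUnit_iff_isCoprime, Int.isCoprime_iff_gcd_eq_one]
    simpa [Int.gcd, Nat.Coprime, Nat.gcd_comm] using hcop
  obtain ⟨y, hy⟩ := ZMod.unitsMap_surjective hg hu.unit
  obtain ⟨y₀, hy₀⟩ := ZMod.intCast_surjective (y : ZMod w.natAbs)
  have hy1 : (y₀ : ZMod (Int.gcd w n)) = v₁ := by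
    have h1 := congrArg Units.val hy
    rw [ZMod.unitsMap_val, ← hy₀] at h1
    simpa [ZMod.cast_intCast hg] using h1
  have hy2 : IsCoprime w y₀ := by
    have h1 : IsUnit (y₀ : ZMod w.natAbs) := hy₀ ▸ y.isUnit
    rw [ZMod.coe_int_isUnit_iff_isCoprime] at h1
    rcases Int.natAbs_eq w with h | h
    · rw [h]; exact h1
    · rw [h]; exact h1.neg_left
  obtain ⟨m, hm⟩ := (ZMod.intCast_eq_intCast_iff_dvd_sub _ _ _).1 hy1
  have hbez := Int.gcd_eq_gcd_ab w n
  refine ⟨w, y₀ + w * (Int.gcdA w n * m), ?_, hwn, ⟨-(Int.gcdB w n * m), ?_⟩⟩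
  · exact IsCoprime.add_mul_left_right hy2 _
  · rw [hbez] at hm
    linear_combination (-1) * hm

theorem exists_row_relation {r : ℕ} [Fact r.Prime] {a b c d : ZMod r} (h : a * d - b * c = 0) :
    ∃ v w : ZMod r, (v ≠ 0 ∨ w ≠ 0) ∧ v * a + w * c = 0 ∧ v * b + w * d = 0 := by
  by_cases h1 : c = 0 ∧ a = 0
  · obtain ⟨rfl, rfl⟩ := h1
    by_cases h2 : b = 0 ∧ d = 0
    · obtain ⟨rfl, rfl⟩ := h2
      exact ⟨1, 0, by simp, by simp, by simp⟩
    · refine ⟨d, -b, ?_, by simp, by ring⟩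
      by_contra hc
      push Not at hc
      exact h2 ⟨by simpa using hc.2, hc.1⟩
  · refine ⟨c, -a, ?_, by ring, by linear_combination -h⟩
    by_contra hc
    push Not at hc
    exact h1 ⟨hc.1, by simpa using hc.2⟩

/-- Over a field, a symmetric `S` with `M (A + S C) = C` for `M = 0`, `diag(1, 0)` or `1`, when
`AᵀC` is symmetric and `C` has the shape of the corresponding cusp. -/
theorem exists_symm_shift {F : Type*} [Field F] {a₀₀ a₀₁ a₁₀ a₁₁ c₀₀ c₀₁ c₁₀ c₁₁ m₀ m₁ : F}
    (hsym : a₀₀ * c₀₁ + a₁₀ * c₁₁ = c₀₀ * a₀₁ + c₁₀ * a₁₁)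
    (h : (m₀ = 0 ∧ m₁ = 0 ∧ c₀₀ = 0 ∧ c₀₁ = 0 ∧ c₁₀ = 0 ∧ c₁₁ = 0) ∨
      (m₀ = 1 ∧ m₁ = 0 ∧ (c₀₀ ≠ 0 ∨ c₀₁ ≠ 0) ∧ c₁₀ = 0 ∧ c₁₁ = 0) ∨
      (m₀ = 1 ∧ m₁ = 1 ∧ c₀₀ * c₁₁ - c₁₀ * c₀₁ ≠ 0)) :
    ∃ s₁ s₂ s₃ : F, m₀ * (a₀₀ + s₁ * c₀₀ + s₂ * c₁₀) = c₀₀ ∧ m₀ * (a₀₁ + s₁ * c₀₁ + s₂ * c₁₁) = c₀₁ ∧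
      m₁ * (a₁₀ + s₂ * c₀₀ + s₃ * c₁₀) = c₁₀ ∧ m₁ * (a₁₁ + s₂ * c₀₁ + s₃ * c₁₁) = c₁₁ := by
  rcases h with ⟨rfl, rfl, rfl, rfl, rfl, rfl⟩ | ⟨rfl, rfl, h, rfl, rfl⟩ | ⟨rfl, rfl, h⟩
  · exact ⟨0, 0, 0, by simp⟩
  · simp only [mul_zero, zero_mul, add_zero] at hsym
    rcases h with h | h
    · refine ⟨1 - a₀₀ / c₀₀, 0, 0, by field_simp; ring, ?_, by simp, by simp⟩
      field_simp
      linear_combination -hsym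
    · refine ⟨1 - a₀₁ / c₀₁, 0, 0, ?_, by field_simp; ring, by simp, by simp⟩
      field_simp
      linear_combination hsym
  · obtain ⟨i, hi⟩ := exists_eq_mul_left_of_dvd (isUnit_iff_dvd_one.1 (isUnit_iff_ne_zero.2 h))
    -- This is `S = 1 - A C⁻¹`, the solution of `A + S C = C`, with `i` the inverse of `det C`; the
    -- symmetry of `AᵀC` makes it symmetric.
    refine ⟨1 - (a₀₀ * c₁₁ - a₀₁ * c₁₀) * i, (a₀₀ * c₀₁ - a₀₁ * c₀₀) * i,
      1 - (a₁₁ * c₀₀ - a₁₀ * c₀₁) * i, ?_, ?_, ?_, ?_⟩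
    · linear_combination a₀₀ * hi
    · linear_combination a₀₁ * hi
    · linear_combination a₁₀ * hi + c₀₀ * i * hsym
    · linear_combination a₁₁ * hi + c₀₁ * i * hsym

/-- The diagonal entries of `M_ρ`. -/
def cuspEntry (N₀ N₁ N₂ : ℕ) : Fin 2 → ℤ :=
  ![(N₀ : ℤ) ^ (N₁ * N₂).totient, ((N₀ * N₁ : ℕ) : ℤ) ^ N₂.totient]

theorem cusp_mul_apply (N₀ N₁ N₂ : ℕ) (γ : Sp) (i : Fin 2) (y : Fin 2 ⊕ Fin 2) :
    ((cusp N₀ N₁ N₂ * γ : Sp) : Mat4) (.inr i) y =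
      cuspEntry N₀ N₁ N₂ i * (γ : Mat4) (.inl i) y + (γ : Mat4) (.inr i) y := by
  fin_cases i <;>
  simp [Matrix.mul_apply, cusp, cuspMatrix, cuspEntry, Fin.sum_univ_two, Matrix.one_apply]

theorem cusp_inv_mul_apply (N₀ N₁ N₂ : ℕ) (γ : Sp) (i : Fin 2) (y : Fin 2 ⊕ Fin 2) :
    (((cusp N₀ N₁ N₂)⁻¹ * γ : Sp) : Mat4) (.inr i) y =
      -cuspEntry N₀ N₁ N₂ i * (γ : Mat4) (.inl i) y + (γ : Mat4) (.inr i) y := by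
  have hl : ∀ j y, (((cusp N₀ N₁ N₂)⁻¹ * γ : Sp) : Mat4) (.inl j) y = (γ : Mat4) (.inl j) y := by
    intro j y
    have h : γ = cusp N₀ N₁ N₂ * ((cusp N₀ N₁ N₂)⁻¹ * γ) := by group
    conv_rhs => rw [h]
    generalize (cusp N₀ N₁ N₂)⁻¹ * γ = η
    fin_cases j <;> simp [Matrix.mul_apply, cusp, Matrix.one_apply]
  have h1 := cusp_mul_apply N₀ N₁ N₂ ((cusp N₀ N₁ N₂)⁻¹ * γ) i y
  rw [mul_inv_cancel_left, hl] at h1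
  rw [h1]; ring

section Residues

variable {N₀ N₁ N₂ r : ℕ}

theorem cuspEntry_of_dvd_left (hN : N₀ * N₁ * N₂ ≠ 0) (h : r ∣ N₀) :
    ((cuspEntry N₀ N₁ N₂ 0 : ℤ) : ZMod r) = 0 ∧ ((cuspEntry N₀ N₁ N₂ 1 : ℤ) : ZMod r) = 0 := by
  simp only [ne_eq, mul_eq_zero, not_or] at hN
  have h0 : (N₀ : ZMod r) = 0 := (ZMod.natCast_eq_zero_iff _ _).2 h
  have h1 : (N₁ * N₂).totient ≠ 0 := by simp [hN]
  have h2 : N₂.totient ≠ 0 := by simp [hN]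
  simp [cuspEntry, h0, h1, h2]

/-- The residue `1` is Euler's theorem modulo `N₁ N₂`. -/
theorem cuspEntry_of_dvd_mid (hN : Squarefree (N₀ * N₁ * N₂)) (h : r ∣ N₁) :
    ((cuspEntry N₀ N₁ N₂ 0 : ℤ) : ZMod r) = 1 ∧ ((cuspEntry N₀ N₁ N₂ 1 : ℤ) : ZMod r) = 0 := by
  have hN' := hN.ne_zero
  simp only [ne_eq, mul_eq_zero, not_or] at hN'
  have h0 : (N₁ : ZMod r) = 0 := (ZMod.natCast_eq_zero_iff _ _).2 h
  have h2 : N₂.totient ≠ 0 := by simp [hN']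
  have hc : N₀.Coprime (N₁ * N₂) := Nat.coprime_of_squarefree_mul (by rwa [← mul_assoc])
  have h3 := (ZMod.natCast_eq_natCast_iff _ _ r).2
    ((Nat.ModEq.pow_totient hc).of_dvd (h.mul_right N₂))
  refine ⟨?_, by simp [cuspEntry, h0, h2]⟩
  push_cast at h3
  simpa [cuspEntry] using h3

theorem cuspEntry_of_dvd_right (hN : Squarefree (N₀ * N₁ * N₂)) (h : r ∣ N₂) :
    ((cuspEntry N₀ N₁ N₂ 0 : ℤ) : ZMod r) = 1 ∧ ((cuspEntry N₀ N₁ N₂ 1 : ℤ) : ZMod r) = 1 := by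
  have hc : N₀.Coprime (N₁ * N₂) := Nat.coprime_of_squarefree_mul (by rwa [← mul_assoc])
  have hc2 : (N₀ * N₁).Coprime N₂ := Nat.coprime_of_squarefree_mul hN
  have h3 := (ZMod.natCast_eq_natCast_iff _ _ r).2
    ((Nat.ModEq.pow_totient hc).of_dvd (h.mul_left N₁))
  have h4 := (ZMod.natCast_eq_natCast_iff _ _ r).2 ((Nat.ModEq.pow_totient hc2).of_dvd h)
  push_cast at h3 h4
  exact ⟨by simpa [cuspEntry] using h3, by simpa [cuspEntry] using h4⟩

end Residues

/-- The shape modulo the primes dividing `N₀ N₁ N₂` of the minors of elements of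
`γ_ρ Γ₀(N₀ N₁ N₂)`. -/
def HasCuspType (N₀ N₁ N₂ r : ℕ) (u : Mat4) : Prop :=
  (r ∣ N₀ → ((cB u : ZMod r) = 0 ∧ (cX u : ZMod r) = 0 ∧ (cY u : ZMod r) = 0 ∧
    (cZ u : ZMod r) = 0 ∧ (cE u : ZMod r) ≠ 0)) ∧
  (r ∣ N₁ → ((cB u : ZMod r) = 0 ∧ ¬ ((cX u : ZMod r) = 0 ∧ (cZ u : ZMod r) = 0))) ∧
  (r ∣ N₂ → (cB u : ZMod r) ≠ 0)

/-- Left multiplication by `levi U` and `upperUnip` does not change the minors, so it suffices to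
choose `U` and `S` making the lower left block of `γ_ρ⁻¹ · upperUnip S · levi U · η` vanish modulo
`N`. This amounts to `M_ρ (A + S C) = C` for the blocks of `levi U · η`, which `exists_symm_shift`
solves modulo each prime. The matrix `U` is needed at the primes of `N₁`, where `C` has rank one and
its second row must be made zero. -/
theorem exists_gamma0_of_hasCuspType {N₀ N₁ N₂ : ℕ} (hN : Squarefree (N₀ * N₁ * N₂)) {u : Mat4}
    (hu : u ∈ plueckerSet) (h : ∀ r ∈ (N₀ * N₁ * N₂).primeFactors, HasCuspType N₀ N₁ N₂ r u) :
    ∃ γ ∈ Gamma0 (N₀ * N₁ * N₂), pluecker (cusp N₀ N₁ N₂ * γ) = u := by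
  obtain ⟨η, rfl⟩ := hu
  set N := N₀ * N₁ * N₂ with hNdef
  have hN1N : N₁ ∣ N := ⟨N₀ * N₂, by rw [hNdef]; ring⟩
  -- a row relation modulo `N₁`, lifted to a primitive row
  have hrow : ∀ r : ℕ, ∃ p : ZMod r × ZMod r, r ∈ N.primeFactors → r ∣ N₁ → (p.1 ≠ 0 ∨ p.2 ≠ 0) ∧
      ∀ j, p.1 * ((η : Mat4) (.inr 0) (.inl j) : ZMod r)
        + p.2 * ((η : Mat4) (.inr 1) (.inl j) : ZMod r) = 0 := by
    intro r
    by_cases hr : r ∈ N.primeFactors ∧ r ∣ N₁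
    · have : Fact r.Prime := ⟨Nat.prime_of_mem_primeFactors hr.1⟩
      have hb := ((h r hr.1).2.1 hr.2).1
      rw [cB, pluecker_apply] at hb
      push_cast at hb
      obtain ⟨v, w, h1, h2, h3⟩ := exists_row_relation (r := r)
        (a := ((η : Mat4) (.inr 0) (.inl 0) : ZMod r)) (b := ((η : Mat4) (.inr 0) (.inl 1) : ZMod r))
        (c := ((η : Mat4) (.inr 1) (.inl 0) : ZMod r)) (d := ((η : Mat4) (.inr 1) (.inl 1) : ZMod r))
        (by linear_combination hb)
      refine ⟨(v, w), fun _ _ => ⟨h1, fun j => ?_⟩⟩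
      fin_cases j
      · exact h2
      · exact h3
    · exact ⟨(0, 0), fun h1 h2 => absurd ⟨h1, h2⟩ hr⟩
  choose p hp using hrow
  obtain ⟨v₀, hv₀⟩ := exists_int_eq_residues N fun r => (p r).1
  obtain ⟨v₁, hv₁⟩ := exists_int_eq_residues N fun r => (p r).2
  have hN1 : N₁ ≠ 0 := fun h0 => by
    rw [h0, mul_zero, zero_mul] at hNdef; exact hN.ne_zero hNdef
  have hmem : ∀ r : ℕ, r.Prime → r ∣ N₁ → r ∈ N.primeFactors := fun r hr h1 =>
    Nat.mem_primeFactors.2 ⟨hr, h1.trans hN1N, hN.ne_zero⟩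
  obtain ⟨w₀, w₁, ⟨t₀, t₁, ht⟩, hw₀, hw₁⟩ := exists_isCoprime_of_residues hN1 v₀ v₁ (by
    rintro r hr h1 ⟨h2, h3⟩
    have h4 := hmem r hr h1
    rw [← ZMod.intCast_zmod_eq_zero_iff_dvd, hv₀ r h4] at h2
    rw [← ZMod.intCast_zmod_eq_zero_iff_dvd, hv₁ r h4] at h3
    rcases (hp r h4 h1).1 with h5 | h5
    · exact h5 h2
    · exact h5 h3)
  -- The lifted relation is the bottom row of `U`; the Bézout coefficients complete it to
  -- determinant one.
  let U : SpecialLinearGroup (Fin 2) ℤ := ⟨!![t₁, -t₀; w₀, w₁], by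
    rw [det_fin_two]; simp; linear_combination ht⟩
  set η₁ := levi U * η with hη₁
  have hpl : pluecker η₁ = pluecker η := pluecker_mul_left (levi_mem_gammaInfPlus U) η
  rw [← hpl] at h ⊢
  have hC1 : ∀ r ∈ N.primeFactors, r ∣ N₁ → ∀ j, ((η₁ : Mat4) (.inr 1) (.inl j) : ZMod r) = 0 := by
    intro r hr h1 j
    have e1 : (η₁ : Mat4) (.inr 1) (.inl j) =
        w₀ * (η : Mat4) (.inr 0) (.inl j) + w₁ * (η : Mat4) (.inr 1) (.inl j) := by
      rw [hη₁]
      simp [Matrix.mul_apply, levi, Fin.sum_univ_two, U]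
    have e2 : (w₀ : ZMod r) = (p r).1 := by
      rw [← hv₀ r hr]
      have h2 := (ZMod.intCast_zmod_eq_zero_iff_dvd _ r).2 (dvd_trans (Int.natCast_dvd_natCast.2 h1) hw₀)
      push_cast at h2
      exact sub_eq_zero.1 h2
    have e3 : (w₁ : ZMod r) = (p r).2 := by
      rw [← hv₁ r hr]
      have h2 := (ZMod.intCast_zmod_eq_zero_iff_dvd _ r).2 (dvd_trans (Int.natCast_dvd_natCast.2 h1) hw₁)
      push_cast at h2
      exact sub_eq_zero.1 h2
    rw [e1]
    push_cast
    rw [e2, e3]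
    exact (hp r hr h1).2 j
  -- the symmetric shift
  have hS : ∀ r : ℕ, ∃ s : ZMod r × ZMod r × ZMod r, r ∈ N.primeFactors →
      ∀ j, ((cuspEntry N₀ N₁ N₂ 0 : ℤ) : ZMod r) * (((η₁ : Mat4) (.inl 0) (.inl j) : ZMod r) +
          s.1 * ((η₁ : Mat4) (.inr 0) (.inl j) : ZMod r) +
          s.2.1 * ((η₁ : Mat4) (.inr 1) (.inl j) : ZMod r)) =
          ((η₁ : Mat4) (.inr 0) (.inl j) : ZMod r) ∧
        ((cuspEntry N₀ N₁ N₂ 1 : ℤ) : ZMod r) * (((η₁ : Mat4) (.inl 1) (.inl j) : ZMod r) +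
          s.2.1 * ((η₁ : Mat4) (.inr 0) (.inl j) : ZMod r) +
          s.2.2 * ((η₁ : Mat4) (.inr 1) (.inl j) : ZMod r)) =
          ((η₁ : Mat4) (.inr 1) (.inl j) : ZMod r) := by
    intro r
    by_cases hr : r ∈ N.primeFactors
    swap
    · exact ⟨(0, 0, 0), fun h1 => absurd h1 hr⟩
    have hrp := Nat.prime_of_mem_primeFactors hr
    have : Fact r.Prime := ⟨hrp⟩
    have hsym := congrArg (Int.cast : ℤ → ZMod r) (symplectic_relations η₁).1
    push_cast at hsym
    obtain ⟨s₁, s₂, s₃, h1, h2, h3, h4⟩ := exists_symm_shift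
      (m₀ := ((cuspEntry N₀ N₁ N₂ 0 : ℤ) : ZMod r)) (m₁ := ((cuspEntry N₀ N₁ N₂ 1 : ℤ) : ZMod r))
      hsym (by
        have hd : r ∣ N₀ ∨ r ∣ N₁ ∨ r ∣ N₂ := by
          have := Nat.dvd_of_mem_primeFactors hr
          rw [hNdef, hrp.dvd_mul, hrp.dvd_mul] at this
          tauto
        rcases hd with hd | hd | hd
        · obtain ⟨-, hX, hY, hZ, hE⟩ := (h r hr).1 hd
          have hW := inl_zero_inr_zero_of_mem (u := pluecker η₁) ⟨_, rfl⟩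
          obtain ⟨m0, m1⟩ := cuspEntry_of_dvd_left hN.ne_zero hd
          refine Or.inl ⟨m0, m1, ?_⟩
          have hW' := congrArg (Int.cast : ℤ → ZMod r) hW
          simp only [cX, cY, cZ, cE, pluecker_apply] at hX hY hZ hE hW'
          push_cast at hX hY hZ hE hW'
          rw [hY] at hW'
          -- The combinations are the entries of `D · adj(D) C = det D · C`, where `adj(D) C = 0`
          -- and `det D ≠ 0` modulo `r`.
          refine ⟨?_, ?_, ?_, ?_⟩ <;> refine (mul_eq_zero.1 ?_).resolve_left hE
          · linear_combination ((η₁ : Mat4) (.inr 0) (.inr 0) : ZMod r) * hX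
              - ((η₁ : Mat4) (.inr 0) (.inr 1) : ZMod r) * hW'
          · linear_combination ((η₁ : Mat4) (.inr 0) (.inr 0) : ZMod r) * hY
              + ((η₁ : Mat4) (.inr 0) (.inr 1) : ZMod r) * hZ
          · linear_combination ((η₁ : Mat4) (.inr 1) (.inr 0) : ZMod r) * hX
              - ((η₁ : Mat4) (.inr 1) (.inr 1) : ZMod r) * hW'
          · linear_combination ((η₁ : Mat4) (.inr 1) (.inr 0) : ZMod r) * hY
              + ((η₁ : Mat4) (.inr 1) (.inr 1) : ZMod r) * hZ
        · obtain ⟨m0, m1⟩ := cuspEntry_of_dvd_mid hN hd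
          refine Or.inr (Or.inl ⟨m0, m1, ?_, hC1 r hr hd 0, hC1 r hr hd 1⟩)
          by_contra hc
          push Not at hc
          apply ((h r hr).2.1 hd).2
          simp only [cX, cZ, pluecker_apply]
          push_cast
          rw [hC1 r hr hd 0, hC1 r hr hd 1, hc.1, hc.2]
          simp
        · obtain ⟨m0, m1⟩ := cuspEntry_of_dvd_right hN hd
          refine Or.inr (Or.inr ⟨m0, m1, ?_⟩)
          have hB := (h r hr).2.2 hd
          simp only [cB, pluecker_apply] at hB
          push_cast at hB
          exact hB)
    refine ⟨(s₁, s₂, s₃), fun _ j => ?_⟩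
    fin_cases j
    · exact ⟨h1, h3⟩
    · exact ⟨h2, h4⟩
  choose s hs using hS
  obtain ⟨s₁, hs₁⟩ := exists_int_eq_residues N fun r => (s r).1
  obtain ⟨s₂, hs₂⟩ := exists_int_eq_residues N fun r => (s r).2.1
  obtain ⟨s₃, hs₃⟩ := exists_int_eq_residues N fun r => (s r).2.2
  refine ⟨(cusp N₀ N₁ N₂)⁻¹ * (upperUnip s₁ s₂ s₃ * η₁), ?_, ?_⟩
  · intro i j
    refine natCast_dvd_of_primeFactors hN fun r hr => ?_
    have h1 := hs r hr j
    rw [blockC_apply, cusp_inv_mul_apply]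
    have e1 : ∀ i, ((upperUnip s₁ s₂ s₃ * η₁ : Sp) : Mat4) (.inr i) (.inl j) =
        (η₁ : Mat4) (.inr i) (.inl j) := by
      intro i
      fin_cases i <;> simp [Matrix.mul_apply, upperUnip, Matrix.one_apply]
    have e2 : ((upperUnip s₁ s₂ s₃ * η₁ : Sp) : Mat4) (.inl 0) (.inl j) =
        (η₁ : Mat4) (.inl 0) (.inl j) + s₁ * (η₁ : Mat4) (.inr 0) (.inl j) +
          s₂ * (η₁ : Mat4) (.inr 1) (.inl j) := by
      simp [Matrix.mul_apply, upperUnip, Fin.sum_univ_two, Matrix.one_apply]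
      ring
    have e3 : ((upperUnip s₁ s₂ s₃ * η₁ : Sp) : Mat4) (.inl 1) (.inl j) =
        (η₁ : Mat4) (.inl 1) (.inl j) + s₂ * (η₁ : Mat4) (.inr 0) (.inl j) +
          s₃ * (η₁ : Mat4) (.inr 1) (.inl j) := by
      simp [Matrix.mul_apply, upperUnip, Fin.sum_univ_two, Matrix.one_apply]
      ring
    rw [e1]
    fin_cases i
    · simp only [Fin.zero_eta]
      rw [e2]
      push_cast
      rw [hs₁ r hr, hs₂ r hr]
      linear_combination -h1.1
    · simp only [Fin.mk_one]
      rw [e3]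
      push_cast
      rw [hs₂ r hr, hs₃ r hr]
      linear_combination -h1.2
  · rw [mul_inv_cancel_left]
    exact pluecker_mul_left (upperUnip_mem_gammaInfPlus _ _ _) _

end Orbits

end SiegelTwo

end

noncomputable section

namespace SiegelTwo

open Matrix

/-! ### The coefficients of the Eisenstein series as products of local weights. -/

section Weights

/-- The value at `r` of the coefficient of `𝔼_ρ` at the minors `u`. -/
def localWeight {N : ℕ} (χ : DirichletCharacter ℂ N) (N₀ N₁ r : ℕ) (u : Mat4) : ℂ :=
  if r ∣ N₀ then
    if (cB u : ZMod r) = 0 ∧ (cX u : ZMod r) = 0 ∧ (cY u : ZMod r) = 0 ∧ (cZ u : ZMod r) = 0 then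
      starRingEnd ℂ (charPart χ r (cE u : ZMod r)) else 0
  else if r ∣ N₁ then
    if (cB u : ZMod r) = 0 ∧ ¬ ((cX u : ZMod r) = 0 ∧ (cZ u : ZMod r) = 0) then
      starRingEnd ℂ (charPart χ r (if (cX u : ZMod r) = 0 then (cZ u : ZMod r) else cX u)) else 0
  else charPart χ r (cB u : ZMod r)

open Classical in
/-- The coefficient of `𝔼_ρ` at the minors `u`. -/
def cuspWeight {N : ℕ} (χ : DirichletCharacter ℂ N) (N₀ N₁ : ℕ) (u : Mat4) : ℂ :=
  if u ∈ plueckerSet then ∏ r ∈ N.primeFactors, localWeight χ N₀ N₁ r u else 0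

theorem norm_localWeight_le {N : ℕ} (χ : DirichletCharacter ℂ N) (N₀ N₁ r : ℕ) (u : Mat4) :
    ‖localWeight χ N₀ N₁ r u‖ ≤ 1 := by
  unfold localWeight
  split_ifs <;> simp [DirichletCharacter.norm_le_one]

theorem norm_cuspWeight_le {N : ℕ} (χ : DirichletCharacter ℂ N) (N₀ N₁ : ℕ) (u : Mat4) :
    ‖cuspWeight χ N₀ N₁ u‖ ≤ 1 := by
  unfold cuspWeight
  split_ifs
  · rw [norm_prod]
    exact Finset.prod_le_one (fun _ _ => norm_nonneg _) fun r _ => norm_localWeight_le χ N₀ N₁ r u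
  · simp

theorem cuspWeight_of_notMem {N : ℕ} (χ : DirichletCharacter ℂ N) (N₀ N₁ : ℕ) {u : Mat4}
    (hu : u ∉ plueckerSet) : cuspWeight χ N₀ N₁ u = 0 := if_neg hu

theorem mem_of_cuspWeight_ne_zero {N : ℕ} {χ : DirichletCharacter ℂ N} {N₀ N₁ : ℕ} {u : Mat4}
    (h : cuspWeight χ N₀ N₁ u ≠ 0) : u ∈ plueckerSet := by
  by_contra hu
  exact h (cuspWeight_of_notMem χ N₀ N₁ hu)

theorem ne_zero_of_charPart_ne_zero {N r : ℕ} [Fact r.Prime] {χ : DirichletCharacter ℂ N}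
    {a : ZMod r} (h : charPart χ r a ≠ 0) : a ≠ 0 := by
  rintro rfl
  exact h (MulChar.map_zero _)

theorem not_dvd_of_squarefree {N₀ N₁ N₂ r : ℕ} (hN : Squarefree (N₀ * N₁ * N₂)) (hr : r.Prime) :
    (r ∣ N₀ → ¬ r ∣ N₁ ∧ ¬ r ∣ N₂) ∧ (r ∣ N₁ → ¬ r ∣ N₂) := by
  have h1 := Nat.coprime_of_squarefree_mul hN
  have h2 := Nat.coprime_of_squarefree_mul (hN.squarefree_of_dvd (dvd_mul_right _ _))
  have key : ∀ {a b : ℕ}, a.Coprime b → r ∣ a → ¬ r ∣ b := fun hab ha hb =>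
    hr.one_lt.ne' (Nat.dvd_one.1 (hab ▸ Nat.dvd_gcd ha hb))
  exact ⟨fun h => ⟨key h2 h, key h1 (h.mul_right _)⟩, fun h => key h1 (h.mul_left _)⟩

theorem hasCuspType_of_localWeight_ne_zero {N N₀ N₁ N₂ r : ℕ} {χ : DirichletCharacter ℂ N}
    (hN : Squarefree (N₀ * N₁ * N₂)) [Fact r.Prime] {u : Mat4}
    (h : localWeight χ N₀ N₁ r u ≠ 0) : HasCuspType N₀ N₁ N₂ r u := by
  obtain ⟨k1, k2⟩ := not_dvd_of_squarefree hN (Fact.out : r.Prime)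
  unfold localWeight at h
  split_ifs at h with h0 hc h1 hc hx
  · refine ⟨fun _ => ⟨hc.1, hc.2.1, hc.2.2.1, hc.2.2.2, ?_⟩, fun h => absurd h (k1 h0).1,
      fun h => absurd h (k1 h0).2⟩
    exact ne_zero_of_charPart_ne_zero fun h2 => h (by rw [h2, map_zero])
  · exact absurd rfl h
  · exact ⟨fun h => absurd h h0, fun _ => hc, fun h => absurd h (k2 h1)⟩
  · exact ⟨fun h => absurd h h0, fun _ => hc, fun h => absurd h (k2 h1)⟩
  · exact absurd rfl h
  · exact ⟨fun h => absurd h h0, fun h => absurd h h1, fun _ => ne_zero_of_charPart_ne_zero h⟩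

/-- Modulo `r` one has `C = 0` and `AᵀD = 1`, and the lower left block of `γ_ρ γ` is `M_ρ A`. For `r
∣ N₁` the diagonal entries are `x = det D · a₀₀²` and `z = det D · a₀₁²`, so `χ_r² = 1` gives
`χ_r(det D)` from whichever is nonzero. For `r ∣ N₂` one has `b = det A = (det D)⁻¹`, which accounts
for the absent conjugation there. -/
theorem localWeight_pluecker {N N₀ N₁ N₂ r : ℕ} {χ : DirichletCharacter ℂ N} (hN : Squarefree N)
    (hρ : N₀ * N₁ * N₂ = N) (hr : r ∈ N.primeFactors) (hχ : r ∣ N₁ → charPart χ r ^ 2 = 1)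
    {γ : Sp} (hγ : γ ∈ Gamma0 N) :
    localWeight χ N₀ N₁ r (pluecker (cusp N₀ N₁ N₂ * γ)) =
      starRingEnd ℂ (charPart χ r ((blockD γ).det : ZMod r)) := by
  subst hρ
  have hrp := Nat.prime_of_mem_primeFactors hr
  have : Fact r.Prime := ⟨hrp⟩
  have hc : ∀ i j, ((γ : Mat4) (.inr i) (.inl j) : ZMod r) = 0 := fun i j => by
    rw [ZMod.intCast_zmod_eq_zero_iff_dvd]
    exact dvd_trans (Int.natCast_dvd_natCast.2 (Nat.dvd_of_mem_primeFactors hr)) (hγ i j)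
  have hrel := fun i j => congrArg (Int.cast : ℤ → ZMod r) ((symplectic_relations γ).2.2 i j)
  push_cast at hrel
  simp only [hc, zero_mul, sub_zero] at hrel
  have r00 := hrel 0 0
  have r01 := hrel 0 1
  have r10 := hrel 1 0
  have r11 := hrel 1 1
  simp only [if_true, zero_ne_one, one_ne_zero, if_false] at r00 r01 r10 r11
  have hdet : (((blockD γ).det : ℤ) : ZMod r) =
      ((γ : Mat4) (.inr 0) (.inr 0) : ZMod r) * ((γ : Mat4) (.inr 1) (.inr 1) : ZMod r) -
      ((γ : Mat4) (.inr 0) (.inr 1) : ZMod r) * ((γ : Mat4) (.inr 1) (.inr 0) : ZMod r) := by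
    rw [det_fin_two]
    simp only [blockD_apply]
    push_cast
    ring
  rw [hdet]
  unfold localWeight
  simp only [cB, cX, cY, cZ, cE, pluecker_apply, cusp_mul_apply]
  push_cast
  simp only [hc, add_zero]
  by_cases h0 : r ∣ N₀
  · obtain ⟨m0, m1⟩ := cuspEntry_of_dvd_left hN.ne_zero h0
    rw [if_pos h0, m0, m1]
    simp only [zero_mul, sub_zero, zero_add, neg_zero, and_self, if_true]
    congr 2
    ring
  rw [if_neg h0]
  by_cases h1 : r ∣ N₁
  · obtain ⟨m0, m1⟩ := cuspEntry_of_dvd_mid hN h1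
    rw [if_pos h1, m0, m1]
    generalize ((γ : Mat4) (.inl 0) (.inl 0) : ZMod r) = a00 at *
    generalize ((γ : Mat4) (.inl 0) (.inl 1) : ZMod r) = a01 at *
    generalize ((γ : Mat4) (.inl 1) (.inl 0) : ZMod r) = a10 at *
    generalize ((γ : Mat4) (.inl 1) (.inl 1) : ZMod r) = a11 at *
    generalize ((γ : Mat4) (.inr 0) (.inr 0) : ZMod r) = d00 at *
    generalize ((γ : Mat4) (.inr 0) (.inr 1) : ZMod r) = d01 at *
    generalize ((γ : Mat4) (.inr 1) (.inr 0) : ZMod r) = d10 at *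
    generalize ((γ : Mat4) (.inr 1) (.inr 1) : ZMod r) = d11 at *
    simp only [zero_mul, one_mul, mul_zero, sub_zero, zero_add, true_and]
    have hx : a00 * d11 = (d00 * d11 - d01 * d10) * a00 ^ 2 := by
      linear_combination (a00 * d10) * r01 - a00 * d11 * r00
    have hz : -(a01 * d10) = (d00 * d11 - d01 * d10) * a01 ^ 2 := by
      linear_combination (-a01 * d11) * r10 + a01 * d10 * r11
    have hA : (a00 * a11 - a10 * a01) * (d00 * d11 - d01 * d10) = 1 := by
      linear_combination (a01 * d01 + a11 * d11) * r00 + r11 - (a01 * d00 + a11 * d10) * r01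
    have hΔ := right_ne_zero_of_mul_eq_one hA
    have hsq : ∀ t : ZMod r, t ≠ 0 → charPart χ r ((d00 * d11 - d01 * d10) * t ^ 2) =
        charPart χ r (d00 * d11 - d01 * d10) := fun t ht => by
      rw [map_mul, map_pow, ← MulChar.pow_apply' _ two_ne_zero, hχ h1,
        MulChar.one_apply (isUnit_iff_ne_zero.2 ht), mul_one]
    rw [hx, hz]
    simp only [mul_eq_zero, hΔ, false_or, pow_eq_zero_iff two_ne_zero]
    rw [if_pos]
    · split_ifs with h2
      · rw [hsq]
        rintro rfl
        rw [h2] at hA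
        simp at hA
      · rw [hsq _ h2]
    · rintro ⟨h2, h3⟩
      rw [h2, h3] at hA
      simp at hA
  · have h2 : r ∣ N₂ := by
      have := Nat.dvd_of_mem_primeFactors hr
      rw [hrp.dvd_mul, hrp.dvd_mul] at this
      tauto
    obtain ⟨m0, m1⟩ := cuspEntry_of_dvd_right hN h2
    rw [if_neg h1, m0, m1, one_mul, one_mul, one_mul, one_mul, starRingEnd_apply,
      MulChar.star_apply', MulChar.inv_apply']
    congr 1
    refine eq_inv_of_mul_eq_one_left ?_
    generalize ((γ : Mat4) (.inl 0) (.inl 0) : ZMod r) = a00 at *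
    generalize ((γ : Mat4) (.inl 0) (.inl 1) : ZMod r) = a01 at *
    generalize ((γ : Mat4) (.inl 1) (.inl 0) : ZMod r) = a10 at *
    generalize ((γ : Mat4) (.inl 1) (.inl 1) : ZMod r) = a11 at *
    generalize ((γ : Mat4) (.inr 0) (.inr 0) : ZMod r) = d00 at *
    generalize ((γ : Mat4) (.inr 0) (.inr 1) : ZMod r) = d01 at *
    generalize ((γ : Mat4) (.inr 1) (.inr 0) : ZMod r) = d10 at *
    generalize ((γ : Mat4) (.inr 1) (.inr 1) : ZMod r) = d11 at *
    linear_combination (a01 * d01 + a11 * d11) * r00 + r11 - (a01 * d00 + a11 * d10) * r01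

/-- The hypotheses on a cusp under which `𝔼_ρ` is defined. -/
structure IsCusp {N : ℕ} (χ : DirichletCharacter ℂ N) (N₀ N₁ N₂ : ℕ) : Prop where
  squarefree : Squarefree N
  mul_eq : N₀ * N₁ * N₂ = N
  sq_eq_one : ∀ r, r.Prime → r ∣ N₁ → charPart χ r ^ 2 = 1

section

variable {N N₀ N₁ N₂ : ℕ} {χ : DirichletCharacter ℂ N} (h : IsCusp χ N₀ N₁ N₂)

include h in
theorem cuspWeight_pluecker {γ : Sp} (hγ : γ ∈ Gamma0 N) :
    cuspWeight χ N₀ N₁ (pluecker (cusp N₀ N₁ N₂ * γ)) =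
      starRingEnd ℂ (χ ((blockD γ).det : ZMod N)) := by
  rw [cuspWeight, if_pos ⟨_, rfl⟩, ← charPart_self χ h.squarefree,
    charPart_eq_prod χ h.squarefree _ N dvd_rfl, map_prod]
  exact Finset.prod_congr rfl fun r hr => localWeight_pluecker h.squarefree h.mul_eq hr
    (h.sq_eq_one r (Nat.prime_of_mem_primeFactors hr)) hγ

include h in
theorem exists_of_cuspWeight_ne_zero {u : Mat4} (hu : cuspWeight χ N₀ N₁ u ≠ 0) :
    ∃ γ ∈ Gamma0 N, pluecker (cusp N₀ N₁ N₂ * γ) = u := by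
  have hP := mem_of_cuspWeight_ne_zero hu
  rw [cuspWeight, if_pos hP, Finset.prod_ne_zero_iff] at hu
  have hN := h.squarefree
  obtain ⟨-, hρ, -⟩ := h
  subst hρ
  refine exists_gamma0_of_hasCuspType hN hP fun r hr => ?_
  have : Fact r.Prime := ⟨Nat.prime_of_mem_primeFactors hr⟩
  exact hasCuspType_of_localWeight_ne_zero hN (hu r hr)

/-- The block `C` of `γ` vanishes modulo `N`, so the block `D` is multiplicative modulo `N`. -/
theorem det_blockD_mul (χ : DirichletCharacter ℂ N) {γ η : Sp} (hγ : γ ∈ Gamma0 N) :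
    χ ((blockD (γ * η)).det : ZMod N) =
      χ ((blockD γ).det : ZMod N) * χ ((blockD η).det : ZMod N) := by
  obtain ⟨B, hB⟩ := blockD_mul γ η
  have hc : ∀ i j, ((blockC γ i j : ℤ) : ZMod N) = 0 := fun i j =>
    (ZMod.intCast_zmod_eq_zero_iff_dvd _ _).2 (hγ i j)
  rw [← map_mul, ← Int.cast_mul, ← det_mul, hB]
  congr 1
  simp only [det_fin_two, Matrix.add_apply, Matrix.mul_apply, Fin.sum_univ_two]
  push_cast
  simp only [hc, zero_mul, zero_add]

theorem star_det_blockD_mul_self (χ : DirichletCharacter ℂ N) {γ : Sp} (hγ : γ ∈ Gamma0 N) :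
    starRingEnd ℂ (χ ((blockD γ).det : ZMod N)) * χ ((blockD γ).det : ZMod N) = 1 := by
  have h1 := det_blockD_mul χ (η := γ⁻¹) hγ
  rw [mul_inv_cancel, blockD_one, det_one, Int.cast_one, map_one] at h1
  have hu : IsUnit ((blockD γ).det : ZMod N) := by
    by_contra hc
    rw [MulChar.map_nonunit _ hc, zero_mul] at h1
    exact one_ne_zero h1
  rw [starRingEnd_apply, MulChar.star_apply', ← MulChar.mul_apply, inv_mul_cancel,
    MulChar.one_apply hu]

-- The orbit supporting the weight is stable under `Γ₀(N)`, and on it the weight is `conj χ(det D)`,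
-- which is multiplicative.
include h in
theorem cuspWeight_act (u : Mat4) {γ : Sp} (hγ : γ ∈ Gamma0 N) :
    cuspWeight χ N₀ N₁ ((γ : Mat4)ᵀ * u * (γ : Mat4)) =
      starRingEnd ℂ (χ ((blockD γ).det : ZMod N)) * cuspWeight χ N₀ N₁ u := by
  by_cases hu : cuspWeight χ N₀ N₁ u = 0
  · rw [hu, mul_zero]
    by_contra hc
    obtain ⟨η, hη, he⟩ := exists_of_cuspWeight_ne_zero h hc
    refine absurd hu ?_
    have h1 : u = pluecker (cusp N₀ N₁ N₂ * (η * γ⁻¹)) := by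
      rw [← mul_assoc, pluecker_mul, he]
      symm
      calc _ = ((γ : Mat4) * ((γ⁻¹ : Sp) : Mat4))ᵀ * u * ((γ : Mat4) * ((γ⁻¹ : Sp) : Mat4)) := by
            simp only [transpose_mul, Matrix.mul_assoc]
        _ = _ := by rw [coe_mul_coe_inv]; simp
    have h2 := (Gamma0 N).mul_mem hη ((Gamma0 N).inv_mem hγ)
    rw [h1, cuspWeight_pluecker h h2]
    exact left_ne_zero_of_mul_eq_one (star_det_blockD_mul_self χ h2)
  · obtain ⟨η, hη, rfl⟩ := exists_of_cuspWeight_ne_zero h hu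
    rw [← pluecker_mul, mul_assoc, cuspWeight_pluecker h ((Gamma0 N).mul_mem hη hγ),
      cuspWeight_pluecker h hη, det_blockD_mul χ hη, map_mul, mul_comm]

end

end Weights

end SiegelTwo

end

noncomputable section

namespace SiegelTwo

open Matrix

/-! ### Conjugation by `δ` and its effect on matrices of minors. -/

section HeckeConjugation

theorem mul_heckeDelta_apply (p : ℕ) (X : Mat4) (x : Fin 2 ⊕ Fin 2) (j : Fin 2) :
    (X * heckeDelta p) x (.inl j) = p * X x (.inl j) ∧ (X * heckeDelta p) x (.inr j) = X x (.inr j) := by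
  have hp : (p : ℤ) • (1 : Matrix (Fin 2) (Fin 2) ℤ) = !![(p : ℤ), 0; 0, (p : ℤ)] := by
    ext i j; fin_cases i <;> fin_cases j <;> simp
  constructor <;> fin_cases j <;>
    simp [heckeDelta, hp, Matrix.mul_apply, Fin.sum_univ_two, Matrix.one_apply, mul_comm]

theorem heckeDelta_mul_apply (p : ℕ) (X : Mat4) (i : Fin 2) (y : Fin 2 ⊕ Fin 2) :
    (heckeDelta p * X) (.inl i) y = p * X (.inl i) y ∧ (heckeDelta p * X) (.inr i) y = X (.inr i) y := by
  have hp : (p : ℤ) • (1 : Matrix (Fin 2) (Fin 2) ℤ) = !![(p : ℤ), 0; 0, (p : ℤ)] := by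
    ext i j; fin_cases i <;> fin_cases j <;> simp
  constructor <;> fin_cases i <;>
    simp [heckeDelta, hp, Matrix.mul_apply, Fin.sum_univ_two, Matrix.one_apply]

theorem heckeDelta_transpose (p : ℕ) : (heckeDelta p)ᵀ = heckeDelta p := by
  simp [heckeDelta, fromBlocks_transpose]

theorem heckeDelta_act_injective {p : ℕ} (hp : p ≠ 0) {X Y : Mat4}
    (h : (heckeDelta p)ᵀ * X * heckeDelta p = (heckeDelta p)ᵀ * Y * heckeDelta p) : X = Y := by
  have hp' : (p : ℤ) ≠ 0 := by exact_mod_cast hp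
  rw [heckeDelta_transpose] at h
  have key : heckeDelta p * X = heckeDelta p * Y := by
    ext x y
    have h1 := congrFun (congrFun h x) y
    rcases y with y | y
    · rw [(mul_heckeDelta_apply _ _ _ _).1, (mul_heckeDelta_apply _ _ _ _).1] at h1
      exact mul_left_cancel₀ hp' h1
    · rwa [(mul_heckeDelta_apply _ _ _ _).2, (mul_heckeDelta_apply _ _ _ _).2] at h1
  ext x y
  have h1 := congrFun (congrFun key x) y
  rcases x with x | x
  · rw [(heckeDelta_mul_apply _ _ _ _).1, (heckeDelta_mul_apply _ _ _ _).1] at h1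
    exact mul_left_cancel₀ hp' h1
  · rwa [(heckeDelta_mul_apply _ _ _ _).2, (heckeDelta_mul_apply _ _ _ _).2] at h1

theorem heckeDelta_act_J (p : ℕ) :
    (heckeDelta p)ᵀ * Matrix.J (Fin 2) ℤ * heckeDelta p = (p : ℤ) • Matrix.J (Fin 2) ℤ := by
  simp [heckeDelta, Matrix.J, fromBlocks_transpose, fromBlocks_multiply, fromBlocks_smul]

theorem heckeDelta_act_volForm (p : ℕ) : (heckeDelta p)ᵀ * volForm * heckeDelta p = volForm := by
  simp [heckeDelta, volForm, fromBlocks_transpose, fromBlocks_multiply]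

theorem heckeDelta_act_pluecker {p : ℕ} {η η' : Sp}
    (h : (η' : Mat4) * heckeDelta p = heckeDelta p * (η : Mat4)) :
    (heckeDelta p)ᵀ * pluecker η' * heckeDelta p = pluecker η := by
  calc _ = ((η' : Mat4) * heckeDelta p)ᵀ * volForm * ((η' : Mat4) * heckeDelta p) := by
        simp only [pluecker, transpose_mul, Matrix.mul_assoc]
    _ = (η : Mat4)ᵀ * ((heckeDelta p)ᵀ * volForm * heckeDelta p) * (η : Mat4) := by
        rw [h]; simp only [transpose_mul, Matrix.mul_assoc]
    _ = _ := by rw [heckeDelta_act_volForm, pluecker]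

/-- Conjugation by `δ` sends `(A B; C D)` to `(A, pB; C/p, D)`. It preserves the symplectic relation
because `δᵀ J δ = p J`. -/
theorem exists_heckeDelta_conj_of_dvd_blockC {p : ℕ} (hp : p ≠ 0) (η : Sp)
    (h : ∀ i j, (p : ℤ) ∣ (η : Mat4) (.inr i) (.inl j)) :
    ∃ η' : Sp, (η' : Mat4) * heckeDelta p = heckeDelta p * (η : Mat4) := by
  choose c hc using h
  let Z : Mat4 := fromBlocks (η : Mat4).toBlocks₁₁ ((p : ℤ) • (η : Mat4).toBlocks₁₂) (of c)
    (η : Mat4).toBlocks₂₂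
  have hZ : Z * heckeDelta p = heckeDelta p * (η : Mat4) := by
    ext x y
    rcases x with x | x <;> rcases y with y | y <;>
      simp [(mul_heckeDelta_apply _ _ _ _).1, (mul_heckeDelta_apply _ _ _ _).2,
        (heckeDelta_mul_apply _ _ _ _).1, (heckeDelta_mul_apply _ _ _ _).2, Z, toBlocks₁₁,
        toBlocks₁₂, toBlocks₂₂, hc]
  refine ⟨⟨Z, SymplecticGroup.mem_iff'.2 (heckeDelta_act_injective hp ?_)⟩, hZ⟩
  calc _ = (Z * heckeDelta p)ᵀ * Matrix.J (Fin 2) ℤ * (Z * heckeDelta p) := by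
        simp only [transpose_mul, Matrix.mul_assoc]
    _ = (η : Mat4)ᵀ * ((heckeDelta p)ᵀ * Matrix.J (Fin 2) ℤ * heckeDelta p) * (η : Mat4) := by
        rw [hZ]; simp only [transpose_mul, Matrix.mul_assoc]
    _ = _ := by
        rw [heckeDelta_act_J, Matrix.mul_smul, Matrix.smul_mul, SymplecticGroup.mem_iff'.1 η.2]

theorem exists_heckeDelta_conj_of_dvd_blockB {p : ℕ} (hp : p ≠ 0) (η' : Sp)
    (h : ∀ i j, (p : ℤ) ∣ (η' : Mat4) (.inl i) (.inr j)) :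
    ∃ η : Sp, (η' : Mat4) * heckeDelta p = heckeDelta p * (η : Mat4) := by
  have hp' : (p : ℤ) ≠ 0 := by exact_mod_cast hp
  choose b hb using h
  let Z : Mat4 := fromBlocks (η' : Mat4).toBlocks₁₁ (of b) ((p : ℤ) • (η' : Mat4).toBlocks₂₁)
    (η' : Mat4).toBlocks₂₂
  have hZ : (η' : Mat4) * heckeDelta p = heckeDelta p * Z := by
    ext x y
    rcases x with x | x <;> rcases y with y | y <;>
      simp [(mul_heckeDelta_apply _ _ _ _).1, (mul_heckeDelta_apply _ _ _ _).2,
        (heckeDelta_mul_apply _ _ _ _).1, (heckeDelta_mul_apply _ _ _ _).2, Z, toBlocks₁₁,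
        toBlocks₂₁, toBlocks₂₂, hb]
  refine ⟨⟨Z, SymplecticGroup.mem_iff'.2 ?_⟩, hZ⟩
  refine smul_right_injective _ hp' ?_
  calc (p : ℤ) • (Zᵀ * Matrix.J (Fin 2) ℤ * Z)
        = Zᵀ * ((p : ℤ) • Matrix.J (Fin 2) ℤ) * Z := by rw [Matrix.mul_smul, Matrix.smul_mul]
    _ = (heckeDelta p * Z)ᵀ * Matrix.J (Fin 2) ℤ * (heckeDelta p * Z) := by
        rw [← heckeDelta_act_J]; simp only [transpose_mul, Matrix.mul_assoc]
    _ = (heckeDelta p)ᵀ * ((η' : Mat4)ᵀ * Matrix.J (Fin 2) ℤ * (η' : Mat4)) * heckeDelta p := by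
        rw [← hZ]; simp only [transpose_mul, Matrix.mul_assoc]
    _ = _ := by rw [SymplecticGroup.mem_iff'.1 η'.2, heckeDelta_act_J]

/-- The minors `x, y, z` of `η` are divisible by `p` and `det D` is not, so `D · adj(D) C = det D ·
C` gives `p ∣ C`, and `η` can be conjugated by `δ`. -/
theorem mem_plueckerSet_of_heckeDelta_act {p : ℕ} (hp : p.Prime) {v : Mat4}
    (h : (heckeDelta p)ᵀ * v * heckeDelta p ∈ plueckerSet)
    (he : (cE v : ZMod p) ≠ 0) : v ∈ plueckerSet := by
  have : Fact p.Prime := ⟨hp⟩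
  obtain ⟨η, hη⟩ := h
  obtain ⟨-, hX, hY, hZ, hE⟩ := coords_heckeDelta p v
  have hW := inl_zero_inr_zero_of_mem (u := pluecker η) ⟨_, rfl⟩
  rw [← hη] at hX hY hZ hE
  rw [hY] at hW
  have hX := congrArg (Int.cast : ℤ → ZMod p) hX
  have hY := congrArg (Int.cast : ℤ → ZMod p) hY
  have hZ := congrArg (Int.cast : ℤ → ZMod p) hZ
  have hW := congrArg (Int.cast : ℤ → ZMod p) hW
  rw [← hE] at he
  simp only [cX, cY, cZ, cE, pluecker_apply] at hX hY hZ hW he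
  push_cast at hX hY hZ hW he
  simp only [CharP.cast_eq_zero, zero_mul, neg_zero] at hX hY hZ hW
  obtain ⟨η', h'⟩ := exists_heckeDelta_conj_of_dvd_blockC hp.ne_zero η (by
    intro i j
    rw [← ZMod.intCast_zmod_eq_zero_iff_dvd]
    refine (mul_eq_zero.1 ?_).resolve_left he
    fin_cases i <;> fin_cases j <;> simp only [Fin.zero_eta, Fin.mk_one]
    · linear_combination ((η : Mat4) (.inr 0) (.inr 0) : ZMod p) * hX
        - ((η : Mat4) (.inr 0) (.inr 1) : ZMod p) * hW
    · linear_combination ((η : Mat4) (.inr 0) (.inr 0) : ZMod p) * hY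
        + ((η : Mat4) (.inr 0) (.inr 1) : ZMod p) * hZ
    · linear_combination ((η : Mat4) (.inr 1) (.inr 0) : ZMod p) * hX
        - ((η : Mat4) (.inr 1) (.inr 1) : ZMod p) * hW
    · linear_combination ((η : Mat4) (.inr 1) (.inr 0) : ZMod p) * hY
        + ((η : Mat4) (.inr 1) (.inr 1) : ZMod p) * hZ)
  refine ⟨η', heckeDelta_act_injective hp.ne_zero ?_⟩
  rw [heckeDelta_act_pluecker h', hη]

theorem upperUnip_mul_apply_inl (s₁ s₂ s₃ : ℤ) (η : Sp) (y : Fin 2 ⊕ Fin 2) :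
    ((upperUnip s₁ s₂ s₃ * η : Sp) : Mat4) (.inl 0) y = (η : Mat4) (.inl 0) y
      + s₁ * (η : Mat4) (.inr 0) y + s₂ * (η : Mat4) (.inr 1) y ∧
    ((upperUnip s₁ s₂ s₃ * η : Sp) : Mat4) (.inl 1) y = (η : Mat4) (.inl 1) y
      + s₂ * (η : Mat4) (.inr 0) y + s₃ * (η : Mat4) (.inr 1) y := by
  constructor <;>
  · simp [Matrix.mul_apply, upperUnip, Fin.sum_univ_two, Matrix.one_apply]
    ring

/-- Conjugating by `δ⁻¹` requires `B ≡ 0` modulo `p`. Since `det D` is a unit, the class of `η`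
contains such a representative: shift by the symmetric `S = -B D⁻¹`, computed as `-t B adj(D)` with
`t` inverse to `det D`. -/
theorem heckeDelta_act_mem_plueckerSet {p : ℕ} (hp : p.Prime) {v : Mat4} (hv : v ∈ plueckerSet)
    (he : (cE v : ZMod p) ≠ 0) : (heckeDelta p)ᵀ * v * heckeDelta p ∈ plueckerSet := by
  have : Fact p.Prime := ⟨hp⟩
  obtain ⟨η, rfl⟩ := hv
  obtain ⟨t, ht⟩ := ZMod.intCast_surjective ((cE (pluecker η) : ZMod p)⁻¹)
  have ht' : (t : ZMod p) * cE (pluecker η) = 1 := by rw [ht, inv_mul_cancel₀ he]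
  simp only [cE, pluecker_apply] at ht'
  push_cast at ht'
  have hsym := congrArg (Int.cast : ℤ → ZMod p) (symplectic_relations η).2.1
  push_cast at hsym
  obtain ⟨η₁, hη₁⟩ : ∃ η₁ : Sp, η₁ = upperUnip
      (-t * ((η : Mat4) (.inl 0) (.inr 0) * (η : Mat4) (.inr 1) (.inr 1)
        - (η : Mat4) (.inl 0) (.inr 1) * (η : Mat4) (.inr 1) (.inr 0)))
      (-t * ((η : Mat4) (.inl 0) (.inr 1) * (η : Mat4) (.inr 0) (.inr 0)
        - (η : Mat4) (.inl 0) (.inr 0) * (η : Mat4) (.inr 0) (.inr 1)))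
      (-t * ((η : Mat4) (.inl 1) (.inr 1) * (η : Mat4) (.inr 0) (.inr 0)
        - (η : Mat4) (.inl 1) (.inr 0) * (η : Mat4) (.inr 0) (.inr 1))) * η := ⟨_, rfl⟩
  obtain ⟨η', h'⟩ := exists_heckeDelta_conj_of_dvd_blockB hp.ne_zero η₁ (by
    intro i j
    rw [← ZMod.intCast_zmod_eq_zero_iff_dvd, hη₁]
    fin_cases i <;> fin_cases j <;> simp only [Fin.zero_eta, Fin.mk_one]
    · rw [(upperUnip_mul_apply_inl _ _ _ _ _).1]
      push_cast
      linear_combination -((η : Mat4) (.inl 0) (.inr 0) : ZMod p) * ht'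
    · rw [(upperUnip_mul_apply_inl _ _ _ _ _).1]
      push_cast
      linear_combination -((η : Mat4) (.inl 0) (.inr 1) : ZMod p) * ht'
    · rw [(upperUnip_mul_apply_inl _ _ _ _ _).2]
      push_cast
      linear_combination -((η : Mat4) (.inl 1) (.inr 0) : ZMod p) * ht'
        + (t * ((η : Mat4) (.inr 0) (.inr 0) : ZMod p)) * hsym
    · rw [(upperUnip_mul_apply_inl _ _ _ _ _).2]
      push_cast
      linear_combination -((η : Mat4) (.inl 1) (.inr 1) : ZMod p) * ht'
        + (t * ((η : Mat4) (.inr 0) (.inr 1) : ZMod p)) * hsym)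
  refine ⟨η', ?_⟩
  rw [← heckeDelta_act_pluecker h', hη₁, pluecker_mul_left (upperUnip_mem_gammaInfPlus _ _ _)]

end HeckeConjugation

end SiegelTwo

end

noncomputable section

namespace SiegelTwo

open Matrix

/-! ### The Hecke operator on local weights. -/

section LocalHecke

/-- The factor by which `diag(q, q, 1, 1)` multiplies the weight at `r ≠ q`. -/
def deltaFactor {N : ℕ} (χ : DirichletCharacter ℂ N) (N₀ N₁ q r : ℕ) : ℂ :=
  if r ∣ N₀ then 1 else if r ∣ N₁ then starRingEnd ℂ (charPart χ r (q : ZMod r))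
  else charPart χ r ((q : ZMod r) ^ 2)

theorem localWeight_heckeDelta {N : ℕ} (χ : DirichletCharacter ℂ N) (N₀ N₁ : ℕ) {q r : ℕ}
    (hq : q.Prime) (hr : r.Prime) (hqr : r ≠ q) (v : Mat4) :
    localWeight χ N₀ N₁ r ((heckeDelta q)ᵀ * v * heckeDelta q) =
      deltaFactor χ N₀ N₁ q r * localWeight χ N₀ N₁ r v := by
  have : Fact r.Prime := ⟨hr⟩
  obtain ⟨hB, hX, hY, hZ, hE⟩ := coords_heckeDelta q v
  have h0 : (q : ZMod r) ≠ 0 := by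
    rw [Ne, ZMod.natCast_eq_zero_iff]
    exact fun h => hqr ((Nat.prime_dvd_prime_iff_eq hr hq).1 h)
  unfold localWeight deltaFactor
  rw [hB, hX, hY, hZ, hE]
  push_cast
  simp only [mul_eq_zero, h0, false_or, pow_eq_zero_iff two_ne_zero]
  split_ifs <;> simp [map_mul]

/-- The shifts of `x, y, z` are multiples of `b`, and `e` enters only where `b = x = y = z = 0`;
there it is unchanged modulo `r`. -/
theorem localWeight_upperUnip {N : ℕ} (χ : DirichletCharacter ℂ N) (N₀ N₁ r : ℕ) {v : Mat4}
    (hv : v ∈ plueckerSet) (s₁ s₂ s₃ : ℤ) :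
    localWeight χ N₀ N₁ r ((upperUnip s₁ s₂ s₃ : Mat4)ᵀ * v * (upperUnip s₁ s₂ s₃ : Mat4)) =
      localWeight χ N₀ N₁ r v := by
  obtain ⟨hB, hX, hY, hZ, hE⟩ := coords_upperUnip hv s₁ s₂ s₃
  unfold localWeight
  rw [hB, hX, hY, hZ, hE]
  push_cast
  by_cases hb : (cB v : ZMod r) = 0
  · simp only [hb, zero_mul, add_zero, sub_zero]
    by_cases hc : (cX v : ZMod r) = 0 ∧ (cY v : ZMod r) = 0 ∧ (cZ v : ZMod r) = 0
    · obtain ⟨h1, h2, h3⟩ := hc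
      simp [h1, h2, h3]
    · simp only [hc, and_false, if_false]
  · simp only [hb, false_and, if_false]

open Classical in
/-- The part of the weight away from `q`. -/
def weightAway {N : ℕ} (χ : DirichletCharacter ℂ N) (N₀ N₁ q : ℕ) (v : Mat4) : ℂ :=
  if v ∈ plueckerSet then ∏ r ∈ N.primeFactors.erase q, localWeight χ N₀ N₁ r v else 0

theorem cuspWeight_eq_mul {N : ℕ} (χ : DirichletCharacter ℂ N) (N₀ N₁ : ℕ) {q : ℕ}
    (hq : q ∈ N.primeFactors) (v : Mat4) :
    cuspWeight χ N₀ N₁ v = weightAway χ N₀ N₁ q v * localWeight χ N₀ N₁ q v := by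
  unfold cuspWeight weightAway
  split_ifs
  · rw [mul_comm]
    exact (Finset.mul_prod_erase _ (fun r => localWeight χ N₀ N₁ r v) hq).symm
  · rw [zero_mul]

theorem weightAway_congr {N N₀ N₁ M₀ M₁ q : ℕ} (χ : DirichletCharacter ℂ N)
    (h : ∀ r ∈ N.primeFactors.erase q, (r ∣ M₀ ↔ r ∣ N₀) ∧ (r ∣ M₁ ↔ r ∣ N₁)) (v : Mat4) :
    weightAway χ M₀ M₁ q v = weightAway χ N₀ N₁ q v := by
  unfold weightAway
  split_ifs
  · refine Finset.prod_congr rfl fun r hr => ?_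
    simp only [localWeight, (h r hr).1, (h r hr).2]
  · rfl

/-- After applying `δ`, the minors `b, x, y, z` are divisible by `q`, so the support condition at `q
∣ N₀` is automatic and only `conj χ_q(e)` remains. Where `q ∣ e` both sides vanish, so membership in
`plueckerSet` need be compared only for `e` prime to `q`. -/
theorem cuspWeight_heckeDelta_upperUnip {N N₀ N₁ q : ℕ} (χ : DirichletCharacter ℂ N)
    (hqN : q ∈ N.primeFactors) (hq : q ∣ N₀) (v : Mat4) (s₁ s₂ s₃ : ℤ) :
    cuspWeight χ N₀ N₁ ((heckeDelta q)ᵀ *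
        ((upperUnip s₁ s₂ s₃ : Mat4)ᵀ * v * (upperUnip s₁ s₂ s₃ : Mat4)) * heckeDelta q) =
      (∏ r ∈ N.primeFactors.erase q, deltaFactor χ N₀ N₁ q r) * weightAway χ N₀ N₁ q v *
        starRingEnd ℂ (charPart χ q
          (cE ((upperUnip s₁ s₂ s₃ : Mat4)ᵀ * v * (upperUnip s₁ s₂ s₃ : Mat4)) : ZMod q)) := by
  have hqp := Nat.prime_of_mem_primeFactors hqN
  have : Fact q.Prime := ⟨hqp⟩
  set u := (upperUnip s₁ s₂ s₃ : Mat4)ᵀ * v * (upperUnip s₁ s₂ s₃ : Mat4) with hu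
  have hmem : u ∈ plueckerSet ↔ v ∈ plueckerSet := act_mem_plueckerSet _ _
  have hlocal : localWeight χ N₀ N₁ q ((heckeDelta q)ᵀ * u * heckeDelta q) =
      starRingEnd ℂ (charPart χ q (cE u : ZMod q)) := by
    obtain ⟨hB, hX, hY, hZ, hE⟩ := coords_heckeDelta q u
    unfold localWeight
    rw [if_pos hq, hB, hX, hY, hZ, hE]
    simp
  rw [cuspWeight_eq_mul χ N₀ N₁ hqN, hlocal]
  by_cases he : charPart χ q (cE u : ZMod q) = 0
  · rw [he, map_zero, mul_zero, mul_zero]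
  have he' := ne_zero_of_charPart_ne_zero he
  congr 1
  unfold weightAway
  by_cases hv : v ∈ plueckerSet
  · rw [if_pos hv, if_pos (heckeDelta_act_mem_plueckerSet hqp (hmem.2 hv) he'),
      ← Finset.prod_mul_distrib]
    refine Finset.prod_congr rfl fun r hr => ?_
    rw [Finset.mem_erase] at hr
    rw [localWeight_heckeDelta χ N₀ N₁ hqp (Nat.prime_of_mem_primeFactors hr.2) hr.1,
      localWeight_upperUnip χ N₀ N₁ r hv]
  · rw [if_neg hv, if_neg fun h => hv (hmem.1 (mem_plueckerSet_of_heckeDelta_act hqp h he')), mul_zero]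

/-- The conjugation at primes of `N₁` disappears because `χ_r² = 1`. -/
theorem prod_deltaFactor {N N₀ N₁ N₂ q : ℕ} {χ : DirichletCharacter ℂ N} (h : IsCusp χ N₀ N₁ N₂)
    (hqp : q.Prime) (hq : q ∣ N₀) :
    ∏ r ∈ N.primeFactors.erase q, deltaFactor χ N₀ N₁ q r =
      charPart χ N₁ (q : ZMod N₁) * charPart χ N₂ ((q : ZMod N₂) ^ 2) := by
  have hsq := h.squarefree
  have hN0 := hsq.ne_zero
  have h1N : N₁ ∣ N := ⟨N₀ * N₂, by rw [← h.mul_eq]; ring⟩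
  have h2N : N₂ ∣ N := ⟨N₀ * N₁, by rw [← h.mul_eq]; ring⟩
  have hdisj := fun (r : ℕ) (hr : r.Prime) =>
    not_dvd_of_squarefree (N₀ := N₀) (N₁ := N₁) (N₂ := N₂) (r := r) (by rw [h.mul_eq]; exact hsq) hr
  have hfil : ∀ M, M ∣ N → ¬ q ∣ M →
      M.primeFactors = (N.primeFactors.erase q).filter (· ∣ M) := by
    intro M hM hqM
    ext r
    simp only [Nat.mem_primeFactors, Finset.mem_filter, Finset.mem_erase]
    constructor
    · rintro ⟨h1, h2, -⟩
      exact ⟨⟨fun h3 => hqM (h3 ▸ h2), h1, h2.trans hM, hN0⟩, h2⟩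
    · rintro ⟨⟨-, h1, -, -⟩, h2⟩
      exact ⟨h1, h2, fun h3 => hN0 (zero_dvd_iff.1 (h3 ▸ hM))⟩
  have e1 := charPart_eq_prod χ hsq (q : ℤ) N₁ h1N
  have e2 := charPart_eq_prod χ hsq ((q : ℤ) ^ 2) N₂ h2N
  push_cast at e1 e2
  rw [e1, e2, hfil N₁ h1N ((hdisj q hqp).1 hq).1, hfil N₂ h2N ((hdisj q hqp).1 hq).2,
    Finset.prod_filter, Finset.prod_filter, ← Finset.prod_mul_distrib]
  refine Finset.prod_congr rfl fun r hr => ?_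
  have hrN := Finset.mem_of_mem_erase hr
  have hrp := Nat.prime_of_mem_primeFactors hrN
  obtain ⟨k1, k2⟩ := hdisj r hrp
  unfold deltaFactor
  by_cases h0 : r ∣ N₀
  · simp [h0, (k1 h0).1, (k1 h0).2]
  by_cases h1 : r ∣ N₁
  · have hinv : (charPart χ r)⁻¹ = charPart χ r :=
      inv_eq_of_mul_eq_one_left (by rw [← pow_two]; exact h.sq_eq_one r hrp h1)
    simp only [h0, h1, k2 h1, if_true, if_false, mul_one]
    rw [starRingEnd_apply, MulChar.star_apply', hinv]
  · have h2 : r ∣ N₂ := by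
      have := Nat.dvd_of_mem_primeFactors hrN
      rw [← h.mul_eq, hrp.dvd_mul, hrp.dvd_mul] at this
      tauto
    simp [h0, h1, h2]

/-- The three possible values at `q` of the weights of the cusps `ρ`, `ρ'`, `ρ''`, and the
corresponding character sum. -/
theorem sum_star_charPart {N : ℕ} (χ : DirichletCharacter ℂ N) {q : ℕ} [Fact q.Prime]
    {N₀ N₁ M₀ M₁ : ℕ} (h0 : q ∣ N₀) (hM0 : ¬ q ∣ M₀) (hN1 : ¬ q ∣ N₁) (hM1 : q ∣ M₁) {v : Mat4}
    (hv : v ∈ plueckerSet) (G : ℂ)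
    (hG : G = ∑ s₁ : ZMod q, ∑ s₂ : ZMod q, ∑ s₃ : ZMod q, starRingEnd ℂ (charPart χ q
      (cB v * s₁ * s₃ - cB v * s₂ ^ 2 - cX v * s₁ - 2 * cY v * s₂ - cZ v * s₃ + cE v))) :
    (charPart χ q = 1 → G = (q : ℂ) ^ 3 * (localWeight χ N₀ N₁ q v
        + (q : ℂ)⁻¹ * (q - 1) * localWeight χ M₀ M₁ q v
        + (q : ℂ)⁻¹ * (q - 1) * localWeight χ M₀ N₁ q v)) ∧
    (charPart χ q ^ 2 = 1 → charPart χ q ≠ 1 → G = (q : ℂ) ^ 3 * (localWeight χ N₀ N₁ q v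
        + (legendreSym q (-1) : ℂ) * ((q : ℂ) ^ 2)⁻¹ * (q - 1) * localWeight χ M₀ N₁ q v)) ∧
    (charPart χ q ^ 2 ≠ 1 → G = (q : ℂ) ^ 3 * localWeight χ N₀ N₁ q v) := by
  have hq0 : (q : ℂ) ≠ 0 := by exact_mod_cast (Fact.out : q.Prime).ne_zero
  have hquad := congrArg (Int.cast : ℤ → ZMod q) (quadric_of_mem hv)
  push_cast at hquad
  set ψ := (charPart χ q)⁻¹ with hψ
  have hstar : ∀ a, starRingEnd ℂ (charPart χ q a) = ψ a := fun a => by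
    rw [starRingEnd_apply, MulChar.star_apply']
  have hψ1 : ψ = 1 ↔ charPart χ q = 1 := inv_eq_one
  have hψ2 : ψ ^ 2 = 1 ↔ charPart χ q ^ 2 = 1 := by rw [hψ, inv_pow, inv_eq_one]
  simp only [hstar] at hG
  unfold localWeight
  simp only [h0, hM0, hN1, hM1, if_true, if_false, hstar]
  have hsum1 : ψ ≠ 1 → ∑ s, ψ s = 0 := fun h => MulChar.sum_eq_zero_of_ne_one h
  have hsumOne : ∑ s, (1 : MulChar (ZMod q) ℂ) s = (q : ℂ) - 1 := by
    rw [MulChar.sum_one_eq_card_units, ZMod.card_units_eq_totient,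
      Nat.totient_prime (Fact.out : q.Prime), Nat.cast_sub (Fact.out : q.Prime).one_le, Nat.cast_one]
  by_cases hb : (cB v : ZMod q) = 0
  · by_cases hxz : (cX v : ZMod q) = 0 ∧ (cZ v : ZMod q) = 0
    · obtain ⟨hx, hz⟩ := hxz
      have hy : (cY v : ZMod q) = 0 := by
        rw [hb, hx] at hquad
        have : (cY v : ZMod q) ^ 2 = 0 := by linear_combination hquad
        exact (pow_eq_zero_iff two_ne_zero).1 this
      -- Type of `ρ`: the argument is constant in `S`.
      have hG' : G = (q : ℂ) ^ 3 * ψ (cE v) := by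
        rw [hG]
        simp [hb, hx, hy, hz]
        ring
      simp [hb, hx, hy, hz, hG', MulChar.map_zero (charPart χ q)]
    -- Type of `ρ'`: the argument is a nonconstant affine function of `S`.
    · have hG' : G = (q : ℂ) ^ 2 * ∑ s, ψ s := by
        have := sum_mulChar_linear ψ (x := -(cX v : ZMod q)) (y := -(cY v : ZMod q))
          (z := -(cZ v : ZMod q)) (e := cE v) (by
            rw [neg_ne_zero, neg_ne_zero]
            by_contra hc
            push Not at hc
            exact hxz hc)
        rw [ZMod.card] at this
        rw [hG, ← this]
        simp only [hb]
        refine Finset.sum_congr rfl fun s₁ _ => Finset.sum_congr rfl fun s₂ _ =>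
          Finset.sum_congr rfl fun s₃ _ => ?_
        congr 1
        ring
      have hW0 : ¬ ((cB v : ZMod q) = 0 ∧ (cX v : ZMod q) = 0 ∧ (cY v : ZMod q) = 0 ∧
        (cZ v : ZMod q) = 0) := fun h => hxz ⟨h.2.1, h.2.2.2⟩
      rw [if_neg hW0, hb, MulChar.map_zero, if_pos ⟨rfl, hxz⟩]
      refine ⟨fun h => ?_, fun _ h => ?_, fun h => ?_⟩
      · have hone := hψ1.2 h
        rw [hG', hone, hsumOne, MulChar.one_apply]
        · field_simp
          ring
        · rw [isUnit_iff_ne_zero]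
          split_ifs with hx
          · exact fun hz => hxz ⟨hx, hz⟩
          · exact hx
      · rw [hG', hsum1 (fun hc => h (hψ1.1 hc))]
        simp
      · rw [hG', hsum1 (fun hc => h (by rw [hψ1.1 hc, one_pow]))]
        simp
  -- Type of `ρ''`. For trivial `ψ` the sum over `S` is `q(q-1)² + q(q-1) = q²(q-1)`; for quadratic
  -- `ψ` only `q ψ(-1)(q-1)` survives; otherwise both inner sums vanish.
  · have hG' : G = ψ (cB v) * ((q : ℂ) * ((q - 1) * ∑ s, ψ s) + q * (ψ (-1) * ∑ s, (ψ ^ 2) s)) := by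
      have := sum_mulChar_quadric ψ (x := -(cX v : ZMod q)) (y := -(cY v : ZMod q))
          (z := -(cZ v : ZMod q)) (e := cE v) hb (by linear_combination hquad)
      rw [sum_mulChar_det, ZMod.card] at this
      rw [hG, ← this]
      refine Finset.sum_congr rfl fun s₁ _ => Finset.sum_congr rfl fun s₂ _ =>
          Finset.sum_congr rfl fun s₃ _ => ?_
      congr 1
      ring
    simp only [hb, false_and, if_false, mul_zero, add_zero, zero_add]
    refine ⟨fun h => ?_, fun h2 h => ?_, fun h => ?_⟩
    · have hone := hψ1.2 h
      rw [hG', hone, one_pow, hsumOne, h, MulChar.one_apply (isUnit_iff_ne_zero.2 hb),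
        MulChar.one_apply (by simp)]
      field_simp
      ring
    · have hinv : charPart χ q = ψ := by
        rw [hψ]
        exact (inv_eq_of_mul_eq_one_left (by rw [← pow_two]; exact h2)).symm
      rw [hG', hsum1 (fun hc => h (hψ1.1 hc)), hψ2.2 h2, hsumOne, hinv,
        mulChar_neg_one_eq_legendreSym (fun hc => h (hψ1.1 hc)) (hψ2.2 h2)]
      field_simp
      ring
    · rw [hG', hsum1 (fun hc => h (by rw [hψ1.1 hc, one_pow])),
        MulChar.sum_eq_zero_of_ne_one (fun hc => h (hψ2.1 hc))]
      simp

end LocalHecke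

end SiegelTwo

end

noncomputable section

namespace SiegelTwo

open Matrix

/-! ### Eisenstein series as sums over matrices of minors. -/

section Series

theorem plForm_apply (u : Mat4) (τ : Matrix (Fin 2) (Fin 2) ℂ) :
    plForm u τ = ((stack τ)ᵀ * u.map (Int.cast : ℤ → ℂ) * stack τ) 0 1 := rfl

/-- A real matrix, viewed as a complex matrix. -/
def toComplex (g : Matrix (Fin 2 ⊕ Fin 2) (Fin 2 ⊕ Fin 2) ℝ) :
    Matrix (Fin 2 ⊕ Fin 2) (Fin 2 ⊕ Fin 2) ℂ := g.map Complex.ofReal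

theorem denom_apply (g : Matrix (Fin 2 ⊕ Fin 2) (Fin 2 ⊕ Fin 2) ℝ)
    (τ : Matrix (Fin 2) (Fin 2) ℂ) (i j : Fin 2) :
    denom g τ i j = (toComplex g * stack τ) (.inr i) j := by
  simp [denom, toComplex, stack, Matrix.mul_apply, toBlocks₂₁, toBlocks₂₂, Matrix.one_apply]

/-- The cocycle relation `g (τ; 1) = (gτ; 1)(Cτ + D)`. -/
theorem toComplex_mul_stack {g : Matrix (Fin 2 ⊕ Fin 2) (Fin 2 ⊕ Fin 2) ℝ}
    {τ : Matrix (Fin 2) (Fin 2) ℂ} (h : (denom g τ).det ≠ 0) :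
    toComplex g * stack τ = stack (act g τ) * denom g τ := by
  ext x j
  rcases x with i | i
  · have h1 : act g τ * denom g τ =
        g.toBlocks₁₁.map Complex.ofReal * τ + g.toBlocks₁₂.map Complex.ofReal := by
      rw [act, Matrix.mul_assoc, nonsing_inv_mul _ (isUnit_iff_ne_zero.2 h), Matrix.mul_one]
    have h2 : (stack (act g τ) * denom g τ) (.inl i) j = (act g τ * denom g τ) i j := by
      simp [stack, Matrix.mul_apply]
    rw [h2, h1]
    simp [toComplex, stack, Matrix.mul_apply, toBlocks₁₁, toBlocks₁₂, Matrix.one_apply]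
  · rw [← denom_apply]
    simp [stack, Matrix.mul_apply, Matrix.one_apply]

/-- By the cocycle relation the `2 × 2` skew matrix defining `plForm` undergoes congruence by `Cτ +
D`, which multiplies it by the determinant. -/
theorem plForm_act {g : Matrix (Fin 2 ⊕ Fin 2) (Fin 2 ⊕ Fin 2) ℝ}
    {τ : Matrix (Fin 2) (Fin 2) ℂ} (h : (denom g τ).det ≠ 0) {u v : Mat4}
    (hu : ∀ x y, u x y = -u y x)
    (hv : v.map (Int.cast : ℤ → ℂ) = (toComplex g)ᵀ * u.map (Int.cast : ℤ → ℂ) * toComplex g) :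
    plForm v τ = (denom g τ).det * plForm u (act g τ) := by
  set K := (stack (act g τ))ᵀ * u.map (Int.cast : ℤ → ℂ) * stack (act g τ) with hK
  have hskew : ∀ i j, K i j = -K j i := by
    intro i j
    have h1 : (u.map (Int.cast : ℤ → ℂ))ᵀ = -u.map (Int.cast : ℤ → ℂ) := by
      ext x y
      simp [hu y x]
    have h2 : Kᵀ = -K := by
      rw [hK, transpose_mul, transpose_mul, transpose_transpose, h1]
      simp [Matrix.mul_assoc]
    have := congrFun (congrFun h2 j) i
    simpa using this
  have h00 : K 0 0 = 0 := by have := hskew 0 0; exact self_eq_neg.1 this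
  have h11 : K 1 1 = 0 := by have := hskew 1 1; exact self_eq_neg.1 this
  have h10 := hskew 1 0
  rw [plForm_apply, plForm_apply, ← hK, hv]
  have h3 : (stack τ)ᵀ * ((toComplex g)ᵀ * u.map (Int.cast : ℤ → ℂ) * toComplex g) * stack τ =
      (denom g τ)ᵀ * K * denom g τ := by
    calc _ = (toComplex g * stack τ)ᵀ * u.map (Int.cast : ℤ → ℂ) * (toComplex g * stack τ) := by
          simp only [transpose_mul, Matrix.mul_assoc]
      _ = _ := by
          rw [toComplex_mul_stack h, hK]
          simp only [transpose_mul, Matrix.mul_assoc]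
  rw [h3]
  simp [Matrix.mul_apply, Fin.sum_univ_two, h00, h11, h10, det_fin_two]
  ring

theorem toComplex_toReal (γ : Sp) : toComplex (toReal γ) = (γ : Mat4).map (Int.cast : ℤ → ℂ) := by
  ext x y
  simp [toComplex, toReal]

theorem map_intCast_mul {l m n : Type*} [Fintype m] (X : Matrix l m ℤ) (Y : Matrix m n ℤ) :
    (X * Y).map (Int.cast : ℤ → ℂ) = X.map (Int.cast : ℤ → ℂ) * Y.map (Int.cast : ℤ → ℂ) :=
  Matrix.map_mul (f := Int.castRingHom ℂ)

theorem plForm_pluecker (γ : Sp) (τ : Matrix (Fin 2) (Fin 2) ℂ) :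
    plForm (pluecker γ) τ = (denom (toReal γ) τ).det := by
  rw [det_fin_two, denom_apply, denom_apply, denom_apply, denom_apply, plForm_apply, pluecker,
    map_intCast_mul, map_intCast_mul, toComplex_toReal]
  have : (stack τ)ᵀ * ((γ : Mat4)ᵀ.map (Int.cast : ℤ → ℂ) * volForm.map (Int.cast : ℤ → ℂ) *
      (γ : Mat4).map (Int.cast : ℤ → ℂ)) * stack τ =
      ((γ : Mat4).map (Int.cast : ℤ → ℂ) * stack τ)ᵀ * volForm.map (Int.cast : ℤ → ℂ) *
        ((γ : Mat4).map (Int.cast : ℤ → ℂ) * stack τ) := by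
    simp only [transpose_mul, Matrix.mul_assoc, transpose_map]
  rw [this]
  generalize (γ : Mat4).map (Int.cast : ℤ → ℂ) * stack τ = Y
  simp [Matrix.mul_apply, volForm, Fin.sum_univ_two]
  ring

theorem det_toReal (γ : Sp) : (toReal γ).det = 1 := by
  have h := SymplecticGroup.det_eq_one γ.2
  have h1 : (toReal γ).det = (((γ : Mat4).det : ℤ) : ℝ) := by
    rw [toReal, Int.cast_det]
  rw [h1, h, Int.cast_one]

theorem slash_one_toReal (k : ℕ) (γ : Sp) (τ : Matrix (Fin 2) (Fin 2) ℂ) :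
    slash k (fun _ => 1) (toReal γ) τ = plForm (pluecker γ) τ ^ (-(k : ℤ)) := by
  rw [slash, det_toReal, Real.one_rpow, plForm_pluecker]
  simp

theorem mem_cuspStabilizer_iff (N : ℕ) (γ₀ : Sp) (x : Gamma0 N) :
    x ∈ cuspStabilizer N γ₀ ↔ γ₀ * x * γ₀⁻¹ ∈ GammaInfPlus := Iff.rfl

/-- The Eisenstein series as a sum over matrices of minors. -/
theorem eisensteinCusp_eq_tsum {N N₀ N₁ N₂ : ℕ} {χ : DirichletCharacter ℂ N}
    (h : IsCusp χ N₀ N₁ N₂) (k : ℕ) (τ : Matrix (Fin 2) (Fin 2) ℂ) :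
    eisensteinCusp N χ k N₀ N₁ N₂ τ =
      (1 / 2) * ∑' u : Mat4, cuspWeight χ N₀ N₁ u * plForm u τ ^ (-(k : ℤ)) := by
  rw [eisensteinCusp, eisenstein]
  congr 1
  let φ : Quotient (QuotientGroup.rightRel (cuspStabilizer N (cusp N₀ N₁ N₂))) → Mat4 :=
    fun c => pluecker (cusp N₀ N₁ N₂ * (c.out : Gamma0 N))
  have hrel : ∀ x y : Gamma0 N, (QuotientGroup.rightRel (cuspStabilizer N (cusp N₀ N₁ N₂))) x y ↔
      pluecker (cusp N₀ N₁ N₂ * y) = pluecker (cusp N₀ N₁ N₂ * x) := by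
    intro x y
    rw [QuotientGroup.rightRel_apply, mem_cuspStabilizer_iff, pluecker_eq_iff]
    simp only [Subgroup.coe_mul, Subgroup.coe_inv, _root_.mul_inv_rev, mul_assoc]
  have hφ : Function.Injective φ := by
    intro c c' hc
    rw [← Quotient.out_eq c, ← Quotient.out_eq c']
    exact Quotient.sound ((hrel _ _).2 hc.symm)
  have hsupp : Function.support (fun u => cuspWeight χ N₀ N₁ u * plForm u τ ^ (-(k : ℤ))) ⊆
      Set.range φ := by
    intro u hu
    obtain ⟨γ, hγ, rfl⟩ := exists_of_cuspWeight_ne_zero h (left_ne_zero_of_mul hu)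
    refine ⟨Quotient.mk _ ⟨γ, hγ⟩, ?_⟩
    exact ((hrel _ _).1 (Quotient.mk_out (s := QuotientGroup.rightRel _) (⟨γ, hγ⟩ : Gamma0 N))).symm
  rw [← hφ.tsum_eq hsupp]
  refine tsum_congr fun c => ?_
  simp only [φ]
  rw [slash_one_toReal, cuspWeight_pluecker h (c.out : Gamma0 N).2]

end Series

/-! ### The Hecke operator: substitution in the series and coset representatives. -/

section Hecke

theorem inv_act_act (γ : Sp) (v : Mat4) :
    (γ : Mat4)ᵀ * (((γ⁻¹ : Sp) : Mat4)ᵀ * v * ((γ⁻¹ : Sp) : Mat4)) * (γ : Mat4) = v := by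
  calc _ = (((γ⁻¹ : Sp) : Mat4) * (γ : Mat4))ᵀ * v * (((γ⁻¹ : Sp) : Mat4) * (γ : Mat4)) := by
        simp only [transpose_mul, Matrix.mul_assoc]
    _ = _ := by rw [coe_inv_mul_coe]; simp

theorem act_inv_act (γ : Sp) (v : Mat4) :
    ((γ⁻¹ : Sp) : Mat4)ᵀ * ((γ : Mat4)ᵀ * v * (γ : Mat4)) * ((γ⁻¹ : Sp) : Mat4) = v := by
  simpa using inv_act_act γ⁻¹ v

theorem det_heckeDelta_inv (q : ℕ) :
    (((heckeDelta q).map (Int.cast : ℤ → ℝ))⁻¹).det = ((q : ℝ) ^ 2)⁻¹ := by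
  have h1 : ((heckeDelta q).map (Int.cast : ℤ → ℝ)).det = (q : ℝ) ^ 2 := by
    have : ((heckeDelta q).map (Int.cast : ℤ → ℝ)).det = (((heckeDelta q).det : ℤ) : ℝ) := by
      rw [Int.cast_det]
    rw [this, heckeDelta, det_fromBlocks_zero₁₂, det_smul, det_one]
    simp
  rw [det_nonsing_inv, h1, Ring.inverse_eq_inv']

/-- Substitute `u = δᵀ γ⁻ᵀ v γ⁻¹ δ` in the series. Every `u` of nonzero weight is reached because `q
∣ N₀` makes the lower left block of `γ_ρ η` divisible by `q`. The factor `q^{-k}` is `(det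
δ⁻¹)^{k/2}`. -/
theorem slash_heckeDelta_inv_mul {N N₀ N₁ N₂ q k : ℕ} {χ : DirichletCharacter ℂ N}
    (h : IsCusp χ N₀ N₁ N₂) (hqp : q.Prime) (hq : q ∣ N₀) (γ : Sp)
    {τ : Matrix (Fin 2) (Fin 2) ℂ} (hτ : τ ∈ upperHalf) :
    slash k (eisensteinCusp N χ k N₀ N₁ N₂)
        (((heckeDelta q).map (Int.cast : ℤ → ℝ))⁻¹ * toReal γ) τ =
      ((q : ℂ) ^ k)⁻¹ * ((1 / 2) * ∑' v : Mat4, cuspWeight χ N₀ N₁ ((heckeDelta q)ᵀ *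
        (((γ⁻¹ : Sp) : Mat4)ᵀ * v * ((γ⁻¹ : Sp) : Mat4)) * heckeDelta q) *
          plForm v τ ^ (-(k : ℤ))) := by
  have hq0 : (0 : ℝ) < q := by exact_mod_cast hqp.pos
  set δ := (heckeDelta q).map (Int.cast : ℤ → ℝ) with hδ
  set g := δ⁻¹ * toReal γ with hg
  have hunit : IsUnit δ.det := by
    rw [← isUnit_nonsing_inv_det_iff, det_heckeDelta_inv, isUnit_iff_ne_zero]
    positivity
  have hdet : ((g.det ^ ((k : ℝ) / 2) : ℝ) : ℂ) = ((q : ℂ) ^ k)⁻¹ := by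
    rw [hg, det_mul, det_heckeDelta_inv, det_toReal, mul_one, Real.inv_rpow (by positivity),
      ← Real.rpow_natCast, ← Real.rpow_mul hq0.le]
    rw [show ((2 : ℕ) : ℝ) * ((k : ℝ) / 2) = k by push_cast; ring, Real.rpow_natCast]
    push_cast
    rfl
  have hδg : δ * g = toReal γ := by
    rw [hg, ← Matrix.mul_assoc, mul_nonsing_inv _ hunit, Matrix.one_mul]
  have hden : denom g τ = denom (toReal γ) τ := by
    ext i j
    rw [denom_apply, denom_apply, ← hδg]
    have : ∀ x, toComplex (δ * g) (.inr i) x = toComplex g (.inr i) x := by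
      intro x
      simp [toComplex, hδ, heckeDelta, Matrix.mul_apply, Matrix.one_apply]
    rw [Matrix.mul_apply, Matrix.mul_apply]
    simp only [this]
  have hden0 : (denom g τ).det ≠ 0 := by
    rw [hden, ← plForm_pluecker]
    exact plForm_ne_zero ⟨γ, rfl⟩ hτ
  rw [slash, hdet, eisensteinCusp_eq_tsum h, mul_assoc, mul_left_comm _ (1 / 2 : ℂ), ← tsum_mul_left]
  congr 2
  let ψ : Mat4 → Mat4 := fun v => (heckeDelta q)ᵀ *
    (((γ⁻¹ : Sp) : Mat4)ᵀ * v * ((γ⁻¹ : Sp) : Mat4)) * heckeDelta q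
  have hψ : Function.Injective ψ := by
    intro v w hvw
    have h1 := heckeDelta_act_injective hqp.ne_zero hvw
    rw [← inv_act_act γ v, h1, inv_act_act]
  have hsupp : Function.support (fun u => (denom g τ).det ^ (-(k : ℤ)) *
      (cuspWeight χ N₀ N₁ u * plForm u (act g τ) ^ (-(k : ℤ)))) ⊆ Set.range ψ := by
    intro u hu
    obtain ⟨η, hη, rfl⟩ := exists_of_cuspWeight_ne_zero h
      (left_ne_zero_of_mul (right_ne_zero_of_mul hu))
    obtain ⟨η', h'⟩ := exists_heckeDelta_conj_of_dvd_blockC hqp.ne_zero (cusp N₀ N₁ N₂ * η) (by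
      intro i j
      rw [cusp_mul_apply]
      have hqN : q ∣ N := by rw [← h.mul_eq, mul_assoc]; exact hq.mul_right _
      have hm := cuspEntry_of_dvd_left (by rw [h.mul_eq]; exact h.squarefree.ne_zero) hq
      refine dvd_add (dvd_mul_of_dvd_left ?_ _) (dvd_trans (Int.natCast_dvd_natCast.2 hqN) (hη i j))
      rw [← ZMod.intCast_zmod_eq_zero_iff_dvd]
      fin_cases i
      · exact hm.1
      · exact hm.2)
    refine ⟨(γ : Mat4)ᵀ * pluecker η' * (γ : Mat4), ?_⟩
    simp only [ψ]
    rw [act_inv_act, heckeDelta_act_pluecker h']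
  rw [← hψ.tsum_eq hsupp]
  refine tsum_congr fun v => ?_
  change _ = cuspWeight χ N₀ N₁ (ψ v) * _
  by_cases hw : cuspWeight χ N₀ N₁ (ψ v) = 0
  · rw [hw]; simp
  have hform := plForm_act hden0 (skew_of_mem (mem_of_cuspWeight_ne_zero hw)) (v := v) (by
    have e1 : (heckeDelta q).map (Int.cast : ℤ → ℂ) * toComplex g = (γ : Mat4).map Int.cast := by
      rw [← toComplex_toReal, ← hδg]
      ext x y
      simp [toComplex, hδ, Matrix.mul_apply]
    obtain ⟨W, hW⟩ : ∃ W, W = ((γ⁻¹ : Sp) : Mat4)ᵀ * v * ((γ⁻¹ : Sp) : Mat4) := ⟨_, rfl⟩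
    have hv : v = (γ : Mat4)ᵀ * W * (γ : Mat4) := by rw [hW, inv_act_act]
    simp only [ψ, ← hW]
    rw [hv]
    have e2 : (γ : Mat4)ᵀ.map (Int.cast : ℤ → ℂ) =
        (toComplex g)ᵀ * (heckeDelta q)ᵀ.map Int.cast := by
      rw [show (γ : Mat4)ᵀ.map (Int.cast : ℤ → ℂ) = ((γ : Mat4).map Int.cast)ᵀ from rfl, ← e1,
        transpose_mul]
      rfl
    simp only [map_intCast_mul]
    rw [e2, ← e1]
    simp only [Matrix.mul_assoc])
  rw [hform, mul_zpow]
  ring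

theorem upperUnip_mul (s₁ s₂ s₃ t₁ t₂ t₃ : ℤ) :
    upperUnip s₁ s₂ s₃ * upperUnip t₁ t₂ t₃ = upperUnip (s₁ + t₁) (s₂ + t₂) (s₃ + t₃) := by
  apply Subtype.ext
  rw [Submonoid.coe_mul]
  simp [upperUnip, fromBlocks_multiply, add_comm]

theorem mul_upperUnip_apply (γ : Sp) (s₁ s₂ s₃ : ℤ) (x : Fin 2 ⊕ Fin 2) :
    ((γ * upperUnip s₁ s₂ s₃ : Sp) : Mat4) x (.inr 0) =
      (γ : Mat4) x (.inl 0) * s₁ + (γ : Mat4) x (.inl 1) * s₂ + (γ : Mat4) x (.inr 0) ∧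
    ((γ * upperUnip s₁ s₂ s₃ : Sp) : Mat4) x (.inr 1) =
      (γ : Mat4) x (.inl 0) * s₂ + (γ : Mat4) x (.inl 1) * s₃ + (γ : Mat4) x (.inr 1) := by
  constructor <;> simp [Matrix.mul_apply, upperUnip, Fin.sum_univ_two, Matrix.one_apply]

theorem upperUnip_inv (s₁ s₂ s₃ : ℤ) : (upperUnip s₁ s₂ s₃)⁻¹ = upperUnip (-s₁) (-s₂) (-s₃) := by
  rw [inv_eq_iff_mul_eq_one, upperUnip_mul]
  apply Subtype.ext
  ext x y
  rcases x with x | x <;> rcases y with y | y <;> fin_cases x <;> fin_cases y <;>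
    simp [upperUnip]

theorem mem_heckeSubgroup_iff {N q : ℕ} (hq : q ≠ 0) (γ : Gamma0 N) :
    γ ∈ heckeSubgroup N q ↔ ∀ i j, (q : ℤ) ∣ ((γ : Sp) : Mat4) (.inl i) (.inr j) := by
  constructor
  · rintro ⟨g, hg⟩ i j
    have h1 := congrFun (congrFun hg (.inl i)) (.inr j)
    rw [(mul_heckeDelta_apply _ _ _ _).2, (heckeDelta_mul_apply _ _ _ _).1] at h1
    exact ⟨_, h1⟩
  · intro h
    obtain ⟨η, hη⟩ := exists_heckeDelta_conj_of_dvd_blockB hq (γ : Sp) h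
    refine ⟨⟨η, fun i j => ?_⟩, hη⟩
    have h1 := congrFun (congrFun hη (.inr i)) (.inl j)
    rw [(mul_heckeDelta_apply _ _ _ _).1, (heckeDelta_mul_apply _ _ _ _).2] at h1
    rw [blockC_apply, ← h1]
    exact dvd_mul_of_dvd_right (γ.2 i j) _

/-- The representatives `(1 S; 0 1)`, `S` modulo `q`, of the cosets in the Hecke operator. -/
def heckeRep (N q : ℕ) (s : ZMod q × ZMod q × ZMod q) : Gamma0 N :=
  ⟨upperUnip s.1.val s.2.1.val s.2.2.val, upperUnip_mem_gamma0 _ _ _ _⟩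

/-- The subgroup is given by `B ≡ 0` modulo `q`. As `q ∣ N`, modulo `q` one has `A Dᵀ = 1`, so `B -
A S = 0` has the unique solution `S = Dᵀ B`, symmetric by the symplectic relations. -/
theorem bijective_heckeRep {N q : ℕ} (hqp : q.Prime) (hqN : q ∣ N) :
    Function.Bijective fun s : ZMod q × ZMod q × ZMod q =>
      (Quotient.mk (QuotientGroup.rightRel (heckeSubgroup N q)) (heckeRep N q s)) := by
  have : Fact q.Prime := ⟨hqp⟩
  have hval : ∀ z : ZMod q, (((z.val : ℕ) : ℤ) : ZMod q) = z := fun z => by simp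
  constructor
  · intro s t hst
    have h1 := Quotient.exact hst
    change (QuotientGroup.rightRel (heckeSubgroup N q)) _ _ at h1
    rw [QuotientGroup.rightRel_apply, mem_heckeSubgroup_iff hqp.ne_zero] at h1
    have h2 : ((heckeRep N q t * (heckeRep N q s)⁻¹ : Gamma0 N) : Sp) =
        upperUnip (t.1.val - s.1.val) (t.2.1.val - s.2.1.val) (t.2.2.val - s.2.2.val) := by
      rw [Subgroup.coe_mul, Subgroup.coe_inv, heckeRep, heckeRep, upperUnip_inv, upperUnip_mul]
      rfl
    rw [h2] at h1
    have e0 := h1 0 0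
    have e1 := h1 0 1
    have e2 := h1 1 1
    simp [upperUnip, -ZMod.natCast_val] at e0 e1 e2
    rw [← ZMod.intCast_zmod_eq_zero_iff_dvd] at e0 e1 e2
    simp only [Int.cast_sub, hval] at e0 e1 e2
    exact Prod.ext (sub_eq_zero.1 e0).symm
      (Prod.ext (sub_eq_zero.1 e1).symm (sub_eq_zero.1 e2).symm)
  · intro c
    obtain ⟨γ, rfl⟩ := Quotient.exists_rep c
    let S : Fin 2 → Fin 2 → ZMod q := fun k j =>
      (((γ : Sp) : Mat4) (.inr 0) (.inr k) * ((γ : Sp) : Mat4) (.inl 0) (.inr j) +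
        ((γ : Sp) : Mat4) (.inr 1) (.inr k) * ((γ : Sp) : Mat4) (.inl 1) (.inr j) : ℤ)
    refine ⟨(S 0 0, S 0 1, S 1 1), Quotient.sound ?_⟩
    change (QuotientGroup.rightRel (heckeSubgroup N q)) _ _
    rw [QuotientGroup.rightRel_apply, mem_heckeSubgroup_iff hqp.ne_zero]
    have hc : ∀ i j, (((γ : Sp) : Mat4) (.inr i) (.inl j) : ZMod q) = 0 := fun i j => by
      rw [ZMod.intCast_zmod_eq_zero_iff_dvd]
      exact dvd_trans (Int.natCast_dvd_natCast.2 hqN) (γ.2 i j)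
    have hrel := fun i j => congrArg (Int.cast : ℤ → ZMod q)
      ((symplectic_relations_transpose (γ : Sp)).2 i j)
    have hsym := congrArg (Int.cast : ℤ → ZMod q) (symplectic_relations (γ : Sp)).2.1
    push_cast at hrel hsym
    simp only [hc, mul_zero, sub_zero] at hrel
    have r00 := hrel 0 0
    have r01 := hrel 0 1
    have r10 := hrel 1 0
    have r11 := hrel 1 1
    simp only [if_true, zero_ne_one, one_ne_zero, if_false] at r00 r01 r10 r11
    simp only [← ZMod.intCast_zmod_eq_zero_iff_dvd, Subgroup.coe_mul, Subgroup.coe_inv, heckeRep,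
      upperUnip_inv, Fin.forall_fin_two, (mul_upperUnip_apply _ _ _ _ _).1,
      (mul_upperUnip_apply _ _ _ _ _).2, Int.cast_add, Int.cast_mul, Int.cast_neg, hval, S]
    refine ⟨⟨?_, ?_⟩, ⟨?_, ?_⟩⟩
    · linear_combination (((γ : Sp) : Mat4) (.inl 0) (.inl 1) : ZMod q) * hsym
        - (((γ : Sp) : Mat4) (.inl 0) (.inr 0) : ZMod q) * r00
        - (((γ : Sp) : Mat4) (.inl 1) (.inr 0) : ZMod q) * r01
    · linear_combination -(((γ : Sp) : Mat4) (.inl 0) (.inr 1) : ZMod q) * r00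
        - (((γ : Sp) : Mat4) (.inl 1) (.inr 1) : ZMod q) * r01
    · linear_combination (((γ : Sp) : Mat4) (.inl 1) (.inl 1) : ZMod q) * hsym
        - (((γ : Sp) : Mat4) (.inl 0) (.inr 0) : ZMod q) * r10
        - (((γ : Sp) : Mat4) (.inl 1) (.inr 0) : ZMod q) * r11
    · linear_combination -(((γ : Sp) : Mat4) (.inl 0) (.inr 1) : ZMod q) * r10
        - (((γ : Sp) : Mat4) (.inl 1) (.inr 1) : ZMod q) * r11

end Hecke

end SiegelTwo

end

noncomputable section

namespace SiegelTwo

open Matrix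

/-! ### The image of an Eisenstein series under `T(q)`. -/

section HeckeEisenstein

/-- Independence of the coset representative: changing it moves the minors by an element of `Γ₀(N)`,
and the character from `cuspWeight_act` cancels. This replaces an arbitrary representative by a
unipotent one. -/
theorem star_mul_cuspWeight_out {N N₀ N₁ N₂ q : ℕ} {χ : DirichletCharacter ℂ N}
    (h : IsCusp χ N₀ N₁ N₂) {γ T : Gamma0 N} (hγ : T * γ⁻¹ ∈ heckeSubgroup N q)
    (hT : (blockD (T : Sp)).det = 1) (v : Mat4) :
    starRingEnd ℂ (χ ((blockD (γ : Sp)).det : ZMod N)) * cuspWeight χ N₀ N₁ ((heckeDelta q)ᵀ *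
        ((((γ : Sp)⁻¹ : Sp) : Mat4)ᵀ * v * (((γ : Sp)⁻¹ : Sp) : Mat4)) * heckeDelta q) =
      cuspWeight χ N₀ N₁ ((heckeDelta q)ᵀ *
        ((((T : Sp)⁻¹ : Sp) : Mat4)ᵀ * v * (((T : Sp)⁻¹ : Sp) : Mat4)) * heckeDelta q) := by
  obtain ⟨g, hg⟩ := hγ
  have e1 : (((γ : Sp)⁻¹ : Sp) : Mat4) * heckeDelta q =
      (((T : Sp)⁻¹ : Sp) : Mat4) * heckeDelta q * ((g : Sp) : Mat4) := by
    rw [Matrix.mul_assoc, ← hg, ← Matrix.mul_assoc, ← Submonoid.coe_mul, Subgroup.coe_mul,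
      Subgroup.coe_inv, inv_mul_cancel_left]
  have e2 : (heckeDelta q)ᵀ * ((((γ : Sp)⁻¹ : Sp) : Mat4)ᵀ * v * (((γ : Sp)⁻¹ : Sp) : Mat4)) *
      heckeDelta q = ((g : Sp) : Mat4)ᵀ * ((heckeDelta q)ᵀ *
        ((((T : Sp)⁻¹ : Sp) : Mat4)ᵀ * v * (((T : Sp)⁻¹ : Sp) : Mat4)) * heckeDelta q) *
          ((g : Sp) : Mat4) := by
    calc _ = ((((γ : Sp)⁻¹ : Sp) : Mat4) * heckeDelta q)ᵀ * v *
          ((((γ : Sp)⁻¹ : Sp) : Mat4) * heckeDelta q) := by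
          simp only [transpose_mul, Matrix.mul_assoc]
      _ = _ := by
          rw [e1]
          simp only [transpose_mul, Matrix.mul_assoc]
  have hD : blockD (g : Sp) = blockD ((T * γ⁻¹ : Gamma0 N) : Sp) := by
    ext i j
    have h1 := congrFun (congrFun hg (.inr i)) (.inr j)
    rw [(mul_heckeDelta_apply _ _ _ _).2, (heckeDelta_mul_apply _ _ _ _).2] at h1
    exact h1.symm
  have h3 := det_blockD_mul χ (γ := ((T * γ⁻¹ : Gamma0 N) : Sp)) (η := γ) (T * γ⁻¹ : Gamma0 N).2
  rw [Subgroup.coe_mul, Subgroup.coe_inv, inv_mul_cancel_right, hT, Int.cast_one, map_one] at h3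
  rw [e2, cuspWeight_act h _ g.2, hD, ← mul_assoc, ← map_mul, mul_comm (χ _), Subgroup.coe_mul,
    Subgroup.coe_inv, ← h3, map_one, one_mul]

/-- `𝔼_ρ | T(q)` as a sum over matrices of minors and symmetric matrices modulo `q`. -/
theorem heckeT_eisensteinCusp {N N₀ N₁ N₂ q k : ℕ} {χ : DirichletCharacter ℂ N}
    (h : IsCusp χ N₀ N₁ N₂) [Fact q.Prime] (hq : q ∣ N₀)
    {τ : Matrix (Fin 2) (Fin 2) ℂ} (hτ : τ ∈ upperHalf) :
    heckeT N χ k q (eisensteinCusp N χ k N₀ N₁ N₂) τ =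
      ((q : ℂ) ^ 3)⁻¹ * ∑ s : ZMod q × ZMod q × ZMod q, (1 / 2) * ∑' v : Mat4,
        cuspWeight χ N₀ N₁ ((heckeDelta q)ᵀ *
          ((upperUnip (-s.1.val) (-s.2.1.val) (-s.2.2.val) : Mat4)ᵀ * v *
            (upperUnip (-s.1.val) (-s.2.1.val) (-s.2.2.val) : Mat4)) * heckeDelta q) *
          plForm v τ ^ (-(k : ℤ)) := by
  have hqp : q.Prime := Fact.out
  have hq0 : (q : ℂ) ≠ 0 := by exact_mod_cast hqp.ne_zero
  have hqN : q ∣ N := by rw [← h.mul_eq, mul_assoc]; exact hq.mul_right _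
  rw [heckeT, ← finsum_eq_of_bijective (f := fun s : ZMod q × ZMod q × ZMod q => ((q : ℂ) ^ k)⁻¹ *
    ((1 / 2) * ∑' v : Mat4, cuspWeight χ N₀ N₁ ((heckeDelta q)ᵀ *
          ((upperUnip (-s.1.val) (-s.2.1.val) (-s.2.2.val) : Mat4)ᵀ * v *
            (upperUnip (-s.1.val) (-s.2.1.val) (-s.2.2.val) : Mat4)) * heckeDelta q) *
          plForm v τ ^ (-(k : ℤ)))) _ (bijective_heckeRep hqp hqN) ?_]
  · rw [finsum_eq_sum_of_fintype, ← Finset.mul_sum, ← mul_assoc]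
    congr 1
    rw [zpow_sub₀ hq0, zpow_natCast]
    field_simp
  · intro s
    have hout := Quotient.mk_out (s := QuotientGroup.rightRel (heckeSubgroup N q)) (heckeRep N q s)
    change (QuotientGroup.rightRel (heckeSubgroup N q)) _ _ at hout
    rw [QuotientGroup.rightRel_apply] at hout
    have key := star_mul_cuspWeight_out h hout (by
      rw [heckeRep, blockD_upperUnip, det_one])
    rw [slash_heckeDelta_inv_mul h hqp hq _ hτ, mul_left_comm _ (1 / 2 : ℂ), mul_left_comm _ (1 / 2 : ℂ),
      mul_left_comm _ (1 / 2 : ℂ), mul_left_comm (starRingEnd ℂ _)]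
    congr 2
    rw [← tsum_mul_left]
    refine tsum_congr fun v => ?_
    rw [← mul_assoc (starRingEnd ℂ _), key, heckeRep, upperUnip_inv]

theorem cE_upperUnip_neg_val {q : ℕ} [NeZero q] {v : Mat4} (hv : v ∈ plueckerSet)
    (s₁ s₂ s₃ : ZMod q) :
    ((cE ((upperUnip (-s₁.val) (-s₂.val) (-s₃.val) : Mat4)ᵀ * v *
      (upperUnip (-s₁.val) (-s₂.val) (-s₃.val) : Mat4)) : ℤ) : ZMod q) =
      cB v * s₁ * s₃ - cB v * s₂ ^ 2 - cX v * s₁ - 2 * cY v * s₂ - cZ v * s₃ + cE v := by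
  have hval : ∀ z : ZMod q, (((z.val : ℕ) : ℤ) : ZMod q) = z := fun z => by simp
  rw [(coords_upperUnip hv _ _ _).2.2.2.2]
  simp only [Int.cast_add, Int.cast_mul, Int.cast_neg, Int.cast_sub, Int.cast_pow, hval,
    Int.cast_ofNat]
  ring

/-- `𝔼_ρ | T(q)` in terms of the weights at `q` and away from `q`. -/
theorem heckeT_eisensteinCusp_eq_tsum {N N₀ N₁ N₂ q k : ℕ} {χ : DirichletCharacter ℂ N}
    (h : IsCusp χ N₀ N₁ N₂) [Fact q.Prime] (hq : q ∣ N₀) (hk : 4 ≤ k)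
    {τ : Matrix (Fin 2) (Fin 2) ℂ} (hτ : τ ∈ upperHalf) (W : Mat4 → ℂ)
    (hW : ∀ v ∈ plueckerSet, ∑ s₁ : ZMod q, ∑ s₂ : ZMod q, ∑ s₃ : ZMod q,
      starRingEnd ℂ (charPart χ q
        (cB v * s₁ * s₃ - cB v * s₂ ^ 2 - cX v * s₁ - 2 * cY v * s₂ - cZ v * s₃ + cE v)) =
      (q : ℂ) ^ 3 * W v) :
    heckeT N χ k q (eisensteinCusp N χ k N₀ N₁ N₂) τ =
      charPart χ N₁ (q : ZMod N₁) * charPart χ N₂ ((q : ZMod N₂) ^ 2) *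
        ((1 / 2) * ∑' v : Mat4, weightAway χ N₀ N₁ q v * W v * plForm v τ ^ (-(k : ℤ))) := by
  have hqp : q.Prime := Fact.out
  have hq0 : (q : ℂ) ≠ 0 := by exact_mod_cast hqp.ne_zero
  have hqN : q ∈ N.primeFactors := Nat.mem_primeFactors.2 ⟨hqp, by
    rw [← h.mul_eq, mul_assoc]; exact hq.mul_right _, h.squarefree.ne_zero⟩
  -- Interchanging the finite sum over `S` with the series uses absolute convergence.
  rw [heckeT_eisensteinCusp h hq hτ, ← Finset.mul_sum, ← Summable.tsum_finsetSum]
  · rw [mul_left_comm _ (1 / 2 : ℂ), mul_left_comm _ (1 / 2 : ℂ)]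
    congr 1
    rw [← tsum_mul_left, ← tsum_mul_left]
    refine tsum_congr fun v => ?_
    simp only [cuspWeight_heckeDelta_upperUnip χ hqN hq, prod_deltaFactor h hqp hq]
    by_cases hv : v ∈ plueckerSet
    · rw [← Finset.sum_mul, ← Finset.mul_sum, Fintype.sum_prod_type]
      simp only [Fintype.sum_prod_type, cE_upperUnip_neg_val hv]
      rw [hW v hv]
      field_simp
    · simp [weightAway, hv]
  · intro s _
    refine summable_mul_plForm hτ hk (fun u => norm_cuspWeight_le _ _ _ _) fun u hu => ?_
    rw [cuspWeight_heckeDelta_upperUnip χ hqN hq]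
    simp [weightAway, hu]

end HeckeEisenstein

end SiegelTwo

end

/-! ### The action of `T(q)` on `𝔼_ρ`. -/

open SiegelTwo in
theorem proposition3p7 (N N₀ N₁ N₂ k q : ℕ) [Fact q.Prime] (χ : DirichletCharacter ℂ N)
    (hk : 4 ≤ k) (hN : Squarefree N) (hρ : N₀ * N₁ * N₂ = N)
    (hχ : (charPart χ N₁) ^ 2 = 1) (hq : q ∣ N₀) :
    (charPart χ q = 1 → ∀ τ ∈ upperHalf,
      heckeT N χ k q (eisensteinCusp N χ k N₀ N₁ N₂) τ =
        charPart χ N₁ (q : ZMod N₁) * charPart χ N₂ ((q : ZMod N₂) ^ 2) *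
          (eisensteinCusp N χ k N₀ N₁ N₂ τ
            + (q : ℂ)⁻¹ * ((q : ℂ) - 1) * eisensteinCusp N χ k (N₀ / q) (q * N₁) N₂ τ
            + (q : ℂ)⁻¹ * ((q : ℂ) - 1) * eisensteinCusp N χ k (N₀ / q) N₁ (q * N₂) τ)) ∧
    ((charPart χ q) ^ 2 = 1 → charPart χ q ≠ 1 → ∀ τ ∈ upperHalf,
      heckeT N χ k q (eisensteinCusp N χ k N₀ N₁ N₂) τ =
        charPart χ N₁ (q : ZMod N₁) * charPart χ N₂ ((q : ZMod N₂) ^ 2) *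
          (eisensteinCusp N χ k N₀ N₁ N₂ τ
            + (legendreSym q (-1) : ℂ) * ((q : ℂ) ^ 2)⁻¹ * ((q : ℂ) - 1) *
              eisensteinCusp N χ k (N₀ / q) N₁ (q * N₂) τ)) ∧
    ((charPart χ q) ^ 2 ≠ 1 → ∀ τ ∈ upperHalf,
      heckeT N χ k q (eisensteinCusp N χ k N₀ N₁ N₂) τ =
        charPart χ N₁ (q : ZMod N₁) * charPart χ N₂ ((q : ZMod N₂) ^ 2) *
          eisensteinCusp N χ k N₀ N₁ N₂ τ) := by
  have hqp : q.Prime := Fact.out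
  obtain ⟨M, rfl⟩ := hq
  rw [Nat.mul_div_cancel_left M hqp.pos]
  have hN1 : N₁ ∣ N := ⟨q * M * N₂, by rw [← hρ]; ring⟩
  have hN0 := hN.ne_zero
  have hqN : q ∈ N.primeFactors := Nat.mem_primeFactors.2 ⟨hqp, ⟨M * N₁ * N₂, by
    rw [← hρ]; ring⟩, hN0⟩
  have hsq : ∀ r, r.Prime → r ∣ N₁ → charPart χ r ^ 2 = 1 := fun r _ hr =>
    charPart_sq_eq_one χ hN hN1 hr hχ
  have hcop : q.Coprime (M * N₁ * N₂) := Nat.coprime_of_squarefree_mul (by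
    rw [← mul_assoc, ← mul_assoc, hρ]; exact hN)
  have hndvd : ∀ {d : ℕ}, d ∣ M * N₁ * N₂ → ¬ q ∣ d := fun hd hqd =>
    hqp.one_lt.ne' (Nat.dvd_one.1 (hcop ▸ Nat.dvd_gcd dvd_rfl (hqd.trans hd)))
  have hqM : ¬ q ∣ M := hndvd ⟨N₁ * N₂, by ring⟩
  have hqN1 : ¬ q ∣ N₁ := hndvd ⟨M * N₂, by ring⟩
  have h : IsCusp χ (q * M) N₁ N₂ := ⟨hN, hρ, hsq⟩
  have h'' : IsCusp χ M N₁ (q * N₂) := ⟨hN, by rw [← hρ]; ring, hsq⟩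
  have hiff : ∀ m, ∀ r ∈ N.primeFactors.erase q, (r ∣ q * m ↔ r ∣ m) := fun m r hr => by
    rw [Finset.mem_erase] at hr
    have hrp := Nat.prime_of_mem_primeFactors hr.2
    rw [hrp.dvd_mul, Nat.prime_dvd_prime_iff_eq hrp hqp]
    simp [hr.1]
  -- The three cusps differ only at `q`, so their weights share the factor away from `q`.
  have haway'' : ∀ v, weightAway χ M N₁ q v = weightAway χ (q * M) N₁ q v :=
    weightAway_congr χ fun r hr => ⟨(hiff M r hr).symm, Iff.rfl⟩
  have haway' : ∀ v, weightAway χ M (q * N₁) q v = weightAway χ (q * M) N₁ q v :=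
    weightAway_congr χ fun r hr => ⟨(hiff M r hr).symm, hiff N₁ r hr⟩
  have hsum := fun v (hv : v ∈ plueckerSet) => sum_star_charPart χ (N₀ := q * M) (N₁ := N₁)
    (M₀ := M) (M₁ := q * N₁) (dvd_mul_right _ _) hqM hqN1 (dvd_mul_right _ _) hv _ rfl
  have hS : ∀ {τ}, τ ∈ upperHalf → ∀ A B, Summable fun u =>
      cuspWeight χ A B u * plForm u τ ^ (-(k : ℤ)) := fun hτ A B =>
    summable_mul_plForm hτ hk (norm_cuspWeight_le χ A B) fun u hu => cuspWeight_of_notMem χ A B hu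
  refine ⟨fun h1 τ hτ => ?_, fun h2 h1 τ hτ => ?_, fun h2 τ hτ => ?_⟩
  -- The condition `χ_r² = 1` for `ρ'` includes `r = q`, where it follows from `χ_q = 1`.
  · have h' : IsCusp χ M (q * N₁) N₂ := ⟨hN, by rw [← hρ]; ring, fun r hr hd => by
      rcases hr.dvd_mul.1 hd with hd | hd
      · rw [(Nat.prime_dvd_prime_iff_eq hr hqp).1 hd, h1, one_pow]
      · exact hsq r hr hd⟩
    rw [heckeT_eisensteinCusp_eq_tsum h (dvd_mul_right _ _) hk hτ _
      fun v hv => (hsum v hv).1 h1, eisensteinCusp_eq_tsum h, eisensteinCusp_eq_tsum h',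
      eisensteinCusp_eq_tsum h'']
    congr 1
    rw [mul_left_comm _ (1 / 2 : ℂ), mul_left_comm _ (1 / 2 : ℂ), ← mul_add, ← mul_add]
    congr 1
    rw [← tsum_mul_left, ← tsum_mul_left, ← (hS hτ _ _).tsum_add ((hS hτ _ _).mul_left _),
      ← ((hS hτ _ _).add ((hS hτ _ _).mul_left _)).tsum_add ((hS hτ _ _).mul_left _)]
    refine tsum_congr fun v => ?_
    rw [cuspWeight_eq_mul χ _ _ hqN, cuspWeight_eq_mul χ _ _ hqN, cuspWeight_eq_mul χ _ _ hqN,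
      haway', haway'']
    ring
  · rw [heckeT_eisensteinCusp_eq_tsum h (dvd_mul_right _ _) hk hτ _
      fun v hv => (hsum v hv).2.1 h2 h1, eisensteinCusp_eq_tsum h, eisensteinCusp_eq_tsum h'']
    congr 1
    rw [mul_left_comm _ (1 / 2 : ℂ), ← mul_add]
    congr 1
    rw [← tsum_mul_left, ← (hS hτ _ _).tsum_add ((hS hτ _ _).mul_left _)]
    refine tsum_congr fun v => ?_
    rw [cuspWeight_eq_mul χ _ _ hqN, cuspWeight_eq_mul χ _ _ hqN, haway'']
    ring
  · rw [heckeT_eisensteinCusp_eq_tsum h (dvd_mul_right _ _) hk hτ _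
      fun v hv => (hsum v hv).2.2 h2, eisensteinCusp_eq_tsum h]
    congr 2
    refine tsum_congr fun v => ?_
    rw [cuspWeight_eq_mul χ _ _ hqN]
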